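/- Weighted graphs are finite, simple and undirected, with nonnegative real edge weights and vertex set contained in $\{0,\dots,n-1\}$; $\mathrm{dist}_G(u,v)\in[0,\infty]$ is the shortest-path distance. For a graph $G$, a set $T$ of terminals and $\varepsilon>0$, a *$(1+\varepsilon)$-distance approximating minor* of $G$ with respect to $T$ is a weighted graph $H$ (with its own weights) with $T\subseteq V(H)$ that is a minor of $G$ in which every terminal $t$ lies in its own branch set, and that satisfies $\mathrm{dist}_G(u,v)\le \mathrm{dist}_H(u,v)\le(1+\varepsilon)\,\mathrm{dist}_G(u,v)$ for all $u,v\in T$. Its size is $|V(H)|+|E(H)|$. For a real $c$ let $A(c)$ be the following hypothesis: there is a deterministic algorithm that, given $n\ge 1$, $\varepsilon=1/q$ (with $q\ge1$ an integer), a planar weighted graph $G$ with $m$ edges on vertices in $\{0,\dots,n-1\}$, and a set $T$ of $k$ vertices, constructs a $(1+\varepsilon)$-distance approximating minor of $G$ with respect to $T$ of size at most $k^{c}\cdot\mathrm{poly}(1/\varepsilon,\log n)$ in time $(m+k+1)\cdot\mathrm{poly}(1/\varepsilon,\log n)$. An *offline dynamic $(1+\varepsilon')$-approximate distance oracle for planar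 graphs with update and query time $u(n)$* is a deterministic algorithm that is given $n \ge 1$, an initial planar weighted graph $G_0$ on vertices in $\{0,\dots,n-1\}$ and, in advance, the whole sequence of operations (insertion of an absent weighted edge, deletion of a present edge, or query of a pair of vertices) such that the graph is planar at all times; it outputs for each query $(x,y)$ a number $\delta$ with $\mathrm{dist}(x,y)\le\delta\le(1+\varepsilon')\,\mathrm{dist}(x,y)$ in the graph at the time of the query, in total time at most $u(n)$ times (number of operations $+\,|E(G_0)|+1$). Time is counted on a sequential pointer machine whose integer arithmetic is charged by bit length, with exact unit-cost arithmetic and comparisons on reals; this is equivalent to a RAM up to polylogarithmic factors. **Theorem.** Let $0<\gamma\le 1/3$ be a constant. 1. If $A\big(2/(1+3\gamma)\big)$ holds, then for every constant $\varepsilon'>0$ there is an offline dynamic $(1+\varepsilon')$-approximate distance oracle for planar graphs with update and query time $u(n)=O(n^{1/2-\gamma/2})$. 2. If $A(1)$ holds, then for every constant $\varepsilon'>0$ there is such an oracle with update and query time $u(n)=\mathrm{poly}(\log n)$, where the degree of the polynomial does not depend on $\varepsilon'$. 3. Planarity is preserved in hierarchies of sparsifiers. Take a sequence of operations as above under which the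 graph is planar at all times. For an interval $I$ of operations let $P_I$ be the graph of the edges that are present throughout $I$, and let $\partial_I$ be the set of the vertices that are queried, or are endpoints of an edge that is inserted or deleted, in $I$. Take nested nonempty intervals $I_0\supseteq I_1\supseteq\dots\supseteq I_p$ where $I_0$ is the whole sequence, let $G'_0=G''_0=P_{I_0}$, and for $i\ge1$ let $G''_i=G'_{i-1}\cup(P_{I_i}\setminus P_{I_{i-1}})$ and let $G'_i$ be any $(1+\varepsilon)$-distance approximating minor of $G''_i$ with respect to $\partial_{I_i}$ (new names of nonterminals being arbitrary vertices in $\{0,\dots,n-1\}$). Then all the graphs $G''_i$ and $G'_i$ are planar. -/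

import Mathlib

open scoped NNReal ENNReal

namespace DynDist

/-! ## Planar graphs and minors -/

section Graphs

variable {V : Type*}

/-- The involution of the darts (oriented edges) of a graph that reverses every dart. -/
def dartRev (G : SimpleGraph V) : Equiv.Perm G.Dart where
  toFun d := d.symm
  invFun d := d.symm
  left_inv d := d.symm_symm
  right_inv d := d.symm_symm

/-- `σ` is a rotation system of `G`: for each vertex, it permutes the darts that leave the vertex
in one single cycle (the cyclic order of the edges around the vertex). -/
def IsRotation (G : SimpleGraph V) (σ : Equiv.Perm G.Dart) : Prop :=
  ∀ d e : G.Dart, σ.SameCycle d e ↔ d.fst = e.fst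

/-- The number of faces of a rotation system: the number of cycles of the permutation that walks
along a dart and then takes the next dart in the rotation around the endpoint. -/
noncomputable def faceCount (G : SimpleGraph V) (σ : Equiv.Perm G.Dart) : ℕ :=
  Nat.card (Quotient (Equiv.Perm.SameCycle.setoid (σ * dartRev G)))

/-- A finite graph is planar if it has a combinatorial planar embedding, that is, a rotation system
of genus zero. For each connected component with at least one edge, every rotation system satisfies
`#vertices - #edges + #faces = 2 - 2 * genus` with `genus ≥ 0`; the equation below is the
sum of these equalities with all the genera equal to zero. Isolated vertices play no role. -/
def IsPlanar (G : SimpleGraph V) : Prop :=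
  ∃ σ : Equiv.Perm G.Dart, IsRotation G σ ∧
    Nat.card G.support + faceCount G σ =
      Nat.card G.edgeSet + 2 * Nat.card (G.induce G.support).ConnectedComponent

/-- `H`, considered as a graph with the vertex set `T ∪ H.support`, is a minor of `G` that contains
the terminals `T`: there are pairwise disjoint connected nonempty branch sets in `G`, one for each
vertex of `H`, with an edge of `G` between the branch sets of adjacent vertices of `H`,
and every terminal lies in its own branch set (so it keeps its name, and no two terminals are
contracted into one vertex). The names of the other vertices of `H` are arbitrary. -/
def IsTerminalMinor (G : SimpleGraph V) (T : Set V) (H : SimpleGraph V) : Prop :=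
  ∃ B : V → Set V,
    (∀ v ∈ T ∪ H.support, (G.induce (B v)).Connected) ∧
    (T ∪ H.support).PairwiseDisjoint B ∧
    (∀ t ∈ T, t ∈ B t) ∧
    ∀ u v, H.Adj u v → ∃ x ∈ B u, ∃ y ∈ B v, G.Adj x y

end Graphs

/-! ## Weighted graphs and distances -/

/-- An undirected graph on the vertices `0, …, n - 1` with nonnegative real edge weights, given by
the list of its edges `(u, v, w)`. -/
abbrev WGraph (n : ℕ) := List (Fin n × Fin n × ℝ≥0)

variable {n : ℕ}

/-- The two endpoints of an edge. -/
def ends (e : Fin n × Fin n × ℝ≥0) : Sym2 (Fin n) := s(e.1, e.2.1)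

/-- The list has no loops and no parallel edges. -/
def WGraph.Simple (G : WGraph n) : Prop :=
  (∀ e ∈ G, e.1 ≠ e.2.1) ∧ (G.map ends).Nodup

/-- The underlying unweighted graph. -/
def WGraph.toGraph (G : WGraph n) : SimpleGraph (Fin n) :=
  SimpleGraph.fromEdgeSet {p | p ∈ G.map ends}

/-- The weight of the edge `uv` (the least one, if a list has parallel entries). -/
noncomputable def WGraph.weight (G : WGraph n) (u v : Fin n) : ℝ≥0∞ :=
  ⨅ e ∈ {e | e ∈ G ∧ ends e = s(u, v)}, (e.2.2 : ℝ≥0∞)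

/-- The length of a shortest path from `u` to `v`; it is `∞` if there is no path. -/
noncomputable def WGraph.dist (G : WGraph n) (u v : Fin n) : ℝ≥0∞ :=
  ⨅ p : G.toGraph.Walk u v, (p.darts.map fun d => G.weight d.fst d.snd).sum

/-- `H` is a `(1 + ε)`-distance approximating minor of `G` with respect to the terminals `T`. -/
def IsDistApproxMinor (ε : ℝ) (G : WGraph n) (T : Set (Fin n)) (H : WGraph n) : Prop :=
  IsTerminalMinor G.toGraph T H.toGraph ∧
  ∀ u ∈ T, ∀ v ∈ T,
    G.dist u v ≤ H.dist u v ∧ H.dist u v ≤ ENNReal.ofReal (1 + ε) * G.dist u v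

/-- The number of vertices plus the number of edges of `H`, the vertex set being
`T ∪ H.toGraph.support`. -/
noncomputable def WGraph.size (H : WGraph n) (T : Set (Fin n)) : ℕ :=
  (T ∪ H.toGraph.support).ncard + H.length

/-! ## Offline dynamic graphs -/

/-- The operations on a dynamic graph. -/
inductive Op (n : ℕ) where
  | insert (u v : Fin n) (w : ℝ≥0)
  | delete (u v : Fin n)
  | query (u v : Fin n)

/-- The two vertices that an operation names. -/
def Op.ends : Op n → Sym2 (Fin n)
  | .insert u v _ => s(u, v)
  | .delete u v => s(u, v)
  | .query u v => s(u, v)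

/-- The graph after an operation. -/
def WGraph.step (G : WGraph n) : Op n → WGraph n
  | .insert u v w => (u, v, w) :: G
  | .delete u v => G.filter fun e => DynDist.ends e ≠ s(u, v)
  | .query _ _ => G

/-- An operation may be applied: only absent edges are inserted, only present ones are deleted. -/
def Op.Legal (G : WGraph n) : Op n → Prop
  | .insert u v _ => u ≠ v ∧ ¬ G.toGraph.Adj u v
  | .delete u v => G.toGraph.Adj u v
  | .query _ _ => True

/-- All the operations are legal and the graph is planar at all times. -/
def PlanarRun (G : WGraph n) : List (Op n) → Prop
  | [] => IsPlanar G.toGraph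
  | x :: ops => IsPlanar G.toGraph ∧ x.Legal G ∧ PlanarRun (G.step x) ops

/-- `ans` lists, for the queries in their order, estimates `δ` of the distance `d` in the current
graph with `d ≤ δ ≤ (1 + ε) d`. -/
def ApproxAnswers (ε : ℝ) : WGraph n → List (Op n) → List ℝ≥0∞ → Prop
  | _, [], ans => ans = []
  | _, .query _ _ :: _, [] => False
  | G, .query u v :: ops, a :: ans =>
      (G.dist u v ≤ a ∧ a ≤ ENNReal.ofReal (1 + ε) * G.dist u v) ∧ ApproxAnswers ε G ops ans
  | G, .insert u v w :: ops, ans => ApproxAnswers ε (G.step (.insert u v w)) ops ans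
  | G, .delete u v :: ops, ans => ApproxAnswers ε (G.step (.delete u v)) ops ans

/-! ## Hierarchies of sparsifiers over the intervals of a sequence of operations

The operations are numbered from `0`; an interval `[r, s)` is the block of the operations
`r, …, s - 1`. -/

/-- The block `[r, s)` of operations. -/
def block (ops : List (Op n)) (r s : ℕ) : List (Op n) := (ops.drop r).take (s - r)

/-- The edges that are present throughout the interval `[r, s)`: they are present when it begins,
and no operation of the interval deletes them. -/
def permanent (G : WGraph n) (ops : List (Op n)) (r s : ℕ) : WGraph n :=
  ((ops.take r).foldl WGraph.step G).filter fun e =>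
    ends e ∉ (block ops r s).filterMap fun x =>
      match x with
      | .delete u v => some s(u, v)
      | _ => none

/-- The boundary of the interval `[r, s)`: the endpoints of the edges that are inserted or deleted
in it, and the vertices that are queried in it. -/
def boundary (ops : List (Op n)) (r s : ℕ) : Set (Fin n) :=
  {v | ∃ x ∈ block ops r s, v ∈ x.ends}

/-- The edges that are permanent for `[r, s)` but not for the larger interval `[q, t)`. -/
def newPermanent (G : WGraph n) (ops : List (Op n)) (q t r s : ℕ) : WGraph n :=
  (permanent G ops r s).filter fun e => ends e ∉ (permanent G ops q t).map ends

/-- `Hierarchy ε G ops r s G'' G'`: following a chain of nested intervals from the whole sequence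
down to `[r, s)`, one can obtain the graph `G''` and its sparsifier `G'` at `[r, s)`.
At the root they are the graph of the permanent edges (without edges, if `G` has none). At a
child `[r, s)` of `[q, t)`, `G''` is the union of the sparsifier of `[q, t)` with the new permanent
edges, and `G'` is any `(1 + ε)`-distance approximating minor of `G''` with respect to the
boundary of `[r, s)`. -/
inductive Hierarchy (ε : ℝ) (G : WGraph n) (ops : List (Op n)) :
    ℕ → ℕ → WGraph n → WGraph n → Prop
  | root : Hierarchy ε G ops 0 ops.length
      (permanent G ops 0 ops.length) (permanent G ops 0 ops.length)
  | child {q t r s : ℕ} {K'' K' G' : WGraph n} :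
      Hierarchy ε G ops q t K'' K' → q ≤ r → r < s → s ≤ t →
      IsDistApproxMinor ε (K' ++ newPermanent G ops q t r s) (boundary ops r s) G' →
      Hierarchy ε G ops r s (K' ++ newPermanent G ops q t r s) G'

/-! ## The machine model

A sequential pointer machine with real arithmetic. The data are naturals (charged by their bit
length), reals (as on a real RAM: exact arithmetic and comparisons at unit cost, no rounding),
and pairs, which are created, taken apart and shared at unit cost. A program is a finite
expression, uniform in all the inputs. A RAM simulates it with constant overhead per unit of cost,
and it simulates a RAM, with memory kept in a balanced tree, up to logarithmic factors. -/

/-- The data of the machine. -/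
inductive Val where
  | nat (a : ℕ)
  | real (x : ℝ)
  | pair (a b : Val)

/-- Arithmetic on naturals (truncated subtraction, floor division, `le` returns `1` or `0`). -/
inductive NatOp where
  | add | sub | mul | div | le

def NatOp.eval : NatOp → ℕ → ℕ → ℕ
  | .add, a, b => a + b
  | .sub, a, b => a - b
  | .mul, a, b => a * b
  | .div, a, b => a / b
  | .le, a, b => if a ≤ b then 1 else 0

/-- Arithmetic on reals. -/
inductive RealOp where
  | add | sub | mul | div

noncomputable def RealOp.eval : RealOp → ℝ → ℝ → ℝ
  | .add, x, y => x + y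
  | .sub, x, y => x - y
  | .mul, x, y => x * y
  | .div, x, y => x / y

/-- Programs. -/
inductive Code where
  | id
  | const (k : ℕ)
  | fst
  | snd
  | isPair
  | natOp (o : NatOp)
  | realOp (o : RealOp)
  | realLe
  | toReal
  | pair (f g : Code)
  | comp (g f : Code)
  | ite (c f g : Code)
  | loop (f : Code)

/-- `c.Runs x y t`: on the input `x`, the program `c` halts with the output `y` after `t` steps. -/
inductive Code.Runs : Code → Val → Val → ℕ → Prop
  | id (x : Val) : Runs .id x x 1
  | const (k : ℕ) (x : Val) : Runs (.const k) x (.nat k) 1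
  | fst (a b : Val) : Runs .fst (.pair a b) a 1
  | snd (a b : Val) : Runs .snd (.pair a b) b 1
  | isPair_pair (a b : Val) : Runs .isPair (.pair a b) (.nat 1) 1
  | isPair_nat (a : ℕ) : Runs .isPair (.nat a) (.nat 0) 1
  | isPair_real (x : ℝ) : Runs .isPair (.real x) (.nat 0) 1
  | natOp (o : NatOp) (a b : ℕ) :
      Runs (.natOp o) (.pair (.nat a) (.nat b)) (.nat (o.eval a b)) ((1 + a.size) * (1 + b.size))
  | realOp (o : RealOp) (x y : ℝ) :
      Runs (.realOp o) (.pair (.real x) (.real y)) (.real (o.eval x y)) 1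
  | realLe_true (x y : ℝ) (h : x ≤ y) : Runs .realLe (.pair (.real x) (.real y)) (.nat 1) 1
  | realLe_false (x y : ℝ) (h : y < x) : Runs .realLe (.pair (.real x) (.real y)) (.nat 0) 1
  | toReal (a : ℕ) : Runs .toReal (.nat a) (.real a) (1 + a.size)
  | pair {f g : Code} {x a b : Val} {s t : ℕ} :
      Runs f x a s → Runs g x b t → Runs (.pair f g) x (.pair a b) (s + t + 1)
  | comp {f g : Code} {x y z : Val} {s t : ℕ} :
      Runs f x y s → Runs g y z t → Runs (.comp g f) x z (s + t + 1)
  | ite_true {c f g : Code} {x y : Val} {k s t : ℕ} :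
      Runs c x (.nat (k + 1)) s → Runs f x y t → Runs (.ite c f g) x y (s + t + 1)
  | ite_false {c f g : Code} {x y : Val} {s t : ℕ} :
      Runs c x (.nat 0) s → Runs g x y t → Runs (.ite c f g) x y (s + t + 1)
  | loop_done {f : Code} {x y : Val} {s : ℕ} :
      Runs f x (.pair (.nat 0) y) s → Runs (.loop f) x y (s + 1)
  | loop_step {f : Code} {x y z : Val} {k s t : ℕ} :
      Runs f x (.pair (.nat (k + 1)) y) s → Runs (.loop f) y z t →
      Runs (.loop f) x z (s + t + 1)

/-- The machine is deterministic: the output and the number of steps are unique. -/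
theorem Code.Runs.unique {c : Code} {x y : Val} {t : ℕ} (h : c.Runs x y t) :
    ∀ {y' : Val} {t' : ℕ}, c.Runs x y' t' → y = y' ∧ t = t' := by
  induction h with
  | realLe_true x y h =>
    intro y' t' h'; cases h' with
    | realLe_true => exact ⟨rfl, rfl⟩
    | realLe_false _ _ h2 => exact absurd h (not_le.mpr h2)
  | realLe_false x y h =>
    intro y' t' h'; cases h' with
    | realLe_true _ _ h2 => exact absurd h2 (not_le.mpr h)
    | realLe_false => exact ⟨rfl, rfl⟩
  | pair _ _ i1 i2 =>
    intro y' t' h'; cases h' with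
    | pair a b =>
      obtain ⟨rfl, rfl⟩ := i1 a
      obtain ⟨rfl, rfl⟩ := i2 b
      exact ⟨rfl, rfl⟩
  | comp _ _ i1 i2 =>
    intro y' t' h'; cases h' with
    | comp a b =>
      obtain ⟨rfl, rfl⟩ := i1 a
      obtain ⟨rfl, rfl⟩ := i2 b
      exact ⟨rfl, rfl⟩
  | ite_true _ _ i1 i2 =>
    intro y' t' h'; cases h' with
    | ite_true a b =>
      obtain ⟨_, rfl⟩ := i1 a
      obtain ⟨rfl, rfl⟩ := i2 b
      exact ⟨rfl, rfl⟩
    | ite_false a b => exact absurd (i1 a).1 (by simp)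
  | ite_false _ _ i1 i2 =>
    intro y' t' h'; cases h' with
    | ite_true a b => exact absurd (i1 a).1 (by simp)
    | ite_false a b =>
      obtain ⟨_, rfl⟩ := i1 a
      obtain ⟨rfl, rfl⟩ := i2 b
      exact ⟨rfl, rfl⟩
  | loop_done _ i1 =>
    intro y' t' h'; cases h' with
    | loop_done a =>
      obtain ⟨h1, rfl⟩ := i1 a
      cases h1
      exact ⟨rfl, rfl⟩
    | loop_step a b => exact absurd (i1 a).1 (by simp)
  | loop_step _ _ i1 i2 =>
    intro y' t' h'; cases h' with
    | loop_done a => exact absurd (i1 a).1 (by simp)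
    | loop_step a b =>
      obtain ⟨h1, rfl⟩ := i1 a
      cases h1
      obtain ⟨rfl, rfl⟩ := i2 b
      exact ⟨rfl, rfl⟩
  | _ => intro y' t' h'; cases h'; exact ⟨rfl, rfl⟩

/-! ## Inputs and outputs -/

/-- Lists are chains of pairs that end in `0`. -/
def encList {α : Type*} (f : α → Val) : List α → Val
  | [] => .nat 0
  | a :: l => .pair (f a) (encList f l)

def encVertex (v : Fin n) : Val := .nat v

def encEdge (e : Fin n × Fin n × ℝ≥0) : Val :=
  .pair (encVertex e.1) (.pair (encVertex e.2.1) (.real e.2.2))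

def encGraph (G : WGraph n) : Val := encList encEdge G

def encOp : Op n → Val
  | .insert u v w => .pair (.nat 0) (encEdge (u, v, w))
  | .delete u v => .pair (.nat 1) (.pair (encVertex u) (encVertex v))
  | .query u v => .pair (.nat 2) (.pair (encVertex u) (encVertex v))

/-- An answer is a real, or the natural number `0` for the distance `∞`. -/
noncomputable def encAnswer (a : ℝ≥0∞) : Val :=
  if a = ∞ then .nat 0 else .real a.toReal

/-! ## The two kinds of algorithms -/

/-- The order of growth of `log n`, rounded so that it is a positive integer. -/
def lg (n : ℕ) : ℕ := Nat.log 2 n + 1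

/-- There is an algorithm that, given `ε = 1 / q`, a planar weighted graph with `m` edges and a set
of `k` terminals, constructs a `(1 + ε)`-distance approximating minor of size
`k ^ c * poly(1 / ε, log n)` in time `O(m * poly(1 / ε, log n))`
(with `m + k + 1` for `m`, so that the terminals can be read). -/
def HasMinorAlgorithm (c : ℝ) : Prop :=
  ∃ (P : Code) (C d : ℕ), ∀ (n q : ℕ), 0 < n → 0 < q →
    ∀ (G : WGraph n) (T : List (Fin n)), G.Simple → IsPlanar G.toGraph → T.Nodup →
      ∃ (H : WGraph n) (t : ℕ),
        P.Runs (.pair (.nat n) (.pair (.nat q) (.pair (encGraph G) (encList encVertex T))))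
          (encGraph H) t ∧
        t ≤ C * (G.length + T.length + 1) * (q * lg n) ^ d ∧
        IsDistApproxMinor (1 / (q : ℝ)) G {v | v ∈ T} H ∧
        (H.size {v | v ∈ T} : ℝ) ≤ C * (T.length : ℝ) ^ c * ((q : ℝ) * lg n) ^ d

/-- There is an offline dynamic `(1 + ε)`-approximate distance oracle for planar graphs with
average update and query time `u n`: given an initial graph and the whole sequence of operations,
it answers all the queries, in total time at most `u n` times the number of operations
(the initial edges counted as insertions). -/
def HasOfflineOracle (ε : ℝ) (u : ℕ → ℝ) : Prop :=
  ∃ Q : Code, ∀ n : ℕ, 0 < n →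
    ∀ (G : WGraph n) (ops : List (Op n)), G.Simple → PlanarRun G ops →
      ∃ (ans : List ℝ≥0∞) (t : ℕ),
        Q.Runs (.pair (.nat n) (.pair (encGraph G) (encList encOp ops)))
          (encList encAnswer ans) t ∧
        (t : ℝ) ≤ (G.length + ops.length + 1) * u n ∧
        ApproxAnswers ε G ops ans

end DynDist

open scoped NNReal ENNReal

set_option linter.unusedSectionVars false

/-! ### Partitions, permutations and combinatorial maps. -/

namespace DynDist

/-! ## Counting the classes of setoids -/

section Maps

variable {D : Type*}

/-! Planarity. A rotation system is a pair of permutations `σ`, `α` of the darts, whose vertices,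
faces and components are the classes of `σ`, of `σ * α`, and of the join of the two cycle
partitions. Multiplying by a transposition merges or splits cycles, and this controls the Euler
characteristic when an edge is deleted (`euler_step`). Consequently the genus is never negative
(`euler_le`), and genus zero survives deletion (`Flat.sub`) and contraction (`Flat.contract`); this
yields closure under minors (`IsPlanar.of_minor`) and a linear bound on the number of edges
(`IsPlanar.card_edgeSet_le`).

Hierarchies. If a minor keeps the terminals in separate branch sets, then adding the same edges
between terminals to the graph and to the minor leaves a minor (`IsTerminalMinor.planar_append`). An
edge that is present at some time of an interval without being permanent for it has both ends in the
boundary of the interval. So the right induction hypothesis for the third claim is stronger than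
planarity: at every time of the interval, the graphs `G''` and `G'` remain planar after the
currently present nonpermanent edges are added (`Hierarchy.planar_append`). The same addition of
edges between terminals preserves approximate distances (`dist_append_le`), so the factors `1 + ε`
just multiply along the levels.

Algorithm. The operations are cut into blocks of length `2 ^ J`, about `n ^ r`, and the blocks are
then cut again with half the length until each contains one operation. A task `(K, A, X)` has a
sparsifier `K`, the active edges `A` and the operations `X` of its block. For a subblock, the edges
of `A` that it does not delete join `K`, and the union is sparsified with respect to the vertices
that the subblock names; the edges that it deletes stay active, so they are at most as many as its
operations. `Task.Good` is the invariant: planarity and approximate distances at all times of the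
block. At a single operation `K` has polylogarithmic size, and the query is answered by relaxation
(`shortest_eq`).

Cost. There are `O(log n)` levels, so precision `1 / (Q log n)` suffices. At the top level each
block after the first reads a planar graph with at most `6 n` edges, which is about `n / 2 ^ J` per
operation; the first block reads the initial edges. Further down, a sparsifier for a block of length
`l` has size about `l ^ c`, thus at most about `(2 ^ J) ^ (c - 1)` per operation. If `D` bounds both
quantities, then the time per operation is `D` times a polylogarithm (`MinorProgram.exists_oracle`).
For `c = 1` one takes `r = 1` and `D = 2`. For `c = 2 / (1 + 3γ)` one takes a rational `r` between
`1/2 + γ/2` and `1/2 + 3γ/2`: both `1 - r` and `r (c - 1) ≤ 1/2 - 3γ/2` are then less than `1/2 -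
γ/2`, and the gap absorbs the logarithms.

Programs. `Comp` expresses that one program serves a whole family of inputs within a budget, up to a
polylogarithmic factor, and is closed under loops over lists. The machine has no random access;
radix sorting by keys (`grouped`) takes its place and lets the history of every edge be evaluated
separately (`active`, `passive`). -/

/-- The setoid obtained from `s` by identifying the classes of `x` and `y`. -/
def glue (s : Setoid D) (x y : D) : Setoid D where
  r a b := s a b ∨ (s a x ∧ s y b) ∨ (s a y ∧ s x b)
  iseqv :=
    { refl := fun a => Or.inl (s.refl a)
      symm := by
        rintro a b (h | ⟨h, h'⟩ | ⟨h, h'⟩)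
        · exact Or.inl (s.symm h)
        · exact Or.inr (Or.inr ⟨s.symm h', s.symm h⟩)
        · exact Or.inr (Or.inl ⟨s.symm h', s.symm h⟩)
      trans := by
        rintro a b c (h | ⟨h, h'⟩ | ⟨h, h'⟩) (g | ⟨g, g'⟩ | ⟨g, g'⟩)
        · exact Or.inl (s.trans h g)
        · exact Or.inr (Or.inl ⟨s.trans h g, g'⟩)
        · exact Or.inr (Or.inr ⟨s.trans h g, g'⟩)
        · exact Or.inr (Or.inl ⟨h, s.trans h' g⟩)
        · exact Or.inr (Or.inl ⟨h, g'⟩)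
        · exact Or.inl (s.trans h g')
        · exact Or.inr (Or.inr ⟨h, s.trans h' g⟩)
        · exact Or.inl (s.trans h g')
        · exact Or.inr (Or.inr ⟨h, g'⟩) }

theorem le_glue (s : Setoid D) (x y : D) : s ≤ glue s x y := fun {_ _} h => Or.inl h

theorem glue_pair (s : Setoid D) (x y : D) : glue s x y x y :=
  Or.inr (Or.inl ⟨s.refl x, s.refl y⟩)

theorem glue_le {s t : Setoid D} {x y : D} (h : s ≤ t) (hxy : t x y) : glue s x y ≤ t := by
  rintro a b (g | ⟨g, g'⟩ | ⟨g, g'⟩)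
  · exact h g
  · exact t.trans (h g) (t.trans hxy (h g'))
  · exact t.trans (h g) (t.trans (t.symm hxy) (h g'))

/-- The number of classes of a setoid. -/
noncomputable def classes (s : Setoid D) : ℕ := Nat.card (Quotient s)

variable [Finite D]

theorem classes_anti {s t : Setoid D} (h : s ≤ t) : classes t ≤ classes s := by
  refine Nat.card_le_card_of_surjective (Quotient.map' (s₁ := s) (s₂ := t) id fun a b g => h g) ?_
  intro q
  induction q using Quotient.inductionOn with
  | h a => exact ⟨Quotient.mk s a, rfl⟩

/-- Send the class of `y` to `none` and every other class to its image. Gluing identifies only the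
classes of `x` and `y`, so this map is injective. -/
theorem classes_le_glue (s : Setoid D) (x y : D) : classes s ≤ classes (glue s x y) + 1 := by
  classical
  have : classes (glue s x y) + 1 = Nat.card (Option (Quotient (glue s x y))) := by
    rw [Finite.card_option]; rfl
  rw [this]
  refine Nat.card_le_card_of_injective (fun q : Quotient s =>
    if q = Quotient.mk s y then none
    else some (Quotient.map' (s₁ := s) (s₂ := glue s x y) id (fun a b g => le_glue s x y g) q)) ?_
  intro p q hpq
  induction p using Quotient.inductionOn with
  | h a =>
  induction q using Quotient.inductionOn with
  | h b =>
  by_cases ha : s a y <;> by_cases hb : s b y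
  · exact Quotient.sound (s.trans ha (s.symm hb))
  · have h1 : Quotient.mk s a = Quotient.mk s y := Quotient.sound ha
    have h2 : Quotient.mk s b ≠ Quotient.mk s y := fun h => hb (Quotient.exact h)
    simp [h1, h2] at hpq
  · have h1 : Quotient.mk s b = Quotient.mk s y := Quotient.sound hb
    have h2 : Quotient.mk s a ≠ Quotient.mk s y := fun h => ha (Quotient.exact h)
    simp [h1, h2] at hpq
  · have h1 : Quotient.mk s a ≠ Quotient.mk s y := fun h => ha (Quotient.exact h)
    have h2 : Quotient.mk s b ≠ Quotient.mk s y := fun h => hb (Quotient.exact h)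
    simp only [h1, h2, if_false, Option.some.injEq] at hpq
    have h3 : glue s x y a b := Quotient.exact hpq
    rcases h3 with h | ⟨_, h⟩ | ⟨h, _⟩
    · exact Quotient.sound h
    · exact absurd (s.symm h) hb
    · exact absurd h ha

theorem classes_le_of_le_glue {r s : Setoid D} {x y : D} (h : r ≤ glue s x y) :
    classes s ≤ classes r + 1 :=
  (classes_le_glue s x y).trans (Nat.add_le_add_right (classes_anti h) 1)

theorem classes_lt {s r : Setoid D} (h : s ≤ r) {x y : D} (hr : r x y) (hs : ¬ s x y) :
    classes r + 1 ≤ classes s := by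
  have := Fintype.ofFinite (Quotient s)
  have := Fintype.ofFinite (Quotient r)
  unfold classes
  rw [Nat.card_eq_fintype_card, Nat.card_eq_fintype_card]
  refine Fintype.card_lt_of_surjective_not_injective
    (Quotient.map' (s₁ := s) (s₂ := r) id fun a b g => h g) ?_ ?_
  · intro q
    induction q using Quotient.inductionOn with
    | h a => exact ⟨Quotient.mk s a, rfl⟩
  · intro hinj
    exact hs (Quotient.exact (@hinj (Quotient.mk s x) (Quotient.mk s y) (Quotient.sound hr)))

/-- Counting classes along an embedding whose complement consists of singleton classes. -/
theorem classes_embedding {A : Type*} [Finite A] (j : A → D)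
    {s : Setoid D} {t : Setoid A} (hst : ∀ a b, s (j a) (j b) ↔ t a b)
    (hz : ∀ z ∉ Set.range j, ∀ d, s z d → d = z) :
    classes s = classes t + Nat.card {z // z ∉ Set.range j} := by
  have : classes t + Nat.card {z // z ∉ Set.range j} =
      Nat.card (Quotient t ⊕ {z // z ∉ Set.range j}) := by
    rw [Nat.card_sum]; rfl
  rw [this]
  symm
  refine Nat.card_congr (Equiv.ofBijective (Sum.elim
    (Quotient.map' (s₁ := t) (s₂ := s) j fun a b g => (hst a b).2 g)
    fun z => Quotient.mk s z.1) ⟨?_, ?_⟩)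
  · rintro (p | p) (q | q) h
    · induction p using Quotient.inductionOn with
      | h a =>
      induction q using Quotient.inductionOn with
      | h b =>
      have h' : s (j a) (j b) := Quotient.exact h
      exact congrArg _ (Quotient.sound ((hst a b).1 h'))
    · induction p using Quotient.inductionOn with
      | h a =>
      have h' : s (j a) q.1 := Quotient.exact h
      exact absurd ⟨a, hz _ q.2 _ (s.symm h')⟩ q.2
    · induction q using Quotient.inductionOn with
      | h a =>
      have h' : s p.1 (j a) := Quotient.exact h
      exact absurd ⟨a, hz _ p.2 _ h'⟩ p.2
    · have h' : s p.1 q.1 := Quotient.exact h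
      exact congrArg _ (Subtype.ext (hz _ p.2 _ h').symm)
  · intro q
    induction q using Quotient.inductionOn with
    | h d =>
    by_cases hd : d ∈ Set.range j
    · obtain ⟨a, rfl⟩ := hd
      exact ⟨Sum.inl (Quotient.mk t a), rfl⟩
    · exact ⟨Sum.inr ⟨d, hd⟩, rfl⟩

/-! ## Cycles of permutations -/

open Equiv Equiv.Perm

/-- The partition of a type into the cycles of a permutation. -/
abbrev cyc (σ : Perm D) : Setoid D := SameCycle.setoid σ

theorem cyc_apply (σ : Perm D) (a : D) : cyc σ a (σ a) := ⟨1, by simp⟩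

/-- On a finite type the orbit consists of natural powers, so single steps suffice. Every inclusion
between cycle partitions below is obtained in this way. -/
theorem cyc_le {σ : Perm D} {s : Setoid D} (h : ∀ a, s a (σ a)) : cyc σ ≤ s := by
  intro a b hab
  obtain ⟨i, rfl⟩ := SameCycle.exists_nat_pow_eq hab
  induction i with
  | zero => exact s.refl a
  | succ i ih =>
    rw [pow_succ', mul_apply]
    exact s.trans (ih ⟨i, by simp⟩) (h _)

variable [DecidableEq D]

theorem cyc_mul_swap_le (σ : Perm D) (x y : D) : cyc (σ * swap x y) ≤ glue (cyc σ) x y := by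
  refine cyc_le fun a => ?_
  rw [mul_apply]
  by_cases hx : a = x
  · subst hx
    rw [swap_apply_left]
    exact Or.inr (Or.inl ⟨(cyc σ).refl _, cyc_apply σ y⟩)
  by_cases hy : a = y
  · subst hy
    rw [swap_apply_right]
    exact Or.inr (Or.inr ⟨(cyc σ).refl _, cyc_apply σ x⟩)
  · rw [swap_apply_of_ne_of_ne hx hy]
    exact Or.inl (cyc_apply σ a)

theorem classes_cyc_mul_swap_le (σ : Perm D) (x y : D) :
    classes (cyc σ) ≤ classes (cyc (σ * swap x y)) + 1 :=
  classes_le_of_le_glue (cyc_mul_swap_le σ x y)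

theorem classes_cyc_le_mul_swap (σ : Perm D) (x y : D) :
    classes (cyc (σ * swap x y)) ≤ classes (cyc σ) + 1 := by
  have := classes_cyc_mul_swap_le (σ * swap x y) x y
  rwa [mul_assoc, swap_mul_self, mul_one] at this

/-- The new permutation sends `x` to `σ y` and then follows the old cycle of `y`, which avoids `x`,
until it comes back to `y`. Hence a transposition of points in two cycles joins these cycles. -/
theorem cyc_mul_swap_pair {σ : Perm D} {x y : D} (h : ¬ cyc σ x y) :
    cyc (σ * swap x y) x y := by
  have key : ∀ i, cyc (σ * swap x y) x ((σ ^ (i + 1)) y) ∨ cyc (σ * swap x y) x y := by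
    intro i
    induction i with
    | zero =>
      left
      have := cyc_apply (σ * swap x y) x
      rwa [mul_apply, swap_apply_left] at this
    | succ i ih =>
      rcases ih with ih | ih
      · by_cases hy : (σ ^ (i + 1)) y = y
        · right; rwa [hy] at ih
        · left
          have hx : (σ ^ (i + 1)) y ≠ x := by
            intro hx
            exact h (SameCycle.symm ⟨((i + 1 : ℕ) : ℤ), by rw [zpow_natCast]; exact hx⟩)
          have := cyc_apply (σ * swap x y) ((σ ^ (i + 1)) y)
          rw [mul_apply, swap_apply_of_ne_of_ne hx hy, ← mul_apply, ← pow_succ'] at this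
          exact (cyc _).trans ih this
      · exact Or.inr ih
  have hp := orderOf_pos σ
  -- After `orderOf σ` steps the old cycle closes up at `y`.
  rcases key (orderOf σ - 1) with h' | h'
  · rwa [Nat.sub_add_cancel hp, pow_orderOf_eq_one] at h'
  · exact h'

theorem cyc_mul_swap {σ : Perm D} {x y : D} (h : ¬ cyc σ x y) :
    cyc (σ * swap x y) = glue (cyc σ) x y := by
  have hp := cyc_mul_swap_pair h
  refine le_antisymm (cyc_mul_swap_le σ x y) (glue_le ?_ hp)
  refine cyc_le fun a => ?_
  have ha := cyc_apply (σ * swap x y)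
  by_cases hx : a = x
  · subst hx
    have := ha y
    rw [mul_apply, swap_apply_right] at this
    exact (cyc _).trans hp this
  by_cases hy : a = y
  · subst hy
    have := ha x
    rw [mul_apply, swap_apply_left] at this
    exact (cyc _).trans ((cyc _).symm hp) this
  · have := ha a
    rwa [mul_apply, swap_apply_of_ne_of_ne hx hy] at this

theorem classes_cyc_mul_swap {σ : Perm D} {x y : D} (h : ¬ cyc σ x y) :
    classes (cyc (σ * swap x y)) + 1 ≤ classes (cyc σ) := by
  refine classes_lt (x := x) (y := y) ?_ (cyc_mul_swap_pair h) h
  rw [cyc_mul_swap h]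
  exact le_glue _ _ _

/-! ## Maps: a rotation `σ` and an involution `α` of the darts -/

/-- The number of darts that are moved: twice the number of edges. -/
noncomputable def moved (α : Perm D) : ℕ := Nat.card {d // α d ≠ d}

/-- The genus of the map `(σ, α)` is zero. Fixed points of `α` are ignored. -/
def Flat (σ α : Perm D) : Prop :=
  moved α + 4 * classes (cyc σ ⊔ cyc α) ≤ 2 * classes (cyc σ) + 2 * classes (cyc (σ * α))

theorem moved_mul_swap {α : Perm D} (hα : ∀ d, α (α d) = d) {x : D} (hx : α x ≠ x) :
    moved α = moved (α * swap x (α x)) + 2 := by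
  have := Fintype.ofFinite D
  have e : ∀ β : Perm D, moved β = β.support.card := by
    intro β
    unfold moved
    rw [Nat.card_eq_fintype_card, Fintype.card_subtype]
    congr 1
  rw [e, e]
  have h1 : (α * swap x (α x)).support = (α.support.erase x).erase (α x) := by
    ext d
    simp only [mem_support, mul_apply, Finset.mem_erase, ne_eq]
    by_cases h1 : d = x
    · subst h1; simp [hα]
    by_cases h2 : d = α x
    · subst h2; simp
    · rw [swap_apply_of_ne_of_ne h1 h2]; simp [h1, h2]
  rw [h1, Finset.card_erase_of_mem, Finset.card_erase_of_mem]
  · have : 1 < α.support.card := by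
      refine Finset.one_lt_card.2 ⟨x, by simpa using hx, α x, ?_, hx.symm⟩
      simp [hα, hx.symm]
    omega
  · simpa using hx
  · simp [hα, hx, hx.symm]

theorem involutive_mul_swap {α : Perm D} (hα : ∀ d, α (α d) = d) (x : D) :
    ∀ d, (α * swap x (α x)) ((α * swap x (α x)) d) = d := by
  intro d
  simp only [mul_apply]
  by_cases h1 : d = x
  · subst h1; simp [hα]
  by_cases h2 : d = α x
  · subst h2; simp
  have h3 : α d ≠ x := fun h => h2 (by rw [← h, hα])
  have h4 : α d ≠ α x := fun h => h1 (α.injective h)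
  rw [swap_apply_of_ne_of_ne h1 h2, swap_apply_of_ne_of_ne h3 h4, hα]

/-! ### The Euler inequality; genus zero under deletion, contraction and isolation of darts. -/

theorem sup_le_glue (σ α : Perm D) (x : D) :
    cyc σ ⊔ cyc α ≤ glue (cyc σ ⊔ cyc (α * swap x (α x))) x (α x) := by
  refine sup_le (le_sup_left.trans (le_glue _ _ _)) ?_
  have h := cyc_mul_swap_le (α * swap x (α x)) x (α x)
  rw [mul_assoc, swap_mul_self, mul_one] at h
  exact h.trans (glue_le (le_sup_right.trans (le_glue _ _ _)) (glue_pair _ _ _))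

theorem cyc_mul_le_sup (σ α : Perm D) : cyc (σ * α) ≤ cyc σ ⊔ cyc α := by
  refine cyc_le fun a => ?_
  exact (cyc σ ⊔ cyc α).trans ((le_sup_right : cyc α ≤ cyc σ ⊔ cyc α) (cyc_apply α a))
    ((le_sup_left : cyc σ ≤ cyc σ ⊔ cyc α) (cyc_apply σ (α a)))

/-- The change of the Euler characteristic when an edge is deleted. -/
theorem euler_step (σ : Perm D) {α : Perm D} (hα : ∀ d, α (α d) = d) {x : D} (hx : α x ≠ x) :
    2 * classes (cyc (σ * α)) + moved (α * swap x (α x)) +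
        4 * classes (cyc σ ⊔ cyc (α * swap x (α x))) ≤
      2 * classes (cyc (σ * (α * swap x (α x)))) + moved α + 4 * classes (cyc σ ⊔ cyc α) := by
  set α' := α * swap x (α x) with hα'
  have hm := moved_mul_swap hα hx
  rw [← hα'] at hm
  have e1 : σ * α' = (σ * α) * swap x (α x) := by rw [hα', mul_assoc]
  have e2 : σ * α = (σ * α') * swap x (α x) := by
    rw [e1, mul_assoc, swap_mul_self, mul_one]
  have hglue := sup_le_glue σ α x
  rw [← hα'] at hglue
  -- If the ends remain connected, the number of components does not grow, and the edge changes the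
  -- number of faces by at most one. Otherwise the edge is a bridge: its deletion creates at most
  -- one component, but its ends lie in different faces of the smaller map, because faces lie inside
  -- components, and the edge merges these faces.
  by_cases hk : (cyc σ ⊔ cyc α') x (α x)
  · have h1 : classes (cyc σ ⊔ cyc α') ≤ classes (cyc σ ⊔ cyc α) :=
      classes_anti (hglue.trans (glue_le le_rfl hk))
    have h2 := classes_cyc_le_mul_swap (σ * α') x (α x)
    rw [← e2] at h2
    omega
  · have h1 : classes (cyc σ ⊔ cyc α') ≤ classes (cyc σ ⊔ cyc α) + 1 :=
      classes_le_of_le_glue hglue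
    have h2 := classes_cyc_mul_swap (σ := σ * α') (x := x) (y := α x)
      (fun h => hk (cyc_mul_le_sup σ α' h))
    rw [← e2] at h2
    omega

/-- The edges of `α` that are not in `β` are deleted one at a time, by strong induction on the
number of moved darts. -/
theorem euler_sub (σ : Perm D) {β : Perm D} (hβ : ∀ d, β (β d) = d) :
    ∀ (m : ℕ) {α : Perm D}, moved α = m → (∀ d, α (α d) = d) →
    (∀ d, β d = α d ∨ β d = d) →
    2 * classes (cyc (σ * α)) + moved β + 4 * classes (cyc σ ⊔ cyc β) ≤
      2 * classes (cyc (σ * β)) + moved α + 4 * classes (cyc σ ⊔ cyc α) := by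
  intro m
  induction m using Nat.strong_induction_on with
  | _ m ih =>
  intro α hm hα hsub
  by_cases h : ∃ d, β d ≠ α d
  · obtain ⟨x, hx⟩ := h
    have hbx : β x = x := (hsub x).resolve_left hx
    have hax : α x ≠ x := fun h => hx (by rw [hbx, h])
    have hm' := moved_mul_swap hα hax
    have h1 := ih _ (by omega) rfl (involutive_mul_swap hα x) (by
      intro d
      rw [mul_apply]
      by_cases h1 : d = x
      · exact Or.inr (by rw [h1, hbx])
      by_cases h2 : d = α x
      · right
        rcases hsub d with h3 | h3
        · rw [h2, hα] at h3
          have h4 := congrArg β h3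
          rw [hβ, hbx] at h4
          exact absurd h4 hax
        · exact h3
      · rw [swap_apply_of_ne_of_ne h1 h2]; exact hsub d)
    have h2 := euler_step σ hα hax
    omega
  · push Not at h
    have : β = α := Equiv.ext h
    subst this
    omega

/-- Delete all edges: in the map without edges the vertices, the faces and the components coincide.
This is nonnegativity of the genus, so the inequality in `Flat` is in fact an equality. -/
theorem euler_le (σ : Perm D) {α : Perm D} (hα : ∀ d, α (α d) = d) :
    2 * classes (cyc σ) + 2 * classes (cyc (σ * α)) ≤
      moved α + 4 * classes (cyc σ ⊔ cyc α) := by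
  have h := euler_sub σ (β := 1) (fun d => rfl) _ (α := α) rfl hα (fun d => Or.inr rfl)
  have h1 : cyc σ ⊔ cyc (1 : Perm D) = cyc σ := by
    rw [sup_eq_left]
    exact cyc_le fun a => (cyc σ).refl a
  rw [h1, mul_one] at h
  omega

theorem Flat.sub {σ α β : Perm D} (h : Flat σ α) (hα : ∀ d, α (α d) = d)
    (hβ : ∀ d, β (β d) = d) (hsub : ∀ d, β d = α d ∨ β d = d) : Flat σ β := by
  have := euler_sub σ hβ _ (α := α) rfl hα hsub
  unfold Flat at *
  omega

/-- Contraction of a part `β` of the edges. -/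
theorem Flat.contract (m : ℕ) : ∀ {σ α β : Perm D}, moved β = m → Flat σ α →
    (∀ d, α (α d) = d) → (∀ d, β (β d) = d) → (∀ d, β d = α d ∨ β d = d) →
    ∃ σ', cyc σ' = cyc σ ⊔ cyc β ∧ Flat σ' (α * β) := by
  induction m using Nat.strong_induction_on with
  | _ m ih =>
  intro σ α β hm hflat hα hβ hsub
  by_cases h : ∃ x, β x ≠ x
  · obtain ⟨x, hx⟩ := h
    have hxa : β x = α x := (hsub x).resolve_right hx
    have hax : α x ≠ x := hxa ▸ hx
    have hm' := moved_mul_swap hβ hx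
    have hba : β (α x) = x := by rw [← hxa, hβ]
    have hsub' : ∀ d, (β * swap x (β x)) d = (α * swap x (α x)) d ∨
        (β * swap x (β x)) d = d := by
      intro d
      rw [hxa]
      simp only [mul_apply]
      by_cases h1 : d = x
      · subst h1; right; simp [hba]
      by_cases h2 : d = α x
      · subst h2; right; simp [hxa]
      · rw [swap_apply_of_ne_of_ne h1 h2]; exact hsub d
    -- Taking the same edge out of `α` and out of `β` does not change `α * β`, since the
    -- transposition of its two darts commutes with both involutions.
    have hprod : (α * swap x (α x)) * (β * swap x (β x)) = α * β := by
      rw [hxa]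
      have : β * swap x (α x) = swap x (α x) * β := by
        rw [mul_swap_eq_swap_mul, hxa, hba, swap_comm]
      rw [this, mul_assoc, ← mul_assoc (swap x (α x)), swap_mul_self, one_mul]
    have hsupβ : ∀ s : Setoid D, s x (α x) → s ⊔ cyc (β * swap x (β x)) = s ⊔ cyc β := by
      intro s hs
      rw [hxa]
      refine le_antisymm (sup_le le_sup_left ?_) (sup_le le_sup_left ?_)
      · exact (cyc_mul_swap_le _ _ _).trans (glue_le le_sup_right (le_sup_left (a := s) hs))
      · have h := cyc_mul_swap_le (β * swap x (α x)) x (α x)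
        rw [mul_assoc, swap_mul_self, mul_one] at h
        exact h.trans (glue_le le_sup_right (le_sup_left (a := s) hs))
    -- An edge that has become a loop is deleted. Otherwise its ends are merged by passing to `σ *
    -- swap x (α x)`; the two transpositions cancel in the face permutation, so the faces stay, the
    -- vertices and the edges decrease by one each, and the components do not increase.
    by_cases hc : cyc σ x (α x)
    · obtain ⟨σ', h1, h2⟩ := ih _ (by omega) (σ := σ) (α := α * swap x (α x))
        (β := β * swap x (β x)) rfl
        (hflat.sub hα (involutive_mul_swap hα x) (by
          intro d
          simp only [mul_apply]
          by_cases h1 : d = x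
          · subst h1; right; simp [hα]
          by_cases h2 : d = α x
          · subst h2; right; simp
          · rw [swap_apply_of_ne_of_ne h1 h2]; exact Or.inl rfl))
        (involutive_mul_swap hα x) (involutive_mul_swap hβ x) hsub'
      exact ⟨σ', by rw [h1, hsupβ _ hc], by rw [← hprod]; exact h2⟩
    · have hcomm : α * swap x (α x) = swap x (α x) * α := by
        rw [mul_swap_eq_swap_mul, hα, swap_comm]
      obtain ⟨σ', h1, h2⟩ := ih _ (by omega) (σ := σ * swap x (α x)) (α := α * swap x (α x))
        (β := β * swap x (β x)) rfl (by
          have hf : σ * swap x (α x) * (α * swap x (α x)) = σ * α := by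
            rw [hcomm, mul_assoc, ← mul_assoc (swap x (α x)), swap_mul_self, one_mul]
          have hz := classes_cyc_mul_swap_le σ x (α x)
          have hma := moved_mul_swap hα hax
          have hk : classes (cyc (σ * swap x (α x)) ⊔ cyc (α * swap x (α x))) ≤
              classes (cyc σ ⊔ cyc α) := by
            refine classes_anti (sup_le ?_ ?_)
            · refine le_trans ?_ le_sup_left
              rw [cyc_mul_swap hc]
              exact le_glue _ _ _
            · have h := cyc_mul_swap_le (α * swap x (α x)) x (α x)
              rw [mul_assoc, swap_mul_self, mul_one] at h
              exact h.trans (glue_le le_sup_right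
                (le_sup_left (a := cyc (σ * swap x (α x))) (cyc_mul_swap_pair hc)))
          unfold Flat at *
          rw [hf]
          omega)
        (involutive_mul_swap hα x) (involutive_mul_swap hβ x) hsub'
      refine ⟨σ', ?_, by rw [← hprod]; exact h2⟩
      rw [h1, hsupβ _ (cyc_mul_swap_pair hc), cyc_mul_swap hc]
      refine le_antisymm (sup_le (glue_le le_sup_left ?_) le_sup_right)
        (sup_le ((le_glue _ _ _).trans le_sup_left) le_sup_right)
      have := (le_sup_right : cyc β ≤ cyc σ ⊔ cyc β) (cyc_apply β x)
      rwa [hxa] at this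
  · push Not at h
    have : β = 1 := Equiv.ext h
    subst this
    refine ⟨σ, ?_, by simpa using hflat⟩
    symm
    rw [sup_eq_left]
    exact cyc_le fun a => (cyc σ).refl a

/-- Taking a dart out of its cycle. -/
theorem cyc_isolate_le (σ : Perm D) (x : D) : cyc (swap x (σ x) * σ) ≤ cyc σ := by
  refine cyc_le fun a => ?_
  rw [mul_apply]
  by_cases h1 : σ a = x
  · rw [h1, swap_apply_left]
    exact (cyc σ).trans (cyc_apply σ a) (h1 ▸ cyc_apply σ (σ a))
  by_cases h2 : a = x
  · subst h2; rw [swap_apply_right]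
  · rw [swap_apply_of_ne_of_ne h1 (fun h => h2 (σ.injective h))]
    exact cyc_apply σ a

theorem cyc_fixed {σ : Perm D} {x d : D} (hx : σ x = x) (h : cyc σ x d) : d = x := by
  obtain ⟨i, rfl⟩ := SameCycle.exists_nat_pow_eq h
  exact Function.IsFixedPt.perm_pow (e := σ) hx i

theorem isolate_apply (σ : Perm D) (x : D) : (swap x (σ x) * σ) x = x := by
  rw [mul_apply, swap_apply_right]

theorem classes_isolate {σ : Perm D} {x : D} (hx : σ x ≠ x) :
    classes (cyc σ) + 1 ≤ classes (cyc (swap x (σ x) * σ)) :=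
  classes_lt (cyc_isolate_le σ x) (cyc_apply σ x)
    fun h => hx (cyc_fixed (isolate_apply σ x) h)

theorem apply_glue_isolate (σ : Perm D) (x a : D) :
    glue (cyc (swap x (σ x) * σ)) x (σ x) a (σ a) := by
  have h := cyc_apply (swap x (σ x) * σ) a
  rw [mul_apply] at h
  by_cases h1 : σ a = x
  · rw [h1, swap_apply_left] at h
    rw [h1]
    exact Or.inr (Or.inr ⟨h, (cyc _).refl _⟩)
  by_cases h2 : a = x
  · subst h2; exact glue_pair _ _ _
  · rw [swap_apply_of_ne_of_ne h1 (fun h => h2 (σ.injective h))] at h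
    exact Or.inl h

theorem cyc_isolate_iff {σ : Perm D} {x a b : D} (ha : a ≠ x) (hb : b ≠ x) :
    cyc (swap x (σ x) * σ) a b ↔ cyc σ a b := by
  refine ⟨fun h => cyc_isolate_le σ x h, fun h => ?_⟩
  have h' : glue (cyc (swap x (σ x) * σ)) x (σ x) a b :=
    cyc_le (apply_glue_isolate σ x) h
  rcases h' with h | ⟨h, _⟩ | ⟨_, h⟩
  · exact h
  · exact absurd (cyc_fixed (isolate_apply σ x) ((cyc _).symm h)) ha
  · exact absurd (cyc_fixed (isolate_apply σ x) h) hb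

/-- A dart fixed by `α` goes to the same place under `σ * α` as under `σ`. Cutting it out therefore
creates a new vertex and a new face, which pays for the at most one new component: `2 + 2 = 4`. -/
theorem Flat.isolate {σ α : Perm D} (h : Flat σ α) {x : D} (hx : α x = x) :
    Flat (swap x (σ x) * σ) α := by
  by_cases hs : σ x = x
  · have : swap x (σ x) * σ = σ := by rw [hs, swap_self]; rfl
    rwa [this]
  have h1 := classes_isolate hs
  have h2 := classes_isolate (σ := σ * α) (x := x) (by rwa [mul_apply, hx])
  have h3 : swap x ((σ * α) x) * (σ * α) = swap x (σ x) * σ * α := by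
    rw [mul_apply, hx, mul_assoc]
  rw [h3] at h2
  have h4 : classes (cyc (swap x (σ x) * σ) ⊔ cyc α) ≤ classes (cyc σ ⊔ cyc α) + 1 := by
    refine classes_le_of_le_glue (x := x) (y := σ x) (sup_le (cyc_le fun a => ?_) ?_)
    · exact glue_le (le_sup_left.trans (le_glue _ _ _)) (glue_pair _ _ _)
        (apply_glue_isolate σ x a)
    · exact le_sup_right.trans (le_glue _ _ _)
  unfold Flat at *
  omega

theorem Flat.isolate_all {α : Perm D} (Z : Finset D) : ∀ {σ : Perm D}, Flat σ α →
    (∀ z ∈ Z, α z = z) → ∃ σ', Flat σ' α ∧ (∀ z ∈ Z, σ' z = z) ∧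
      ∀ a b, a ∉ Z → b ∉ Z → (cyc σ' a b ↔ cyc σ a b) := by
  induction Z using Finset.induction_on with
  | empty => exact fun {σ} h _ => ⟨σ, h, by simp, fun _ _ _ _ => Iff.rfl⟩
  | insert x Z hxZ ih =>
    intro σ h hZ
    obtain ⟨σ', h1, h2, h3⟩ := ih h fun z hz => hZ z (Finset.mem_insert_of_mem hz)
    refine ⟨swap x (σ' x) * σ', h1.isolate (hZ x (Finset.mem_insert_self _ _)), ?_, ?_⟩
    · intro z hz
      rcases Finset.mem_insert.1 hz with rfl | hz
      · exact isolate_apply _ _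
      · have hne : z ≠ x := fun e => hxZ (e ▸ hz)
        rw [mul_apply, h2 z hz, swap_apply_of_ne_of_ne hne]
        intro e
        have : σ' x = σ' z := by rw [h2 z hz, e]
        exact hne (σ'.injective this).symm
    · intro a b ha hb
      rw [Finset.mem_insert, not_or] at ha hb
      rw [cyc_isolate_iff ha.1 hb.1, h3 a b ha.2 hb.2]

end Maps

end DynDist

namespace DynDist

/-! ## Planar graphs -/

section Planar

open Equiv Equiv.Perm

variable {V : Type*} [Finite V]

instance dartFinite (G : SimpleGraph V) : Finite G.Dart :=
  Finite.of_injective (fun d : G.Dart => d.toProd) fun a b h => SimpleGraph.Dart.ext _ _ h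

theorem dartRev_apply (G : SimpleGraph V) (d : G.Dart) : dartRev G d = d.symm := rfl

theorem dartRev_invol (G : SimpleGraph V) (d : G.Dart) : dartRev G (dartRev G d) = d :=
  d.symm_symm

theorem fst_mem_support {G : SimpleGraph V} (d : G.Dart) : d.fst ∈ G.support := ⟨d.snd, d.adj⟩

theorem classes_rotation {G : SimpleGraph V} {σ : Perm G.Dart} (h : IsRotation G σ) :
    classes (cyc σ) = Nat.card G.support := by
  refine Nat.card_congr (Equiv.ofBijective (Quotient.lift
    (fun d : G.Dart => (⟨d.fst, fst_mem_support d⟩ : G.support)) fun a b hab => ?_) ⟨?_, ?_⟩)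
  · exact Subtype.ext ((h a b).1 hab)
  · intro p q hpq
    induction p using Quotient.inductionOn with
    | h a =>
    induction q using Quotient.inductionOn with
    | h b => exact Quotient.sound ((h a b).2 (congrArg Subtype.val hpq))
  · rintro ⟨v, w, hvw⟩
    exact ⟨Quotient.mk _ ⟨(v, w), hvw⟩, rfl⟩

theorem card_dart (G : SimpleGraph V) : Nat.card G.Dart = 2 * Nat.card G.edgeSet := by
  classical
  have := Fintype.ofFinite V
  rw [Nat.card_eq_fintype_card, SimpleGraph.dart_card_eq_twice_card_edges,
    SimpleGraph.edgeFinset_card, Nat.card_eq_fintype_card]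

theorem moved_dartRev (G : SimpleGraph V) : moved (dartRev G) = 2 * Nat.card G.edgeSet := by
  rw [← card_dart]
  refine Nat.card_congr (Equiv.subtypeUnivEquiv fun d => ?_)
  rw [dartRev_apply]
  exact SimpleGraph.Dart.symm_ne d

theorem classes_sup_rotation {G : SimpleGraph V} {σ : Perm G.Dart} (h : IsRotation G σ) :
    classes (cyc σ ⊔ cyc (dartRev G)) = Nat.card (G.induce G.support).ConnectedComponent := by
  let s : Setoid G.Dart := cyc σ ⊔ cyc (dartRev G)
  have hs1 : ∀ d e : G.Dart, d.fst = e.fst → s d e := fun d e hde =>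
    (le_sup_left : cyc σ ≤ s) ((h d e).2 hde)
  have hs2 : ∀ d : G.Dart, s d d.symm := fun d =>
    (le_sup_right : cyc (dartRev G) ≤ s) (cyc_apply (dartRev G) d)
  let F : G.Dart → (G.induce G.support).ConnectedComponent := fun d =>
    (G.induce G.support).connectedComponentMk ⟨d.fst, fst_mem_support d⟩
  have hF : s ≤ Setoid.ker F := by
    refine sup_le (cyc_le fun a => ?_) (cyc_le fun a => ?_)
    · have : a.fst = (σ a).fst := (h _ _).1 (cyc_apply σ a)
      simp only [Setoid.ker_def, F]
      congr 1
      exact Subtype.ext this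
    · simp only [Setoid.ker_def, F]
      refine SimpleGraph.ConnectedComponent.sound (SimpleGraph.Adj.reachable ?_)
      exact a.adj
  have hwalk : ∀ {x y : G.support} (p : (G.induce G.support).Walk x y) (d e : G.Dart),
      d.fst = x → e.fst = y → s d e := by
    intro x y p
    induction p with
    | nil => intro d e hd he; exact hs1 d e (hd.trans he.symm)
    | @cons u v w hadj p ih =>
      intro d e hd he
      have hadj' : G.Adj u v := hadj
      let f : G.Dart := ⟨(u.1, v.1), hadj'⟩
      exact s.trans (hs1 d f hd) (s.trans (hs2 f) (ih f.symm e rfl he))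
  refine Nat.card_congr (Equiv.ofBijective (Quotient.lift F fun a b hab => hF hab) ⟨?_, ?_⟩)
  · intro p q hpq
    induction p using Quotient.inductionOn with
    | h a =>
    induction q using Quotient.inductionOn with
    | h b =>
      obtain ⟨w⟩ := SimpleGraph.ConnectedComponent.exact (show F a = F b from hpq)
      exact Quotient.sound (hwalk w a b rfl rfl)
  · intro c
    induction c using SimpleGraph.ConnectedComponent.ind with
    | h v =>
      obtain ⟨v, w, hvw⟩ := v
      exact ⟨Quotient.mk _ ⟨(v, w), hvw⟩, rfl⟩

/-- `Flat` is twice one of the two inequalities in Euler's formula, and `euler_le` is the other one.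
-/
theorem euler_iff_flat {G : SimpleGraph V} {σ : Perm G.Dart} (h : IsRotation G σ) :
    (Nat.card G.support + faceCount G σ =
      Nat.card G.edgeSet + 2 * Nat.card (G.induce G.support).ConnectedComponent) ↔
    Flat σ (dartRev G) := by
  classical
  have h1 := classes_rotation h
  have h2 := moved_dartRev G
  have h3 := classes_sup_rotation h
  have h4 : faceCount G σ = classes (cyc (σ * dartRev G)) := rfl
  have h5 := euler_le σ (dartRev_invol G)
  unfold Flat
  omega

theorem isPlanar_iff {G : SimpleGraph V} :
    IsPlanar G ↔ ∃ σ : Perm G.Dart, IsRotation G σ ∧ Flat σ (dartRev G) :=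
  exists_congr fun _ => and_congr_right fun h => euler_iff_flat h

/-- A restriction of a permutation along an embedding of a subset that it preserves. -/
theorem exists_pullback {A D : Type*} [Finite D] (j : A → D) (hj : Function.Injective j)
    (ρ : Perm D) (hρ : ∀ z ∉ Set.range j, ρ z = z) :
    ∃ τ : Perm A, (∀ a, j (τ a) = ρ (j a)) ∧ ∀ a b, cyc ρ (j a) (j b) ↔ SameCycle τ a b := by
  have hmem : ∀ z, z ∈ Set.range j ↔ ρ z ∈ Set.range j := by
    intro z
    constructor
    · intro h
      by_contra hz
      have := hρ _ hz
      exact hz (by rw [ρ.injective this]; exact h)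
    · intro h
      by_contra hz
      rw [hρ z hz] at h
      exact hz h
  let e := Equiv.ofInjective j hj
  let τ : Perm A := (e.trans (ρ.subtypePerm fun z => (hmem z).symm)).trans e.symm
  have hτ : ∀ a, j (τ a) = ρ (j a) := by
    intro a
    have := Equiv.apply_ofInjective_symm hj (ρ.subtypePerm (fun z => (hmem z).symm) (e a))
    exact this
  have hpow : ∀ (i : ℕ) a, j ((τ ^ i) a) = (ρ ^ i) (j a) := by
    intro i
    induction i with
    | zero => simp
    | succ i ih => intro a; rw [pow_succ', pow_succ', mul_apply, mul_apply, hτ, ih]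
  have : Finite A := Finite.of_injective j hj
  refine ⟨τ, hτ, fun a b => ⟨fun h => ?_, fun h => ?_⟩⟩
  · obtain ⟨i, hi⟩ := SameCycle.exists_nat_pow_eq h
    exact ⟨i, by rw [zpow_natCast]; exact hj (by rw [hpow, hi])⟩
  · obtain ⟨i, hi⟩ := SameCycle.exists_nat_pow_eq h
    exact ⟨i, by rw [zpow_natCast, ← hpow, hi]⟩

/-- A graph is planar if its darts are represented by darts of a map of genus zero. -/
theorem isPlanar_of_flat {H : SimpleGraph V} {D : Type*} [Finite D] [DecidableEq D]
    {σ α : Perm D} (hf : Flat σ α) (hα : ∀ d, α (α d) = d) (j : H.Dart → D)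
    (hj : Function.Injective j) (hrev : ∀ h : H.Dart, j h.symm = α (j h))
    (hσ : ∀ h h' : H.Dart, cyc σ (j h) (j h') ↔ h.fst = h'.fst) : IsPlanar H := by
  classical
  let S : Set D := Set.range j
  have hS : ∀ d ∈ S, α d ∈ S := by
    rintro _ ⟨h, rfl⟩
    exact ⟨h.symm, hrev h⟩
  -- Edges outside the image of `j` are deleted: their darts become fixed points of the involution.
  let f : D → D := fun d => if d ∈ S then α d else d
  have hf2 : ∀ d, f (f d) = d := by
    intro d
    by_cases hd : d ∈ S
    · simp [f, hd, hS d hd, hα]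
    · simp [f, hd]
  let β : Perm D := ⟨f, f, hf2, hf2⟩
  have hβ : ∀ d, β d = if d ∈ S then α d else d := fun d => rfl
  have hflat : Flat σ β := hf.sub hα hf2 fun d => by
    rw [hβ]; split_ifs
    · exact Or.inl rfl
    · exact Or.inr rfl
  have := Fintype.ofFinite D
  obtain ⟨σ', h1, h2, h3⟩ := hflat.isolate_all (Finset.univ.filter fun d => d ∉ S)
    (fun z hz => by rw [hβ, if_neg (Finset.mem_filter.1 hz).2])
  have h2' : ∀ z ∉ Set.range j, σ' z = z := fun z hz =>
    h2 z (Finset.mem_filter.2 ⟨Finset.mem_univ _, hz⟩)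
  have hβ' : ∀ z ∉ Set.range j, β z = z := fun z hz => by rw [hβ, if_neg hz]
  obtain ⟨τ, hτ1, hτ2⟩ := exists_pullback j hj σ' h2'
  have hjβ : ∀ h : H.Dart, j (dartRev H h) = β (j h) := fun h => by
    rw [dartRev_apply, hrev, hβ, if_pos ⟨h, rfl⟩]
  have hmem : ∀ h : H.Dart, j h ∉ Finset.univ.filter (fun d => d ∉ S) := fun h => by
    simp [S]
  refine isPlanar_iff.2 ⟨τ, fun d e => ?_, ?_⟩
  · rw [← hτ2, h3 _ _ (hmem d) (hmem e), hσ]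
  -- After the isolation every dart outside the image of `j` is a singleton vertex, face and
  -- component. Its contributions to the two sides of `Flat` are both `4`, so they cancel.
  have c1 := classes_embedding j (s := cyc σ') (t := cyc τ) hτ2
    (fun z hz d => cyc_fixed (h2' z hz))
  have c2 : classes (cyc (σ' * β)) = classes (cyc (τ * dartRev H)) + Nat.card {z // z ∉ Set.range j} := by
    refine classes_embedding j (fun a b => ?_) (fun z hz d => cyc_fixed ?_)
    · have hc : ∀ (i : ℕ) a, j (((τ * dartRev H) ^ i) a) = ((σ' * β) ^ i) (j a) := by
        intro i
        induction i with
        | zero => simp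
        | succ i ih =>
          intro a
          rw [pow_succ', pow_succ', mul_apply, mul_apply, mul_apply, mul_apply, hτ1, hjβ, ih]
      constructor
      · intro h
        obtain ⟨i, hi⟩ := SameCycle.exists_nat_pow_eq h
        exact ⟨i, by rw [zpow_natCast]; exact hj (by rw [hc, hi])⟩
      · intro h
        obtain ⟨i, hi⟩ := SameCycle.exists_nat_pow_eq h
        exact ⟨i, by rw [zpow_natCast, ← hc, hi]⟩
    · rw [mul_apply, hβ' z hz, h2' z hz]
  have c3 : classes (cyc σ' ⊔ cyc β) = classes (cyc τ ⊔ cyc (dartRev H)) +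
      Nat.card {z // z ∉ Set.range j} := by
    let s : Setoid H.Dart := cyc τ ⊔ cyc (dartRev H)
    -- The pushforward of the partition of the darts of `H` into components, with singletons
    -- elsewhere. It bounds the join on `D` from above.
    let u : Setoid D :=
      { r := fun a b => a = b ∨ ∃ x y, j x = a ∧ j y = b ∧ s x y
        iseqv :=
          { refl := fun a => Or.inl rfl
            symm := by
              rintro a b (h | ⟨x, y, hx, hy, h⟩)
              · exact Or.inl h.symm
              · exact Or.inr ⟨y, x, hy, hx, s.symm h⟩
            trans := by
              rintro a b c (rfl | ⟨x, y, rfl, rfl, h⟩) (rfl | ⟨x', y', hx', rfl, h'⟩)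
              · exact Or.inl rfl
              · exact Or.inr ⟨x', y', hx', rfl, h'⟩
              · exact Or.inr ⟨x, y, rfl, rfl, h⟩
              · rw [hj hx'] at h'
                exact Or.inr ⟨x, y', rfl, rfl, s.trans h h'⟩ } }
    have hu : cyc σ' ⊔ cyc β ≤ u := by
      refine sup_le (cyc_le fun a => ?_) (cyc_le fun a => ?_)
      · by_cases ha : a ∈ Set.range j
        · obtain ⟨x, rfl⟩ := ha
          exact Or.inr ⟨x, τ x, rfl, hτ1 x, (le_sup_left : cyc τ ≤ s) (cyc_apply τ x)⟩
        · exact Or.inl (h2' a ha).symm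
      · by_cases ha : a ∈ Set.range j
        · obtain ⟨x, rfl⟩ := ha
          exact Or.inr ⟨x, dartRev H x, rfl, hjβ x,
            (le_sup_right : cyc (dartRev H) ≤ s) (cyc_apply _ x)⟩
        · exact Or.inl (hβ' a ha).symm
    refine classes_embedding j (fun a b => ⟨fun h => ?_, fun h => ?_⟩) (fun z hz d h => ?_)
    · rcases hu h with h | ⟨x, y, hx, hy, h⟩
      · rw [hj h]
      · rwa [hj hx, hj hy] at h
    · have : s ≤ (cyc σ' ⊔ cyc β).comap j := by
        refine sup_le (cyc_le fun a => ?_) (cyc_le fun a => ?_)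
        · change (cyc σ' ⊔ cyc β) (j a) (j (τ a))
          rw [hτ1]
          exact (le_sup_left : cyc σ' ≤ cyc σ' ⊔ cyc β) (cyc_apply _ _)
        · change (cyc σ' ⊔ cyc β) (j a) (j (dartRev H a))
          rw [hjβ]
          exact (le_sup_right : cyc β ≤ cyc σ' ⊔ cyc β) (cyc_apply _ _)
      exact this h
    · rcases hu h with h | ⟨x, y, hx, hy, h⟩
      · exact h.symm
      · exact absurd ⟨x, hx⟩ hz
  have c4 : moved β = moved (dartRev H) := by
    refine Nat.card_congr (Equiv.ofBijective (fun d : {d // dartRev H d ≠ d} =>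
      (⟨j d.1, by rw [← hjβ]; exact fun h => d.2 (hj h)⟩ : {d // β d ≠ d})) ⟨?_, ?_⟩).symm
    · intro a b h
      exact Subtype.ext (hj (congrArg Subtype.val h))
    · rintro ⟨d, hd⟩
      by_cases hr : d ∈ Set.range j
      · obtain ⟨x, rfl⟩ := hr
        exact ⟨⟨x, fun h => hd (by rw [← hjβ, h])⟩, rfl⟩
      · exact absurd (hβ' d hr) hd
  unfold Flat at *
  omega

/-- Planarity is inherited by minors. -/
theorem IsPlanar.of_minor {W : Type*} [Finite W] {G : SimpleGraph V} {H : SimpleGraph W}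
    (hG : IsPlanar G) (B : W → Set V) (conn : ∀ v ∈ H.support, (G.induce (B v)).Connected)
    (disj : H.support.PairwiseDisjoint B)
    (adj : ∀ u v, H.Adj u v → ∃ x ∈ B u, ∃ y ∈ B v, G.Adj x y) : IsPlanar H := by
  classical
  obtain ⟨σ, hσ, hflat⟩ := isPlanar_iff.1 hG
  have huniq : ∀ {x : V} {v w : W}, v ∈ H.support → w ∈ H.support → x ∈ B v → x ∈ B w →
      v = w := by
    intro x v w hv hw hxv hxw
    by_contra hne
    exact Set.disjoint_left.1 (disj hv hw hne) hxv hxw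
  let I : G.Dart → Prop := fun d => ∃ v ∈ H.support, d.fst ∈ B v ∧ d.snd ∈ B v
  have hI : ∀ d : G.Dart, I d → I d.symm := fun d ⟨v, hv, h1, h2⟩ => ⟨v, hv, h2, h1⟩
  let f : G.Dart → G.Dart := fun d => if I d then d.symm else d
  have hff : ∀ d, f (f d) = d := by
    intro d
    by_cases hd : I d
    · simp [f, hd, hI d hd]
    · simp [f, hd]
  let β : Perm G.Dart := ⟨f, f, hff, hff⟩
  have hβ : ∀ d, β d = if I d then d.symm else d := fun d => rfl
  have hsub : ∀ d, β d = dartRev G d ∨ β d = d := by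
    intro d
    rw [hβ]
    split_ifs
    · exact Or.inl rfl
    · exact Or.inr rfl
  -- The edges inside branch sets are contracted. The vertices of `σ'` that meet a branch set are
  -- then exactly the sets of darts leaving that branch set: `hker` below separates the branch sets,
  -- and `hwalk` uses their connectedness.
  obtain ⟨σ', h1, h2⟩ := Flat.contract _ rfl hflat (dartRev_invol G) hff hsub
  -- the labels of the branch sets
  let F : V → W ⊕ V := fun x =>
    if h : ∃ v ∈ H.support, x ∈ B v then Sum.inl h.choose else Sum.inr x
  have hF : ∀ {x : V} {v : W}, v ∈ H.support → x ∈ B v → F x = Sum.inl v := by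
    intro x v hv hx
    have h : ∃ v ∈ H.support, x ∈ B v := ⟨v, hv, hx⟩
    simp only [F, dif_pos h]
    exact congrArg _ (huniq h.choose_spec.1 hv h.choose_spec.2 hx)
  have hker : cyc σ' ≤ Setoid.ker fun d : G.Dart => F d.fst := by
    rw [h1]
    refine sup_le (cyc_le fun a => ?_) (cyc_le fun a => ?_)
    · rw [Setoid.ker_def, (hσ _ _).1 (cyc_apply σ a)]
    · rw [Setoid.ker_def, hβ]
      split_ifs with ha
      · obtain ⟨v, hv, hx, hy⟩ := ha
        rw [hF hv hx]
        exact (hF hv (x := a.symm.fst) hy).symm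
      · rfl
  have hwalk : ∀ {v : W} (_ : v ∈ H.support) {x y : B v} (_ : (G.induce (B v)).Walk x y)
      (d e : G.Dart), d.fst = x → e.fst = y → cyc σ' d e := by
    intro v hv x y p
    rw [h1]
    have hs1 : ∀ d e : G.Dart, d.fst = e.fst → (cyc σ ⊔ cyc β) d e := fun d e hde =>
      (le_sup_left : cyc σ ≤ cyc σ ⊔ cyc β) ((hσ d e).2 hde)
    induction p with
    | nil => intro d e hd he; exact hs1 d e (hd.trans he.symm)
    | @cons u z w hadj p ih =>
      intro d e hd he
      have hadj' : G.Adj u z := hadj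
      let g : G.Dart := ⟨(u.1, z.1), hadj'⟩
      have hg : β g = g.symm := by rw [hβ, if_pos ⟨v, hv, u.2, z.2⟩]
      refine (cyc σ ⊔ cyc β).trans (hs1 d g hd) ((cyc σ ⊔ cyc β).trans ?_ (ih g.symm e rfl he))
      have := (le_sup_right : cyc β ≤ cyc σ ⊔ cyc β) (cyc_apply β g)
      rwa [hg] at this
  -- representatives of the edges
  have hrep : ∀ h : H.Dart, ∃ d : G.Dart, d.fst ∈ B h.fst ∧ d.snd ∈ B h.snd := by
    intro h
    obtain ⟨x, hx, y, hy, hxy⟩ := adj _ _ h.adj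
    exact ⟨⟨(x, y), hxy⟩, hx, hy⟩
  choose r hr1 hr2 using hrep
  -- One dart of each edge is preferred, and the other one gets the reverse of its representative.
  -- Independent choices for the two darts need not be compatible with reversal.
  have hor : ∀ e : H.edgeSet, ∃ h : H.Dart, h.edge = e.1 := by
    rintro ⟨e, he⟩
    induction e using Sym2.ind with
    | _ u v => exact ⟨⟨(u, v), he⟩, rfl⟩
  choose o ho using hor
  let j : H.Dart → G.Dart := fun h =>
    if h = o ⟨h.edge, h.edge_mem⟩ then r h else (r h.symm).symm
  have hj1 : ∀ h, (j h).fst ∈ B h.fst := by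
    intro h
    simp only [j]
    split_ifs
    · exact hr1 h
    · exact hr2 h.symm
  have hj2 : ∀ h, (j h).snd ∈ B h.snd := by
    intro h
    simp only [j]
    split_ifs
    · exact hr2 h
    · exact hr1 h.symm
  have hs : ∀ h : H.Dart, h.fst ∈ H.support := fun h => ⟨h.snd, h.adj⟩
  have hs' : ∀ h : H.Dart, h.snd ∈ H.support := fun h => ⟨h.fst, h.adj.symm⟩
  have hjs : ∀ h, j h.symm = (j h).symm := by
    intro h
    have he : (⟨h.symm.edge, h.symm.edge_mem⟩ : H.edgeSet) = ⟨h.edge, h.edge_mem⟩ :=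
      Subtype.ext h.edge_symm
    simp only [j, he]
    have := (SimpleGraph.dart_edge_eq_iff h _).1 (ho ⟨h.edge, h.edge_mem⟩).symm
    rcases this with h3 | h3
    · rw [← h3, if_pos rfl, if_neg h.symm_ne, SimpleGraph.Dart.symm_symm]
    · have h4 : o ⟨h.edge, h.edge_mem⟩ = h.symm := by
        have := congrArg SimpleGraph.Dart.symm h3
        rw [SimpleGraph.Dart.symm_symm] at this
        exact this.symm
      rw [h4, if_pos rfl, if_neg h.symm_ne.symm, SimpleGraph.Dart.symm_symm]
  have hinj : Function.Injective j := by
    intro h h' hh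
    refine SimpleGraph.Dart.ext _ _ (Prod.ext ?_ ?_)
    · have := hj1 h'
      rw [← hh] at this
      exact huniq (hs h) (hs h') (hj1 h) this
    · have := hj2 h'
      rw [← hh] at this
      exact huniq (hs' h) (hs' h') (hj2 h) this
  -- Representatives join distinct branch sets, so they are not contracted and the remaining
  -- involution reverses them.
  have hnI : ∀ h, ¬ I (j h) := by
    rintro h ⟨v, hv, h3, h4⟩
    exact h.adj.ne ((huniq (hs h) hv (hj1 h) h3).trans (huniq (hs' h) hv (hj2 h) h4).symm)
  refine isPlanar_of_flat h2 (fun d => ?_) j hinj (fun h => ?_) (fun h h' => ⟨fun hc => ?_, fun hc => ?_⟩)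
  · simp only [mul_apply, dartRev_apply, hβ]
    by_cases hd : I d
    · simp [hd]
    · have : ¬ I d.symm := fun h => hd (by simpa using hI _ h)
      simp [hd, this]
  · rw [mul_apply, hβ, if_neg (hnI h), dartRev_apply, hjs]
  · have := hker hc
    rw [Setoid.ker_def, hF (hs h) (hj1 h), hF (hs h') (hj1 h')] at this
    exact Sum.inl_injective this
  · have hb : (j h').fst ∈ B h.fst := hc ▸ hj1 h'
    obtain ⟨w⟩ := (conn _ (hs h)).preconnected ⟨_, hj1 h⟩ ⟨_, hb⟩
    exact hwalk (hs h) w _ _ rfl rfl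

theorem IsPlanar.mono {G H : SimpleGraph V} (hG : IsPlanar G) (h : H ≤ G) : IsPlanar H := by
  refine hG.of_minor (fun v => {v}) (fun v _ => ?_) ?_ fun u v huv => ⟨u, rfl, v, rfl, h huv⟩
  · have : Nonempty ({v} : Set V) := ⟨⟨v, rfl⟩⟩
    have : Subsingleton ({v} : Set V) := ⟨fun a b => Subtype.ext (a.2.trans b.2.symm)⟩
    exact { preconnected := fun a b => by rw [Subsingleton.elim a b] }
  · intro a _ b _ hab
    simpa [Function.onFun] using hab

/-- The edges of a planar graph are at most six times as many as its vertices. -/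
theorem IsPlanar.card_edgeSet_le {G : SimpleGraph V} (hG : IsPlanar G) :
    Nat.card G.edgeSet ≤ 6 * Nat.card V := by
  classical
  obtain ⟨σ, hσ, h⟩ := hG
  have := Fintype.ofFinite G.Dart
  have := Fintype.ofFinite V
  set φ := σ * dartRev G with hφ
  have hstep : ∀ d, (φ d).fst = d.snd := by
    intro d
    have := (hσ _ _).1 (cyc_apply σ d.symm)
    exact this.symm
  let Q := Quotient (cyc φ)
  have : Fintype Q := Fintype.ofFinite _
  have hfc : faceCount G σ = Fintype.card Q := Nat.card_eq_fintype_card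
  -- a face with at most two darts
  have hno : ∀ d, φ (φ d) = d → φ d = d.symm := by
    intro d hd
    refine SimpleGraph.Dart.ext _ _ (Prod.ext (hstep d) ?_)
    have := hstep (φ d)
    rw [hd] at this
    exact this.symm
  -- Since the graph is simple, a closed face walk of at most two steps goes along an edge and back.
  -- Then `d` is fixed by the rotation, so it is the only dart at its vertex. This makes the map
  -- from short faces to vertices injective.
  have hdeg : ∀ d e : G.Dart, φ (φ d) = d → d.fst = e.fst → e = d := by
    intro d e hd hde
    have h1 : σ d = d := by
      have h2 : φ d.symm = d := by rw [← hno d hd, hd]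
      rw [hφ, mul_apply, dartRev_apply, SimpleGraph.Dart.symm_symm] at h2
      exact h2
    exact cyc_fixed h1 ((hσ d e).2 hde)
  let w : Q → ℕ := fun q => (Finset.univ.filter fun d : G.Dart => Quotient.mk (cyc φ) d = q).card
  have hw : ∑ q, w q = Fintype.card G.Dart := by
    rw [← Finset.card_univ]
    exact (Finset.card_eq_sum_card_fiberwise fun d _ => Finset.mem_coe.2 (Finset.mem_univ _)).symm
  let bad : Finset Q := Finset.univ.filter fun q => ∃ d, Quotient.mk (cyc φ) d = q ∧ φ (φ d) = d
  have hbad : bad.card ≤ Fintype.card V := by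
    have hch : ∀ q : bad, ∃ d, Quotient.mk (cyc φ) d = q.1 ∧ φ (φ d) = d := fun q =>
      (Finset.mem_filter.1 q.2).2
    choose c hc1 hc2 using hch
    rw [← Fintype.card_coe]
    refine Fintype.card_le_of_injective (fun q => (c q).fst) fun p q hpq => ?_
    have := hdeg _ _ (hc2 p) hpq
    exact Subtype.ext (by rw [← hc1 p, ← hc1 q, this])
  have hw3 : ∀ q, 3 ≤ w q + (if q ∈ bad then 3 else 0) := by
    intro q
    split_ifs with hq
    · omega
    · induction q using Quotient.inductionOn with
      | h d =>
      have h0 : φ (φ d) ≠ d := fun h => hq (Finset.mem_filter.2 ⟨Finset.mem_univ _, d, rfl, h⟩)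
      have h1 : φ d ≠ d := fun h => h0 (by rw [h, h])
      have hsub : ({d, φ d, φ (φ d)} : Finset G.Dart) ⊆
          Finset.univ.filter fun e : G.Dart => Quotient.mk (cyc φ) e = Quotient.mk (cyc φ) d := by
        intro e he
        simp only [Finset.mem_insert, Finset.mem_singleton] at he
        refine Finset.mem_filter.2 ⟨Finset.mem_univ _, Quotient.sound ((cyc φ).symm ?_)⟩
        rcases he with rfl | rfl | rfl
        · exact (cyc φ).refl _
        · exact cyc_apply φ d
        · exact (cyc φ).trans (cyc_apply φ d) (cyc_apply φ _)
      have := Finset.card_le_card hsub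
      rw [Finset.card_eq_three.2 ⟨d, φ d, φ (φ d), h1.symm, h0.symm, fun h => h1 (φ.injective h).symm, rfl⟩] at this
      simpa [w] using this
  -- Summation over the `F` faces gives `3 F ≤ 2 E + 3 |V|`, as at most `|V|` faces are short.
  -- Euler's formula gives `E ≤ F + |V|`, and together `E ≤ 6 |V|`.
  have hsum := Finset.sum_le_sum fun q (_ : q ∈ Finset.univ) => hw3 q
  rw [Finset.sum_add_distrib, hw, ← Finset.sum_filter, Finset.sum_const, Finset.sum_const] at hsum
  have hb' : (Finset.univ.filter fun q => q ∈ bad) = bad := by ext; simp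
  rw [hb', Finset.card_univ] at hsum
  have hd := card_dart G
  rw [Nat.card_eq_fintype_card] at hd
  have hsV : Nat.card G.support ≤ Nat.card V := Nat.card_le_card_of_injective _ Subtype.val_injective
  rw [Nat.card_eq_fintype_card (α := V)] at *
  simp only [smul_eq_mul] at hsum
  omega

end Planar

end DynDist

namespace DynDist

variable {n : ℕ}

/-! ## Distances -/

theorem toGraph_adj {G : WGraph n} {u v : Fin n} :
    G.toGraph.Adj u v ↔ (∃ e ∈ G, ends e = s(u, v)) ∧ u ≠ v := by
  simp [WGraph.toGraph]

theorem toGraph_mono {G H : WGraph n} (h : ∀ e ∈ G, e ∈ H) : G.toGraph ≤ H.toGraph := by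
  intro u v huv
  rw [toGraph_adj] at *
  obtain ⟨⟨e, he, h1⟩, h2⟩ := huv
  exact ⟨⟨e, h e he, h1⟩, h2⟩

theorem ends_eq {e : Fin n × Fin n × ℝ≥0} {u v : Fin n} :
    ends e = s(u, v) ↔ (e.1 = u ∧ e.2.1 = v) ∨ (e.1 = v ∧ e.2.1 = u) := by
  simp [ends]

theorem weight_le {G : WGraph n} {e : Fin n × Fin n × ℝ≥0} (he : e ∈ G) {u v : Fin n}
    (h : ends e = s(u, v)) : G.weight u v ≤ e.2.2 :=
  iInf₂_le (f := fun (e : Fin n × Fin n × ℝ≥0) (_ : e ∈ {e | e ∈ G ∧ ends e = s(u, v)}) =>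
    (e.2.2 : ℝ≥0∞)) e ⟨he, h⟩

theorem exists_weight {G : WGraph n} {u v : Fin n} (h : G.toGraph.Adj u v) :
    ∃ e ∈ G, ends e = s(u, v) ∧ G.weight u v = e.2.2 := by
  classical
  obtain ⟨⟨e, he, h1⟩, _⟩ := toGraph_adj.1 h
  obtain ⟨m, hm, hmin⟩ := Finset.exists_min_image
    (G.toFinset.filter fun e => ends e = s(u, v)) (fun e => e.2.2) ⟨e, by simp [he, h1]⟩
  simp only [Finset.mem_filter, List.mem_toFinset] at hm hmin
  refine ⟨m, hm.1, hm.2, le_antisymm (weight_le hm.1 hm.2) ?_⟩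
  exact le_iInf₂ fun e he => by exact_mod_cast hmin e he

theorem dist_cons {G : WGraph n} {u v : Fin n} (h : G.toGraph.Adj u v) (z : Fin n) :
    G.dist u z ≤ G.weight u v + G.dist v z := by
  unfold WGraph.dist
  rw [ENNReal.add_iInf]
  exact le_iInf fun p => (iInf_le _ (SimpleGraph.Walk.cons h p)).trans (by simp)

theorem dist_self (G : WGraph n) (u : Fin n) : G.dist u u = 0 :=
  le_antisymm ((iInf_le _ SimpleGraph.Walk.nil).trans (by simp)) (zero_le)

theorem dist_edge_cons {G : WGraph n} {e : Fin n × Fin n × ℝ≥0} (he : e ∈ G) (z : Fin n) :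
    G.dist e.1 z ≤ e.2.2 + G.dist e.2.1 z ∧ G.dist e.2.1 z ≤ e.2.2 + G.dist e.1 z := by
  by_cases h : e.1 = e.2.1
  · rw [h]; exact ⟨le_add_self, le_add_self⟩
  have h1 : ends e = s(e.1, e.2.1) := rfl
  have h2 : ends e = s(e.2.1, e.1) := Sym2.eq_swap
  exact ⟨(dist_cons (toGraph_adj.2 ⟨⟨e, he, h1⟩, h⟩) z).trans (by gcongr; exact weight_le he h1),
    (dist_cons (toGraph_adj.2 ⟨⟨e, he, h2⟩, Ne.symm h⟩) z).trans (by gcongr; exact weight_le he h2)⟩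

/-- A function that is Lipschitz along the edges is Lipschitz for the distance. -/
theorem lipschitz_dist {G : WGraph n} {c : ℝ≥0∞} (c0 : c ≠ 0) (ct : c ≠ ∞)
    {f : Fin n → ℝ≥0∞}
    (h : ∀ e ∈ G, f e.1 ≤ c * e.2.2 + f e.2.1 ∧ f e.2.1 ≤ c * e.2.2 + f e.1) (u v : Fin n) :
    f u ≤ c * G.dist u v + f v := by
  unfold WGraph.dist
  rw [ENNReal.mul_iInf_of_ne c0 ct, ENNReal.iInf_add]
  refine le_iInf fun p => ?_
  induction p with
  | nil => simp
  | @cons a b d hab p ih =>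
    obtain ⟨e, he, h1, h2⟩ := exists_weight hab
    have h3 : f a ≤ c * e.2.2 + f b := by
      rcases ends_eq.1 h1 with ⟨rfl, rfl⟩ | ⟨rfl, rfl⟩
      · exact (h e he).1
      · exact (h e he).2
    simp only [SimpleGraph.Walk.darts_cons, List.map_cons, List.sum_cons, h2]
    rw [mul_add, add_assoc]
    exact h3.trans (by gcongr)

theorem dist_triangle (G : WGraph n) (u v z : Fin n) : G.dist u z ≤ G.dist u v + G.dist v z := by
  have := lipschitz_dist (G := G) one_ne_zero ENNReal.one_ne_top (f := fun x => G.dist x z)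
    (fun e he => by simpa using dist_edge_cons he z) u v
  simpa using this

theorem dist_edge {G : WGraph n} {e : Fin n × Fin n × ℝ≥0} (he : e ∈ G) :
    G.dist e.1 e.2.1 ≤ e.2.2 ∧ G.dist e.2.1 e.1 ≤ e.2.2 := by
  have h1 := (dist_edge_cons he e.2.1).1
  have h2 := (dist_edge_cons he e.1).2
  rw [dist_self, add_zero] at h1 h2
  exact ⟨h1, h2⟩

theorem dist_symm_le (G : WGraph n) (u v : Fin n) : G.dist u v ≤ G.dist v u := by
  have := lipschitz_dist (G := G) one_ne_zero ENNReal.one_ne_top (f := fun x => G.dist u x)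
    (fun e he => by
      rw [one_mul, add_comm, add_comm (e.2.2 : ℝ≥0∞)]
      exact ⟨(dist_triangle G u e.2.1 e.1).trans (by gcongr; exact (dist_edge he).2),
        (dist_triangle G u e.1 e.2.1).trans (by gcongr; exact (dist_edge he).1)⟩) v u
  simpa [dist_self] using this

theorem dist_comm (G : WGraph n) (u v : Fin n) : G.dist u v = G.dist v u :=
  le_antisymm (dist_symm_le G u v) (dist_symm_le G v u)

/-- By the triangle inequality the function `G.dist · v` is Lipschitz along the edges of `H`, and it
vanishes at `v`. -/
theorem dist_le_dist {G H : WGraph n} (h : ∀ e ∈ H, G.dist e.1 e.2.1 ≤ e.2.2) (u v : Fin n) :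
    G.dist u v ≤ H.dist u v := by
  have := lipschitz_dist (G := H) one_ne_zero ENNReal.one_ne_top (f := fun x => G.dist x v)
    (fun e he => by
      rw [one_mul]
      exact ⟨(dist_triangle G e.1 e.2.1 v).trans (by gcongr; exact h e he),
        (dist_triangle G e.2.1 e.1 v).trans
          (by gcongr; rw [dist_comm]; exact h e he)⟩) u v
  simpa [dist_self] using this

theorem dist_anti {G H : WGraph n} (h : ∀ e ∈ H, e ∈ G) (u v : Fin n) :
    G.dist u v ≤ H.dist u v :=
  dist_le_dist (fun e he => (dist_edge (h e he)).1) u v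

theorem dist_congr {G H : WGraph n} (h : ∀ e, e ∈ G ↔ e ∈ H) (u v : Fin n) :
    G.dist u v = H.dist u v :=
  le_antisymm (dist_anti (fun e he => (h e).2 he) u v) (dist_anti (fun e he => (h e).1 he) u v)

theorem toGraph_congr {G H : WGraph n} (h : ∀ e, e ∈ G ↔ e ∈ H) : G.toGraph = H.toGraph :=
  le_antisymm (toGraph_mono fun e he => (h e).1 he) (toGraph_mono fun e he => (h e).2 he)

/-- `H` is obtained from `G` by deleting loops and all but a lightest one of parallel edges. -/
def Reduces (G H : WGraph n) : Prop :=
  (∀ e ∈ H, e ∈ G) ∧ ∀ e ∈ G, e.1 ≠ e.2.1 → ∃ e' ∈ H, ends e' = ends e ∧ e'.2.2 ≤ e.2.2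

theorem Reduces.dist_eq {G H : WGraph n} (h : Reduces G H) (u v : Fin n) :
    H.dist u v = G.dist u v := by
  refine le_antisymm (dist_le_dist (fun e he => ?_) u v) (dist_anti h.1 u v)
  by_cases hl : e.1 = e.2.1
  · rw [hl, dist_self]; exact zero_le
  obtain ⟨e', he', h1, h2⟩ := h.2 e he hl
  have h3 : (e'.2.2 : ℝ≥0∞) ≤ e.2.2 := by exact_mod_cast h2
  have h4 : ends e' = s(e.1, e.2.1) := h1
  rcases ends_eq.1 h4 with ⟨h5, h6⟩ | ⟨h5, h6⟩
  · rw [← h5, ← h6]; exact (dist_edge he').1.trans h3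
  · rw [← h5, ← h6]; exact (dist_edge he').2.trans h3

theorem Reduces.toGraph_eq {G H : WGraph n} (h : Reduces G H) : H.toGraph = G.toGraph := by
  refine le_antisymm (toGraph_mono h.1) fun u v huv => ?_
  rw [toGraph_adj] at *
  obtain ⟨⟨e, he, h1⟩, h2⟩ := huv
  have hl : e.1 ≠ e.2.1 := by
    rcases ends_eq.1 h1 with ⟨rfl, rfl⟩ | ⟨rfl, rfl⟩
    · exact h2
    · exact h2.symm
  obtain ⟨e', he', h3, _⟩ := h.2 e he hl
  exact ⟨⟨e', he', h3.trans h1⟩, h2⟩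

/-- Approximate distances are preserved when edges between terminals are added. -/
theorem dist_append_le {A A' X : WGraph n} {T : Set (Fin n)} {c : ℝ≥0∞} (c1 : 1 ≤ c)
    (ct : c ≠ ∞) (h : ∀ u ∈ T, ∀ v ∈ T, A'.dist u v ≤ c * A.dist u v)
    (hX : ∀ e ∈ X, e.1 ∈ T ∧ e.2.1 ∈ T) {u v : Fin n} (hu : u ∈ T) (hv : v ∈ T) :
    WGraph.dist (A' ++ X) u v ≤ c * WGraph.dist (A ++ X) u v := by
  have c0 : c ≠ 0 := (zero_lt_one.trans_le c1).ne'
  set B' : WGraph n := A' ++ X with hB'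
  set B : WGraph n := A ++ X with hB
  have hA'B : ∀ x y, B'.dist x y ≤ A'.dist x y := dist_anti fun e he => by simp [hB', he]
  -- A potential: travel in `A`, with lengths multiplied by `c`, to some terminal, and from there in
  -- `B'` to `v`. It is `c`-Lipschitz along the edges of `A` by the triangle inequality, and along
  -- those of `X` because at terminals it equals `B'.dist · v`: the sparsifier replaces the first
  -- leg.
  let f : Fin n → ℝ≥0∞ := fun z => ⨅ t : T, (c * A.dist z t + B'.dist t v)
  have hf : ∀ t ∈ T, ∀ s : T, B'.dist t v ≤ c * A.dist t s + B'.dist s v := fun t ht s =>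
    (dist_triangle _ _ _ _).trans
      (add_le_add_left ((hA'B _ _).trans (h t ht s s.2)) _)
  have hle : ∀ t ∈ T, f t ≤ B'.dist t v := fun t ht =>
    (iInf_le _ (⟨t, ht⟩ : T)).trans (by simp [dist_self])
  have hA : ∀ a b : Fin n, ∀ w : ℝ≥0∞, (∀ z, A.dist a z ≤ w + A.dist b z) →
      f a ≤ c * w + f b := by
    intro a b w hw
    simp only [f]
    rw [ENNReal.add_iInf]
    refine le_iInf fun t => (iInf_le _ t).trans ?_
    rw [← add_assoc, ← mul_add]
    gcongr
    exact hw t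
  have hXX : ∀ a b : Fin n, a ∈ T → b ∈ T → ∀ w : ℝ≥0∞, B'.dist a b ≤ w →
      f a ≤ c * w + f b := by
    intro a b ha hb w hw
    refine (hle a ha).trans ((dist_triangle _ a b v).trans ?_)
    refine add_le_add (hw.trans (le_mul_of_one_le_left' c1)) ?_
    exact le_iInf fun s => hf b hb s
  have key := lipschitz_dist (G := B) c0 ct (f := f) (fun e he => by
    rcases List.mem_append.1 he with he | he
    · exact ⟨hA _ _ _ fun z => (dist_edge_cons he z).1, hA _ _ _ fun z => (dist_edge_cons he z).2⟩
    · have he' : e ∈ B' := by simp [hB', he]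
      obtain ⟨h1, h2⟩ := hX e he
      exact ⟨hXX _ _ h1 h2 _ (dist_edge he').1, hXX _ _ h2 h1 _ (dist_edge he').2⟩) u v
  have hfv : f v = 0 := le_antisymm ((hle v hv).trans (by simp [dist_self])) (zero_le)
  rw [hfv, add_zero] at key
  exact (le_iInf fun s => hf u hu s).trans key

/-! ## Planarity of hierarchies of sparsifiers -/

/-- The same branch sets work with `X` on both sides: an edge of `X` joins terminals, and every
terminal lies in its own branch set, so the edge itself connects the two branch sets. -/
theorem IsTerminalMinor.planar_append {A A' X : WGraph n} {T : Set (Fin n)}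
    (h : IsTerminalMinor A.toGraph T A'.toGraph) (hX : ∀ e ∈ X, e.1 ∈ T ∧ e.2.1 ∈ T)
    (hp : IsPlanar (WGraph.toGraph (A ++ X))) : IsPlanar (WGraph.toGraph (A' ++ X)) := by
  obtain ⟨B, h1, h2, h3, h4⟩ := h
  have hadj : ∀ {u v}, (WGraph.toGraph (A' ++ X)).Adj u v →
      A'.toGraph.Adj u v ∨ (u ∈ T ∧ v ∈ T ∧ X.toGraph.Adj u v) := by
    intro u v huv
    obtain ⟨⟨e, he, h5⟩, h6⟩ := toGraph_adj.1 huv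
    rcases List.mem_append.1 he with he | he
    · exact Or.inl (toGraph_adj.2 ⟨⟨e, he, h5⟩, h6⟩)
    · refine Or.inr ?_
      have := hX e he
      rcases ends_eq.1 h5 with ⟨rfl, rfl⟩ | ⟨rfl, rfl⟩
      · exact ⟨this.1, this.2, toGraph_adj.2 ⟨⟨e, he, h5⟩, h6⟩⟩
      · exact ⟨this.2, this.1, toGraph_adj.2 ⟨⟨e, he, h5⟩, h6⟩⟩
  have hsup : ∀ v ∈ (WGraph.toGraph (A' ++ X)).support, v ∈ T ∪ A'.toGraph.support := by
    rintro v ⟨w, hvw⟩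
    rcases hadj hvw with h | ⟨h, _, _⟩
    · exact Or.inr ⟨w, h⟩
    · exact Or.inl h
  have hA : A.toGraph ≤ WGraph.toGraph (A ++ X) := toGraph_mono fun e he => by simp [he]
  have hXX : X.toGraph ≤ WGraph.toGraph (A ++ X) := toGraph_mono fun e he => by simp [he]
  refine hp.of_minor B (fun v hv => (h1 v (hsup v hv)).mono fun x y hxy => hA hxy)
    (h2.subset hsup) fun u v huv => ?_
  rcases hadj huv with h | ⟨hu, hv, h⟩
  · obtain ⟨x, hx, y, hy, hxy⟩ := h4 u v h
    exact ⟨x, hx, y, hy, hA hxy⟩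
  · exact ⟨u, h3 u hu, v, h3 v hv, hXX h⟩

/-! ### Permanent edges, states of the dynamic graph and boundaries of intervals. -/

theorem mem_block {ops : List (Op n)} {r s : ℕ} {x : Op n} :
    x ∈ block ops r s ↔ ∃ i, r ≤ i ∧ i < s ∧ ops[i]? = some x := by
  unfold block
  rw [List.mem_iff_getElem?]
  simp only [List.getElem?_take, List.getElem?_drop]
  constructor
  · rintro ⟨i, hi⟩
    split_ifs at hi with h
    · exact ⟨r + i, by omega, by omega, hi⟩
  · rintro ⟨i, h1, h2, h3⟩
    exact ⟨i - r, by rw [if_pos (by omega), show r + (i - r) = i by omega, h3]⟩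

/-- The graph before the operation with the number `τ`. -/
def stateAt (G : WGraph n) (ops : List (Op n)) (τ : ℕ) : WGraph n :=
  (ops.take τ).foldl WGraph.step G

theorem stateAt_succ (G : WGraph n) (ops : List (Op n)) {τ : ℕ} {x : Op n}
    (h : ops[τ]? = some x) : stateAt G ops (τ + 1) = (stateAt G ops τ).step x := by
  unfold stateAt
  rw [List.take_add_one, h]
  simp

theorem PlanarRun.stateAt {G : WGraph n} {ops : List (Op n)} (h : PlanarRun G ops) :
    ∀ τ, IsPlanar (stateAt G ops τ).toGraph := by
  induction ops generalizing G with
  | nil => intro τ; simpa [DynDist.stateAt, PlanarRun] using h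
  | cons x ops ih =>
    intro τ
    cases τ with
    | zero => exact h.1
    | succ τ => exact ih h.2.2 τ

theorem mem_step_of_mem {G : WGraph n} {x : Op n} {e : Fin n × Fin n × ℝ≥0} (he : e ∈ G)
    (hx : ∀ u v, x = .delete u v → ends e ≠ s(u, v)) : e ∈ G.step x := by
  cases x with
  | insert u v w => exact List.mem_cons_of_mem _ he
  | delete u v => exact List.mem_filter.2 ⟨he, by simpa using hx u v rfl⟩
  | query u v => exact he

theorem mem_of_mem_step {G : WGraph n} {x : Op n} {e : Fin n × Fin n × ℝ≥0}
    (he : e ∈ G.step x) : e ∈ G ∨ x.ends = ends e := by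
  cases x with
  | insert u v w =>
    rcases List.mem_cons.1 he with rfl | he
    · exact Or.inr rfl
    · exact Or.inl he
  | delete u v => exact Or.inl (List.mem_of_mem_filter he)
  | query u v => exact Or.inl he

theorem mem_permanent {G : WGraph n} {ops : List (Op n)} {r s : ℕ}
    {e : Fin n × Fin n × ℝ≥0} :
    e ∈ permanent G ops r s ↔ e ∈ stateAt G ops r ∧
      ∀ x ∈ block ops r s, ∀ u v, x = .delete u v → ends e ≠ s(u, v) := by
  unfold permanent stateAt
  rw [List.mem_filter]
  refine and_congr_right fun _ => ?_
  simp only [List.mem_filterMap, not_exists, not_and, decide_eq_true_eq]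
  constructor
  · rintro h x hx u v rfl he
    exact h _ hx (by rw [he])
  · intro h x hx hm
    cases x with
    | insert u v w => simp at hm
    | delete u v => exact h _ hx u v rfl (by simpa using hm.symm)
    | query u v => simp at hm

theorem permanent_subset {G : WGraph n} {ops : List (Op n)} {r s τ : ℕ} (h1 : r ≤ τ)
    (h2 : τ ≤ s) {e : Fin n × Fin n × ℝ≥0} (he : e ∈ permanent G ops r s) :
    e ∈ stateAt G ops τ := by
  rw [mem_permanent] at he
  induction τ, h1 using Nat.le_induction with
  | base => exact he.1
  | succ τ hτ ih =>
    have := ih (by omega)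
    cases hx : ops[τ]? with
    | none =>
      have hl : ops.length ≤ τ := List.getElem?_eq_none_iff.1 hx
      unfold stateAt at *
      rw [List.take_of_length_le (by omega)]
      rwa [List.take_of_length_le hl] at this
    | some x =>
      rw [stateAt_succ _ _ hx]
      exact mem_step_of_mem this (he.2 x (mem_block.2 ⟨τ, hτ, by omega, hx⟩))

/-- An edge that was there at the beginning fails to be permanent only because the interval deletes
it; any other edge present at time `τ` has been inserted within the interval. In both cases an
operation of the interval names its ends. -/
theorem mem_boundary_of_mem_stateAt {G : WGraph n} {ops : List (Op n)} {r s τ : ℕ} (h1 : r ≤ τ)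
    (h2 : τ ≤ s) {e : Fin n × Fin n × ℝ≥0} (he : e ∈ stateAt G ops τ)
    (hp : e ∉ permanent G ops r s) : ∃ x ∈ block ops r s, x.ends = ends e := by
  induction τ, h1 using Nat.le_induction with
  | base =>
    rw [mem_permanent] at hp
    push Not at hp
    obtain ⟨x, hx, u, v, rfl, h⟩ := hp he
    exact ⟨_, hx, h.symm⟩
  | succ τ hτ ih =>
    cases hx : ops[τ]? with
    | none =>
      -- Beyond the end of the list the state no longer changes.
      have hl : ops.length ≤ τ := List.getElem?_eq_none_iff.1 hx
      refine ih (by omega) ?_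
      unfold stateAt at *
      rw [List.take_of_length_le (by omega)] at he
      rwa [List.take_of_length_le hl]
    | some x =>
      rw [stateAt_succ _ _ hx] at he
      rcases mem_of_mem_step he with he | he
      · exact ih (by omega) he
      · exact ⟨x, mem_block.2 ⟨τ, hτ, by omega, hx⟩, he⟩

theorem permanent_mono {G : WGraph n} {ops : List (Op n)} {q t r s : ℕ} (h1 : q ≤ r)
    (h2 : r ≤ s) (h3 : s ≤ t) {e : Fin n × Fin n × ℝ≥0} (he : e ∈ permanent G ops q t) :
    e ∈ permanent G ops r s := by
  refine mem_permanent.2 ⟨permanent_subset h1 (by omega) he, fun x hx => ?_⟩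
  obtain ⟨i, h4, h5, h6⟩ := mem_block.1 hx
  exact (mem_permanent.1 he).2 x (mem_block.2 ⟨i, by omega, by omega, h6⟩)

/-- Planarity of `G'` alone would not carry over to a child, where new permanent edges are added.
The induction therefore keeps all the edges of the state at time `τ` that are not permanent for the
interval. -/
theorem Hierarchy.planar_append {ε : ℝ} {G : WGraph n} {ops : List (Op n)}
    (hrun : PlanarRun G ops) {r s : ℕ} {G'' G' : WGraph n} (h : Hierarchy ε G ops r s G'' G') :
    r ≤ s ∧ ∀ τ, r ≤ τ → τ ≤ s →
      IsPlanar (WGraph.toGraph (G'' ++ (stateAt G ops τ).filter fun e =>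
        ends e ∉ (permanent G ops r s).map ends)) ∧
      IsPlanar (WGraph.toGraph (G' ++ (stateAt G ops τ).filter fun e =>
        ends e ∉ (permanent G ops r s).map ends)) := by
  induction h with
  | root =>
    refine ⟨Nat.zero_le _, fun τ h1 h2 => ?_⟩
    have : IsPlanar (WGraph.toGraph (permanent G ops 0 ops.length ++
        (stateAt G ops τ).filter fun e =>
          ends e ∉ (permanent G ops 0 ops.length).map ends)) := by
      refine (hrun.stateAt τ).mono (toGraph_mono fun e he => ?_)
      rcases List.mem_append.1 he with he | he
      · exact permanent_subset h1 h2 he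
      · exact List.mem_of_mem_filter he
    exact ⟨this, this⟩
  | @child q t r s K'' K' G' hK h1 h2 h3 hm ih =>
    refine ⟨h2.le, fun τ h4 h5 => ?_⟩
    have hsub : ∀ e : Fin n × Fin n × ℝ≥0, ends e ∈ (permanent G ops q t).map ends →
        ends e ∈ (permanent G ops r s).map ends := by
      intro e he
      obtain ⟨e', he', h6⟩ := List.mem_map.1 he
      exact List.mem_map.2 ⟨e', permanent_mono h1 h2.le h3 he', h6⟩
    -- New permanent edges of the child and edges not permanent for the child are both among the
    -- edges not permanent for the parent, at the same time `τ`.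
    have hp : IsPlanar (WGraph.toGraph (K' ++ newPermanent G ops q t r s ++
        (stateAt G ops τ).filter fun e => ends e ∉ (permanent G ops r s).map ends)) := by
      refine (ih.2 τ (by omega) (by omega)).2.mono (toGraph_mono fun e he => ?_)
      simp only [List.mem_append, newPermanent, List.mem_filter, decide_eq_true_eq] at he ⊢
      rcases he with (he | he) | he
      · exact Or.inl he
      · exact Or.inr ⟨permanent_subset h4 h5 he.1, he.2⟩
      · exact Or.inr ⟨he.1, fun h => he.2 (hsub e h)⟩
    -- The edges kept beside the sparsifier have both ends in the boundary, that is, among the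
    -- terminals.
    refine ⟨hp, hm.1.planar_append (fun e he => ?_) hp⟩
    simp only [List.mem_filter, decide_eq_true_eq] at he
    obtain ⟨x, hx, h6⟩ := mem_boundary_of_mem_stateAt h4 h5 he.1
      (fun h => he.2 (List.mem_map_of_mem h))
    exact ⟨⟨x, hx, by rw [h6]; exact Sym2.mem_mk_left _ _⟩,
      ⟨x, hx, by rw [h6]; exact Sym2.mem_mk_right _ _⟩⟩

theorem Hierarchy.planar {ε : ℝ} {G : WGraph n} {ops : List (Op n)}
    (hrun : PlanarRun G ops) {r s : ℕ} {G'' G' : WGraph n} (h : Hierarchy ε G ops r s G'' G') :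
    IsPlanar G''.toGraph ∧ IsPlanar G'.toGraph := by
  obtain ⟨h1, h2⟩ := h.planar_append hrun
  obtain ⟨h3, h4⟩ := h2 r le_rfl h1
  exact ⟨h3.mono (toGraph_mono fun e he => List.mem_append_left _ he),
    h4.mono (toGraph_mono fun e he => List.mem_append_left _ he)⟩

end DynDist

namespace DynDist

/-! ## Uniform computations

Families of inputs and outputs are indexed by the valid instances `i : ι`. All the time bounds are
of the form `(w i + 2) ^ k * (N i + 1)`, where `w` is a polylogarithmic parameter and `N` a
budget. -/

section Computations

universe u v

variable {ι : Type u} {w N : ι → ℕ}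

/-- `f` is bounded by a polynomial in `w` times `N`. -/
def Bdd (w N f : ι → ℕ) : Prop := ∃ k, ∀ i, f i ≤ (w i + 2) ^ k * (N i + 1)

/-- One program computes `y i` from `x i` for all `i`, in time polynomial in `w` times `N`. -/
def Comp (w N : ι → ℕ) (x y : ι → Val) : Prop :=
  ∃ (c : Code) (k : ℕ), ∀ i, ∃ t, c.Runs (x i) (y i) t ∧ t ≤ (w i + 2) ^ k * (N i + 1)

theorem pow_le_pow_two {W k l : ℕ} (h : k ≤ l) : (W + 2) ^ k ≤ (W + 2) ^ l :=
  Nat.pow_le_pow_right (by omega) h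

/-- The base is at least `2`, so constant factors turn into powers; the exponent `2` pays for the
sum of three terms, as `3 ≤ 4 ≤ (W + 2) ^ 2`. One such step is used for each construct of the
programming language. -/
theorem bound_add {W M a b k l : ℕ} (ha : a ≤ (W + 2) ^ k * (M + 1))
    (hb : b ≤ (W + 2) ^ l * (M + 1)) : a + b + 1 ≤ (W + 2) ^ (k + l + 2) * (M + 1) := by
  have h1 : 1 ≤ (W + 2) ^ k := Nat.one_le_pow _ _ (by omega)
  have h2 : 1 ≤ (W + 2) ^ l := Nat.one_le_pow _ _ (by omega)
  have h3 : (W + 2) ^ k ≤ (W + 2) ^ k * (W + 2) ^ l := Nat.le_mul_of_pos_right _ h2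
  have h4 : (W + 2) ^ l ≤ (W + 2) ^ k * (W + 2) ^ l := Nat.le_mul_of_pos_left _ h1
  have h5 : 1 ≤ (W + 2) ^ k * (W + 2) ^ l := h1.trans h3
  have h6 : 4 ≤ (W + 2) ^ 2 := by
    calc 4 = 2 ^ 2 := rfl
      _ ≤ _ := Nat.pow_le_pow_left (by omega) 2
  have h7 : 1 ≤ M + 1 := by omega
  rw [pow_add, pow_add]
  generalize (W + 2) ^ k = p at *
  generalize (W + 2) ^ l = q at *
  generalize (W + 2) ^ 2 = r at *
  generalize M + 1 = m at *
  calc a + b + 1 ≤ p * m + q * m + 1 * 1 := by omega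
    _ ≤ p * q * m + p * q * m + p * q * m := by gcongr
    _ ≤ p * q * 4 * m := by nlinarith
    _ ≤ p * q * r * m := by gcongr

namespace Bdd

theorem of_le {f g : ι → ℕ} (h : Bdd w N g) (hfg : ∀ i, f i ≤ g i) : Bdd w N f :=
  h.imp fun _ hk i => (hfg i).trans (hk i)

theorem self : Bdd w N N :=
  ⟨0, fun i => by simp⟩

theorem weight : Bdd w N w :=
  ⟨1, fun i => by rw [pow_one]; nlinarith [Nat.zero_le (w i * N i), Nat.zero_le (N i)]⟩

theorem const (c : ℕ) : Bdd w N fun _ => c :=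
  ⟨c, fun i => (Nat.lt_two_pow_self (n := c)).le.trans
    ((Nat.pow_le_pow_left (by omega : 2 ≤ w i + 2) c).trans (Nat.le_mul_of_pos_right _ (by omega)))⟩

theorem add {f g : ι → ℕ} (hf : Bdd w N f) (hg : Bdd w N g) : Bdd w N fun i => f i + g i := by
  obtain ⟨k, hk⟩ := hf
  obtain ⟨l, hl⟩ := hg
  exact ⟨k + l + 2, fun i => (Nat.le_succ _).trans (bound_add (hk i) (hl i))⟩

theorem mul {f g : ι → ℕ} (hf : Bdd w (fun _ => 0) f) (hg : Bdd w N g) :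
    Bdd w N fun i => f i * g i := by
  obtain ⟨k, hk⟩ := hf
  obtain ⟨l, hl⟩ := hg
  refine ⟨k + l, fun i => (Nat.mul_le_mul (hk i) (hl i)).trans (le_of_eq ?_)⟩
  rw [pow_add]; ring

theorem pow {f : ι → ℕ} (hf : Bdd w (fun _ => 0) f) (m : ℕ) :
    Bdd w (fun _ => 0) fun i => f i ^ m := by
  induction m with
  | zero => simpa using const 1
  | succ m ih => simpa [pow_succ] using ih.mul hf

theorem comap {ι' : Type v} {f : ι → ℕ} (hf : Bdd w N f) (g : ι' → ι) :
    Bdd (fun i => w (g i)) (fun i => N (g i)) fun i => f (g i) :=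
  hf.imp fun _ hk i => hk (g i)

theorem trans {M f : ι → ℕ} (hf : Bdd w M f) (hM : Bdd w N M) : Bdd w N f := by
  obtain ⟨k, hk⟩ := hf
  obtain ⟨l, hl⟩ := hM.add (const 1)
  refine ⟨k + l, fun i => (hk i).trans ?_⟩
  rw [pow_add, mul_assoc]
  exact Nat.mul_le_mul le_rfl (hl i)

theorem of_zero {f : ι → ℕ} (hf : Bdd w (fun _ => 0) f) : Bdd w N f :=
  hf.trans (const 0)

theorem size_mul {f g : ι → ℕ} (hf : Bdd w N fun i => (f i).size)
    (hg : Bdd w N fun i => (g i).size) : Bdd w N fun i => (f i * g i).size := by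
  refine (hf.add hg).of_le fun i => Nat.size_le.2 ?_
  rw [pow_add]
  exact Nat.mul_lt_mul'' (Nat.lt_size_self _) (Nat.lt_size_self _)

theorem size_le {f g : ι → ℕ} (hg : Bdd w N fun i => (g i).size) (h : ∀ i, f i ≤ g i) :
    Bdd w N fun i => (f i).size :=
  hg.of_le fun i => Nat.size_le_size (h i)

theorem size_of {f : ι → ℕ} (hf : Bdd w N f) : Bdd w N fun i => (f i).size :=
  hf.of_le fun i => Nat.size_le.2 Nat.lt_two_pow_self

theorem size_const (c : ℕ) : Bdd w N fun _ => c.size := const _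

end Bdd

namespace Comp

variable {x y z a b : ι → Val}

theorem mono {M : ι → ℕ} (h : Comp w M x y) (hM : Bdd w N M) : Comp w N x y := by
  obtain ⟨c, k, hc⟩ := h
  have hb : Bdd w M fun i => (w i + 2) ^ k * (M i + 1) := ⟨k, fun i => le_rfl⟩
  obtain ⟨l, hl⟩ := hb.trans hM
  exact ⟨c, l, fun i => (hc i).imp fun t ht => ⟨ht.1, ht.2.trans (hl i)⟩⟩

theorem of_eq (h : Comp w N x y) (hy : ∀ i, y i = z i) : Comp w N x z := by
  have : y = z := funext hy
  rwa [← this]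

theorem of_zero (h : Comp w (fun _ => 0) x y) : Comp w N x y := h.mono (Bdd.const 0)

/-- The program stays the same when the family is reindexed or restricted. This serves for the
bodies of loops, indexed by pairs of an instance and a position, and for the branches of case
distinctions, indexed by subtypes. -/
theorem comap {ι' : Type v} (h : Comp w N x y) (g : ι' → ι) :
    Comp (fun i => w (g i)) (fun i => N (g i)) (fun i => x (g i)) fun i => y (g i) := by
  obtain ⟨c, k, hc⟩ := h
  exact ⟨c, k, fun i => hc (g i)⟩

theorem basic (c : Code) (h : ∀ i, c.Runs (x i) (y i) 1) : Comp w N x y :=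
  ⟨c, 0, fun i => ⟨1, h i, by simp⟩⟩

theorem id : Comp w N x x := basic .id fun i => .id _

theorem const (m : ℕ) : Comp w N x fun _ => .nat m := basic (.const m) fun i => .const m _

theorem trans (h : Comp w N x y) (h' : Comp w N y z) : Comp w N x z := by
  obtain ⟨c, k, hc⟩ := h
  obtain ⟨d, l, hd⟩ := h'
  refine ⟨.comp d c, k + l + 2, fun i => ?_⟩
  obtain ⟨s, h1, h2⟩ := hc i
  obtain ⟨t, h3, h4⟩ := hd i
  exact ⟨_, .comp h1 h3, bound_add h2 h4⟩

theorem pair (h : Comp w N x a) (h' : Comp w N x b) :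
    Comp w N x fun i => .pair (a i) (b i) := by
  obtain ⟨c, k, hc⟩ := h
  obtain ⟨d, l, hd⟩ := h'
  refine ⟨.pair c d, k + l + 2, fun i => ?_⟩
  obtain ⟨s, h1, h2⟩ := hc i
  obtain ⟨t, h3, h4⟩ := hd i
  exact ⟨_, .pair h1 h3, bound_add h2 h4⟩

theorem fst (h : Comp w N x fun i => .pair (a i) (b i)) : Comp w N x a :=
  h.trans (basic .fst fun i => .fst _ _)

theorem snd (h : Comp w N x fun i => .pair (a i) (b i)) : Comp w N x b :=
  h.trans (basic .snd fun i => .snd _ _)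

theorem natOp (o : NatOp) {f g : ι → ℕ} (hf : Comp w N x fun i => .nat (f i))
    (hg : Comp w N x fun i => .nat (g i)) (bf : Bdd w (fun _ => 0) fun i => (f i).size)
    (bg : Bdd w (fun _ => 0) fun i => (g i).size) :
    Comp w N x fun i => .nat (o.eval (f i) (g i)) := by
  refine (hf.pair hg).trans (of_zero ?_)
  obtain ⟨k, hk⟩ := ((Bdd.const 1).add bf).mul ((Bdd.const 1).add bg)
  exact ⟨.natOp o, k, fun i => ⟨_, .natOp o _ _, hk i⟩⟩

theorem realOp (o : RealOp) {f g : ι → ℝ} (hf : Comp w N x fun i => .real (f i))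
    (hg : Comp w N x fun i => .real (g i)) : Comp w N x fun i => .real (o.eval (f i) (g i)) :=
  (hf.pair hg).trans (basic (.realOp o) fun i => .realOp o _ _)

theorem realLe {f g : ι → ℝ} (hf : Comp w N x fun i => .real (f i))
    (hg : Comp w N x fun i => .real (g i)) :
    Comp w N x fun i => .nat (if f i ≤ g i then 1 else 0) := by
  refine (hf.pair hg).trans (basic .realLe fun i => ?_)
  split_ifs with h
  · exact .realLe_true _ _ h
  · exact .realLe_false _ _ (not_le.1 h)

/-- Constants of programs are natural numbers, so a real zero has to be converted. -/
theorem realZero : Comp w N x fun _ => .real 0 := by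
  refine (const 0).trans (of_zero ⟨.toReal, 0, fun i => ⟨1, ?_, by simp⟩⟩)
  simpa using Code.Runs.toReal 0

/-- Case distinction. -/
theorem cases {p : ι → Prop} {q : ι → ℕ} (hq : Comp w N x fun i => .nat (q i))
    (h0 : ∀ i, q i = 0 ↔ ¬ p i)
    (h1 : Comp (fun i : {i // p i} => w i) (fun i => N i) (fun i => x i) fun i => y i)
    (h2 : Comp (fun i : {i // ¬ p i} => w i) (fun i => N i) (fun i => x i) fun i => y i) :
    Comp w N x y := by
  obtain ⟨c, k, hc⟩ := hq
  obtain ⟨d, l, hd⟩ := h1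
  obtain ⟨e, m, he⟩ := h2
  refine ⟨.ite c d e, k + (l + m) + 2, fun i => ?_⟩
  obtain ⟨s, h3, h4⟩ := hc i
  by_cases hi : p i
  · obtain ⟨t, h5, h6⟩ := hd ⟨i, hi⟩
    obtain ⟨r, hr⟩ := Nat.exists_eq_succ_of_ne_zero (fun h => (h0 i).1 h hi)
    have h3 : c.Runs (x i) (.nat (q i)) s := h3
    rw [hr] at h3
    exact ⟨_, .ite_true h3 h5, bound_add h4 (h6.trans
      (Nat.mul_le_mul (pow_le_pow_two (by omega)) le_rfl))⟩
  · obtain ⟨t, h5, h6⟩ := he ⟨i, hi⟩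
    have h3 : c.Runs (x i) (.nat (q i)) s := h3
    rw [(h0 i).2 hi] at h3
    exact ⟨_, .ite_false h3 h5, bound_add h4 (h6.trans
      (Nat.mul_le_mul (pow_le_pow_two (by omega)) le_rfl))⟩

open Classical in
/-- `p i` can be decided from `x i`. -/
def Test (w N : ι → ℕ) (x : ι → Val) (p : ι → Prop) : Prop :=
  Comp w N x fun i => .nat (if p i then 1 else 0)

theorem Test.cond {p : ι → Prop} (hq : Test w N x p)
    (h1 : Comp (fun i : {i // p i} => w i) (fun i => N i) (fun i => x i) fun i => y i)
    (h2 : Comp (fun i : {i // ¬ p i} => w i) (fun i => N i) (fun i => x i) fun i => y i) :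
    Comp w N x y :=
  cases hq (fun i => by simp) h1 h2

theorem Test.ite {p : ι → Prop} [∀ i, Decidable (p i)] (hq : Test w N x p)
    (h1 : Comp w N x y) (h2 : Comp w N x z) :
    Comp w N x fun i => if p i then y i else z i := by
  refine hq.cond ?_ ?_
  · convert h1.comap (Subtype.val : {i // p i} → ι) using 2 with i
    exact if_pos i.2
  · convert h2.comap (Subtype.val : {i // ¬ p i} → ι) using 2 with i
    exact if_neg i.2

theorem Test.le {f g : ι → ℕ} (hf : Comp w N x fun i => .nat (f i))
    (hg : Comp w N x fun i => .nat (g i)) (bf : Bdd w (fun _ => 0) fun i => (f i).size)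
    (bg : Bdd w (fun _ => 0) fun i => (g i).size) : Test w N x fun i => f i ≤ g i := by
  unfold Test
  convert natOp .le hf hg bf bg using 3 with i
  simp only [NatOp.eval]
  congr

theorem Test.and {p q : ι → Prop} (hp : Test w N x p) (hq : Test w N x q) :
    Test w N x fun i => p i ∧ q i := by
  classical
  unfold Test at *
  convert natOp .mul hp hq ((Bdd.const 1).of_le fun i => ?_) ((Bdd.const 1).of_le fun i => ?_)
    using 3 with i
  · by_cases h1 : p i <;> by_cases h2 : q i <;> simp [h1, h2, NatOp.eval]
  · split_ifs <;> decide
  · split_ifs <;> decide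

theorem Test.not {p : ι → Prop} (hp : Test w N x p) : Test w N x fun i => ¬ p i := by
  classical
  unfold Test at *
  convert natOp .sub (const 1) hp ((Bdd.const 1).of_le fun i => ?_)
    ((Bdd.const 1).of_le fun i => ?_) using 3 with i
  · by_cases h1 : p i <;> simp [h1, NatOp.eval]
  · decide
  · split_ifs <;> decide

theorem Test.congr {p q : ι → Prop} (hp : Test w N x p) (h : ∀ i, p i ↔ q i) : Test w N x q := by
  have : p = q := funext fun i => propext (h i)
  rwa [← this]

theorem Test.eq {f g : ι → ℕ} (hf : Comp w N x fun i => .nat (f i))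
    (hg : Comp w N x fun i => .nat (g i)) (bf : Bdd w (fun _ => 0) fun i => (f i).size)
    (bg : Bdd w (fun _ => 0) fun i => (g i).size) : Test w N x fun i => f i = g i :=
  ((Test.le hf hg bf bg).and (Test.le hg hf bg bf)).congr fun i => le_antisymm_iff.symm

theorem Test.lt {f g : ι → ℕ} (hf : Comp w N x fun i => .nat (f i))
    (hg : Comp w N x fun i => .nat (g i)) (bf : Bdd w (fun _ => 0) fun i => (f i).size)
    (bg : Bdd w (fun _ => 0) fun i => (g i).size) : Test w N x fun i => f i < g i :=
  (Test.le hg hf bg bf).not.congr fun i => not_le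

theorem Test.realLe {f g : ι → ℝ} (hf : Comp w N x fun i => .real (f i))
    (hg : Comp w N x fun i => .real (g i)) : Test w N x fun i => f i ≤ g i := by
  unfold Test
  convert Comp.realLe hf hg using 3 with i

/-! ### Loops -/

theorem loop_runs {f : Code} {y : Val} : ∀ (m : ℕ) (s : ℕ → Val) (T : ℕ → ℕ),
    (∀ j < m, ∃ t k, f.Runs (s j) (.pair (.nat (k + 1)) (s (j + 1))) t ∧ t ≤ T j) →
    (∃ t, f.Runs (s m) (.pair (.nat 0) y) t ∧ t ≤ T m) →
    ∃ t, (Code.loop f).Runs (s 0) y t ∧ t ≤ ∑ j ∈ Finset.range (m + 1), (T j + 1) := by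
  intro m
  induction m with
  | zero =>
    rintro s T - ⟨t, h1, h2⟩
    exact ⟨_, .loop_done h1, by simpa using h2⟩
  | succ m ih =>
    intro s T h hd
    obtain ⟨t, h1, h2⟩ := ih (fun j => s (j + 1)) (fun j => T (j + 1))
      (fun j hj => h (j + 1) (by omega)) hd
    obtain ⟨t', k, h3, h4⟩ := h 0 (by omega)
    refine ⟨_, .loop_step h3 h1, ?_⟩
    rw [Finset.sum_range_succ']
    omega

/-- The budget `M i j` may depend on the iteration, and only the sum counts: this allows amortized
bounds. The exponent is the same for all iterations, so the polynomial factor comes out of the sum.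
-/
theorem loop (m : ι → ℕ) (s : ι → ℕ → Val) (M : ι → ℕ → ℕ)
    (hM : Bdd w N fun i => ∑ j ∈ Finset.range (m i + 1), (M i j + 1))
    (h : Comp (ι := Σ i, {j // j ≤ m i}) (fun p => w p.1) (fun p => M p.1 p.2.1)
      (fun p => s p.1 p.2.1) fun p =>
        if p.2.1 < m p.1 then .pair (.nat 1) (s p.1 (p.2.1 + 1)) else .pair (.nat 0) (y p.1)) :
    Comp w N (fun i => s i 0) y := by
  obtain ⟨c, k, hc⟩ := h
  -- The additional factor `w i + 2 ≥ 2` pays for the one step of overhead in each iteration.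
  have hb : Bdd w N fun i =>
      (w i + 2) ^ (k + 1) * ∑ j ∈ Finset.range (m i + 1), (M i j + 1) :=
    Bdd.mul ((Bdd.weight.add (Bdd.const 2)).pow _) hM
  obtain ⟨l, hl⟩ := hb
  refine ⟨.loop c, l, fun i => ?_⟩
  obtain ⟨t, h1, h2⟩ := loop_runs (f := c) (y := y i) (m i) (s i)
    (fun j => (w i + 2) ^ k * (M i j + 1)) (fun j hj => by
      obtain ⟨t, h1, h2⟩ := hc ⟨i, j, hj.le⟩
      simp only [if_pos hj] at h1
      exact ⟨t, 0, h1, h2⟩) (by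
      obtain ⟨t, h1, h2⟩ := hc ⟨i, m i, le_rfl⟩
      simp only [lt_irrefl, if_false] at h1
      exact ⟨t, h1, h2⟩)
  refine ⟨t, h1, h2.trans (le_trans ?_ (hl i))⟩
  simp only [Finset.mul_sum]
  refine Finset.sum_le_sum fun j _ => ?_
  have h3 : 1 ≤ (w i + 2) ^ k := Nat.one_le_pow _ _ (by omega)
  have h4 : 1 ≤ (w i + 2) ^ k * (M i j + 1) := Nat.mul_pos h3 (by omega)
  rw [pow_succ]
  calc _ ≤ (w i + 2) ^ k * (M i j + 1) * 2 := by omega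
    _ ≤ (w i + 2) ^ k * (M i j + 1) * (w i + 2) := Nat.mul_le_mul le_rfl (by omega)
    _ = _ := by ring

/-! ### Lists -/

theorem isPair_cons {κ : Type v} {e : κ → Val} (c : κ) (l : List κ) :
    Code.Runs .isPair (encList e (c :: l)) (.nat 1) 1 := .isPair_pair _ _

theorem isPair_nil {κ : Type v} {e : κ → Val} :
    Code.Runs .isPair (encList e ([] : List κ)) (.nat 0) 1 := .isPair_nat _

variable {κ : ι → Type v} {e : ∀ i, κ i → Val} {L : ∀ i, List (κ i)}

theorem Test.ne_nil (hl : Comp w N x fun i => encList (e i) (L i)) :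
    Test w N x fun i => L i ≠ [] := by
  classical
  refine hl.trans (basic .isPair fun i => ?_)
  beta_reduce
  generalize L i = l
  cases l with
  | nil => simpa using isPair_nil (e := e i)
  | cons c l => simpa using isPair_cons (e := e i) c l

theorem head {c : ∀ i, κ i} {T : ∀ i, List (κ i)} (h : ∀ i, L i = c i :: T i)
    (hl : Comp w N x fun i => encList (e i) (L i)) : Comp w N x fun i => e i (c i) :=
  hl.trans (basic .fst fun i => by rw [h]; exact .fst _ _)

theorem tail {c : ∀ i, κ i} {T : ∀ i, List (κ i)} (h : ∀ i, L i = c i :: T i)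
    (hl : Comp w N x fun i => encList (e i) (L i)) : Comp w N x fun i => encList (e i) (T i) :=
  hl.trans (basic .snd fun i => by rw [h]; exact .snd _ _)

theorem nil : Comp w N x fun i => encList (e i) ([] : List (κ i)) := const 0

theorem cons {c : ∀ i, κ i} (hc : Comp w N x fun i => e i (c i))
    (hl : Comp w N x fun i => encList (e i) (L i)) :
    Comp w N x fun i => encList (e i) (c i :: L i) := hc.pair hl

/-- Folding over a list: `S i j` is the state after `j` elements. -/
theorem fold (S : ι → ℕ → Val) (M : ι → ℕ → ℕ) (hs : Comp w N x fun i => S i 0)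
    (hl : Comp w N x fun i => encList (e i) (L i))
    (hM : Bdd w N fun i => ∑ j ∈ Finset.range (L i).length, (M i j + 1))
    (h : Comp (ι := Σ i, {j // j < (L i).length}) (fun p => w p.1) (fun p => M p.1 p.2.1)
      (fun p => .pair (x p.1) (.pair (S p.1 p.2.1) (e p.1 ((L p.1)[p.2.1]'p.2.2))))
      fun p => S p.1 (p.2.1 + 1)) :
    Comp w N x fun i => S i (L i).length := by
  have key : Comp w N (fun i => .pair (x i) (.pair (S i 0) (encList (e i) (L i))))
      fun i => S i (L i).length := by
    have h0 := loop (w := w) (N := N) (fun i => (L i).length) (y := fun i => S i (L i).length)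
      (fun i j => .pair (x i) (.pair (S i j) (encList (e i) ((L i).drop j))))
      -- The last pass, which finds the rest of the list empty, has no element and gets the budget
      -- `0`.
      (fun i j => if j < (L i).length then M i j else 0) ?_ ?_
    · simpa using h0
    · refine (hM.add (Bdd.const 1)).of_le fun i => ?_
      rw [Finset.sum_range_succ, if_neg (lt_irrefl _)]
      refine Nat.add_le_add_right (Finset.sum_le_sum fun j hj => ?_) _
      rw [if_pos (Finset.mem_range.1 hj)]
    · let I := Σ i, {j // j ≤ (L i).length}
      have hlist : Comp (ι := I) (fun p => w p.1)
          (fun p => if p.2.1 < (L p.1).length then M p.1 p.2.1 else 0)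
          (fun p => .pair (x p.1) (.pair (S p.1 p.2.1) (encList (e p.1) ((L p.1).drop p.2.1))))
          fun p => encList (e p.1) ((L p.1).drop p.2.1) := (id.snd).snd
      refine ((Test.ne_nil hlist).congr (q := fun p => p.2.1 < (L p.1).length) fun p => ?_).cond
        ?_ ?_
      · rw [ne_eq, List.drop_eq_nil_iff, not_le]
      · let I' := {p : I // p.2.1 < (L p.1).length}
        have hcons : ∀ p : I', (L p.1.1).drop p.1.2.1 =
            (L p.1.1)[p.1.2.1]'p.2 :: (L p.1.1).drop (p.1.2.1 + 1) :=
          fun p => List.drop_eq_getElem_cons p.2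
        have h1 := h.comap (fun p : I' => (⟨p.1.1, p.1.2.1, p.2⟩ : Σ i, {j // j < (L i).length}))
        have hid : Comp (ι := I') (fun p => w p.1.1) (fun p => M p.1.1 p.1.2.1)
            (fun p => .pair (x p.1.1) (.pair (S p.1.1 p.1.2.1)
              (encList (e p.1.1) ((L p.1.1).drop p.1.2.1)))) _ := id
        have h2 := (hid.fst.pair (hid.snd.fst.pair (head hcons hid.snd.snd))).trans h1
        have h3 := (const 1).pair (hid.fst.pair (h2.pair (tail hcons hid.snd.snd)))
        convert h3 using 2 with p p
        · rw [if_pos p.2]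
        · rw [if_pos p.2]
      · have h3 : Comp (ι := {p : I // ¬ p.2.1 < (L p.1).length}) (fun p => w p.1.1)
            (fun p => if p.1.2.1 < (L p.1.1).length then M p.1.1 p.1.2.1 else 0)
            (fun p => .pair (x p.1.1) (.pair (S p.1.1 p.1.2.1)
              (encList (e p.1.1) ((L p.1.1).drop p.1.2.1))))
            fun p => .pair (.nat 0) (S p.1.1 p.1.2.1) := (const 0).pair id.snd.fst
        convert h3 using 2 with p
        have : p.1.2.1 = (L p.1.1).length := le_antisymm p.1.2.2 (not_lt.1 p.2)
        rw [if_neg p.2, this]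
  exact (id.pair (hs.pair hl)).trans key

/-- Lists are accessible only at the front, so a loop that collects its results reverses them.
Appending, and likewise `flatMap` below, costs a second reversal. -/
theorem revAppend {A : ∀ i, List (κ i)} (hl : Comp w N x fun i => encList (e i) (L i))
    (ha : Comp w N x fun i => encList (e i) (A i)) (hb : Bdd w N fun i => (L i).length) :
    Comp w N x fun i => encList (e i) ((L i).reverse ++ A i) := by
  have h := fold (S := fun i j => encList (e i) (((L i).take j).reverse ++ A i))
    (M := fun _ _ => 0) (by simpa using ha) hl (by simpa using hb) ?_
  · simpa using h
  · have hid : Comp (ι := Σ i, {j // j < (L i).length}) (fun p => w p.1) (fun _ => 0)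
        (fun p => .pair (x p.1) (.pair (encList (e p.1) (((L p.1).take p.2.1).reverse ++ A p.1))
          (e p.1 ((L p.1)[p.2.1]'p.2.2)))) _ := id
    have h3 := hid.snd.snd.pair hid.snd.fst
    have h4 : ∀ i (j : ℕ) (hj : j < (L i).length),
        (L i)[j] :: (((L i).take j).reverse ++ A i) = ((L i).take (j + 1)).reverse ++ A i := by
      intro i j hj
      rw [← List.take_append_getElem hj, List.reverse_append]
      rfl
    exact h3.of_eq fun p => congrArg (encList (e p.1)) (h4 p.1 p.2.1 p.2.2)

theorem reverse (hl : Comp w N x fun i => encList (e i) (L i))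
    (hb : Bdd w N fun i => (L i).length) : Comp w N x fun i => encList (e i) (L i).reverse := by
  simpa using revAppend hl nil hb

theorem append {A : ∀ i, List (κ i)} (hl : Comp w N x fun i => encList (e i) (L i))
    (ha : Comp w N x fun i => encList (e i) (A i)) (hb : Bdd w N fun i => (L i).length) :
    Comp w N x fun i => encList (e i) (L i ++ A i) := by
  simpa using revAppend (reverse hl hb) ha (by simpa using hb)

theorem flatMap {κ' : ι → Type v} {e' : ∀ i, κ' i → Val} (f : ∀ i, κ i → List (κ' i))
    (M : ∀ i, κ i → ℕ) (hl : Comp w N x fun i => encList (e i) (L i))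
    (hM : Bdd w N fun i => ((L i).map fun c => M i c + 1).sum)
    (hf : Bdd (ι := Σ i, {c // c ∈ L i}) (fun p => w p.1) (fun p => M p.1 p.2.1)
      fun p => (f p.1 p.2.1).length)
    (h : Comp (ι := Σ i, {c // c ∈ L i}) (fun p => w p.1) (fun p => M p.1 p.2.1)
      (fun p => .pair (x p.1) (e p.1 p.2.1)) fun p => encList (e' p.1) (f p.1 p.2.1)) :
    Comp w N x fun i => encList (e' i) ((L i).flatMap (f i)) := by
  have hlen : Bdd w N fun i => ((L i).flatMap (f i)).length := by
    obtain ⟨k, hk⟩ := hf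
    have h1 : Bdd w N fun i => (w i + 2) ^ k * ((L i).map fun c => M i c + 1).sum :=
      Bdd.mul ((Bdd.weight.add (Bdd.const 2)).pow _) hM
    refine h1.of_le fun i => ?_
    rw [List.length_flatMap, ← List.sum_map_mul_left]
    exact List.sum_le_sum fun c hc => hk ⟨i, c, hc⟩
  have h0 := fold (S := fun i j => encList (e' i) (((L i).take j).flatMap (f i)).reverse)
    (M := fun i j => if h : j < (L i).length then M i (L i)[j] else 0) (by simpa using nil) hl
    (hM.of_le fun i => le_of_eq ?_) ?_
  · have h1 : Comp w N x fun i => encList (e' i) ((L i).flatMap (f i)).reverse := by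
      simpa using h0
    have h2 := reverse h1 (by simpa using hlen)
    simpa using h2
  · rw [Finset.sum_range, ← Fin.sum_univ_fun_getElem]
    exact Finset.sum_congr rfl fun j _ => by simp
  · let I := Σ i, {j // j < (L i).length}
    have hid : Comp (ι := I) (fun p => w p.1)
        (fun p => if h : p.2.1 < (L p.1).length then M p.1 (L p.1)[p.2.1] else 0)
        (fun p => .pair (x p.1) (.pair (encList (e' p.1) (((L p.1).take p.2.1).flatMap (f p.1)).reverse)
          (e p.1 ((L p.1)[p.2.1]'p.2.2)))) _ := id
    have hMp : ∀ p : I, (if h : p.2.1 < (L p.1).length then M p.1 (L p.1)[p.2.1] else 0) =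
        M p.1 ((L p.1)[p.2.1]'p.2.2) := fun p => dif_pos p.2.2
    simp only [hMp] at hid ⊢
    let g : I → Σ i, {c // c ∈ L i} := fun p => ⟨p.1, (L p.1)[p.2.1]'p.2.2, List.getElem_mem _⟩
    have h1 := (hid.fst.pair hid.snd.snd).trans (h.comap g)
    have h2 := revAppend (κ := fun p : I => κ' p.1) (e := fun p => e' p.1)
      (L := fun p => f (g p).1 (g p).2.1) h1 hid.snd.fst (hf.comap g)
    have h4 : ∀ i (j : ℕ) (hj : j < (L i).length),
        (f i (L i)[j]).reverse ++ (((L i).take j).flatMap (f i)).reverse =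
          (((L i).take (j + 1)).flatMap (f i)).reverse := by
      intro i j hj
      rw [← List.take_append_getElem hj, List.flatMap_append, List.reverse_append,
        List.flatMap_singleton]
    exact h2.of_eq fun p => congrArg (encList (e' p.1)) (h4 p.1 p.2.1 p.2.2)

/-- Filtering or mapping, with constantly many results for every element. -/
theorem flatMap_const {κ' : ι → Type v} {e' : ∀ i, κ' i → Val} (f : ∀ i, κ i → List (κ' i))
    (hl : Comp w N x fun i => encList (e i) (L i)) (hb : Bdd w N fun i => (L i).length)
    {m : ℕ} (hf : ∀ i c, (f i c).length ≤ m)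
    (h : Comp (ι := Σ i, {c // c ∈ L i}) (fun p => w p.1) (fun _ => 0)
      (fun p => .pair (x p.1) (e p.1 p.2.1)) fun p => encList (e' p.1) (f p.1 p.2.1)) :
    Comp w N x fun i => encList (e' i) ((L i).flatMap (f i)) :=
  flatMap f (fun _ _ => 0) hl (by simpa using hb) ((Bdd.const m).of_le fun p => hf _ _) h

theorem map {κ' : ι → Type v} {e' : ∀ i, κ' i → Val} (f : ∀ i, κ i → κ' i)
    (hl : Comp w N x fun i => encList (e i) (L i)) (hb : Bdd w N fun i => (L i).length)
    (h : Comp (ι := Σ i, {c // c ∈ L i}) (fun p => w p.1) (fun _ => 0)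
      (fun p => .pair (x p.1) (e p.1 p.2.1)) fun p => e' p.1 (f p.1 p.2.1)) :
    Comp w N x fun i => encList (e' i) ((L i).map (f i)) := by
  have := flatMap_const (e' := e') (fun i c => [f i c]) hl hb (m := 1) (by simp)
    (h.pair (const 0))
  simpa [← List.map_eq_flatMap] using this

theorem filter (q : ∀ i, κ i → Bool) (hl : Comp w N x fun i => encList (e i) (L i))
    (hb : Bdd w N fun i => (L i).length)
    (h : Test (ι := Σ i, {c // c ∈ L i}) (fun p => w p.1) (fun _ => 0)
      (fun p => .pair (x p.1) (e p.1 p.2.1)) fun p => q p.1 p.2.1 = true) :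
    Comp w N x fun i => encList (e i) ((L i).filter (q i)) := by
  have := flatMap_const (e' := e) (fun i c => if q i c then [c] else []) hl hb (m := 1)
    (fun i c => by split_ifs <;> simp) (by
      let I := Σ i, {c // c ∈ L i}
      have hid : Comp (ι := I) (fun p => w p.1) (fun _ => 0)
        (fun p => .pair (x p.1) (e p.1 p.2.1)) _ := id
      refine (h.ite (hid.snd.pair (const 0)) (const 0)).of_eq fun p => ?_
      split_ifs <;> rfl)
  convert this using 3 with i
  induction L i with
  | nil => rfl
  | cons c l ih =>
    rw [List.flatMap_cons, ← ih, List.filter_cons]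
    split_ifs <;> simp

end Comp

end Computations

end DynDist

namespace DynDist

/-! ## Grouping by keys -/

section Grouping

universe u

variable {κ : Type u}

/-- The elements with keys of parity `r`, with their keys halved. -/
def halve (r : ℕ) (g : List (ℕ × κ)) : List (ℕ × κ) :=
  (g.filter fun p => p.1 % 2 = r).map fun p => (p.1 / 2, p.2)

/-- The nonempty halves of a group. -/
def splitGroup (g : List (ℕ × κ)) : List (List (ℕ × κ)) :=
  [halve 0 g, halve 1 g].filter fun h => !h.isEmpty

/-- The groups of the elements with equal keys, for keys less than `2 ^ B`. -/
def groups : ℕ → List (ℕ × κ) → List (List (ℕ × κ))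
  | 0, g => [g]
  | B + 1, g => (splitGroup g).flatMap (groups B)

/-- The elements with a given key. -/
def withKey (k : ℕ) (g : List (ℕ × κ)) : List κ := (g.filter fun p => p.1 = k).map Prod.snd

theorem withKey_halve {r : ℕ} (hr : r < 2) (k : ℕ) (g : List (ℕ × κ)) :
    withKey k (halve r g) = withKey (2 * k + r) g := by
  unfold withKey halve
  rw [List.filter_map, List.map_map, List.filter_filter]
  have : ((fun p : ℕ × κ => decide (p.1 = k)) ∘ fun p : ℕ × κ => (p.1 / 2, p.2)) =
      fun p => decide (p.1 / 2 = k) := rfl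
  rw [this]
  have h2 : (List.filter (fun a : ℕ × κ => decide (a.1 / 2 = k) && decide (a.1 % 2 = r)) g) =
      g.filter fun p => p.1 = 2 * k + r := by
    refine List.filter_congr fun p _ => ?_
    rw [Bool.eq_iff_iff]
    simp only [Bool.and_eq_true, decide_eq_true_eq]
    omega
  rw [h2]
  rfl

theorem mem_halve {r : ℕ} {g : List (ℕ × κ)} {p : ℕ × κ} :
    p ∈ halve r g ↔ ∃ p' ∈ g, p'.1 % 2 = r ∧ p'.1 / 2 = p.1 ∧ p'.2 = p.2 := by
  unfold halve
  simp only [List.mem_map, List.mem_filter, decide_eq_true_eq]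
  constructor
  · rintro ⟨p', ⟨h1, h2⟩, rfl⟩
    exact ⟨p', h1, h2, rfl, rfl⟩
  · rintro ⟨p', h1, h2, h3, h4⟩
    exact ⟨p', ⟨h1, h2⟩, Prod.ext h3 h4⟩

/-- Radix sorting from the lowest bit: key `k` in the half of parity `r` stands for the key `2 * k +
r`, and both halves have keys with one bit less. Filtering keeps the order within each group, which
matters when the elements are events in time. -/
theorem groups_spec (B : ℕ) : ∀ g : List (ℕ × κ), g ≠ [] → (∀ p ∈ g, p.1 < 2 ^ B) →
    ∃ ks : List ℕ, ks.Nodup ∧ (∀ k, k ∈ ks ↔ ∃ p ∈ g, p.1 = k) ∧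
      (groups B g).map (List.map Prod.snd) = ks.map fun k => withKey k g := by
  induction B with
  | zero =>
    intro g hg h
    have h0 : ∀ p ∈ g, p.1 = 0 := fun p hp => by have := h p hp; omega
    refine ⟨[0], by simp, fun k => ?_, ?_⟩
    · rw [List.mem_singleton]
      constructor
      · rintro rfl
        obtain ⟨p, hp⟩ := List.exists_mem_of_ne_nil g hg
        exact ⟨p, hp, h0 p hp⟩
      · rintro ⟨p, hp, rfl⟩
        exact h0 p hp
    · simp only [groups, List.map_cons, List.map_nil, withKey]
      rw [List.filter_eq_self.2 fun p hp => by simpa using h0 p hp]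
  | succ B ih =>
    intro g hg h
    have hpart : ∀ r < 2, ∃ ks : List ℕ, ks.Nodup ∧
        (∀ k, k ∈ ks ↔ k % 2 = r ∧ ∃ p ∈ g, p.1 = k) ∧
        (([halve r g].filter fun h => !h.isEmpty).flatMap (groups B)).map (List.map Prod.snd) =
          ks.map fun k => withKey k g := by
      intro r hr
      by_cases he : halve r g = []
      · refine ⟨[], by simp, fun k => ?_, by simp [he]⟩
        simp only [List.not_mem_nil, false_iff, not_and, not_exists]
        rintro rfl p hp rfl
        have : (p.1 / 2, p.2) ∈ halve (p.1 % 2) g := mem_halve.2 ⟨p, hp, rfl, rfl, rfl⟩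
        rw [he] at this
        exact List.not_mem_nil this
      · obtain ⟨ks, h1, h2, h3⟩ := ih (halve r g) he (by
          intro p hp
          obtain ⟨p', h1, h2, h3, h4⟩ := mem_halve.1 hp
          have := h p' h1
          rw [pow_succ] at this
          omega)
        refine ⟨ks.map fun k => 2 * k + r, ?_, fun k => ?_, ?_⟩
        · refine h1.map fun a b hab => ?_
          have : 2 * a + r = 2 * b + r := hab
          omega
        · rw [List.mem_map]
          constructor
          · rintro ⟨k', hk', rfl⟩
            obtain ⟨p, hp, rfl⟩ := (h2 k').1 hk'
            obtain ⟨p', h4, h5, h6, h7⟩ := mem_halve.1 hp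
            exact ⟨by omega, p', h4, by omega⟩
          · rintro ⟨hk, p, hp, rfl⟩
            exact ⟨p.1 / 2, (h2 _).2 ⟨(p.1 / 2, p.2), mem_halve.2 ⟨p, hp, hk, rfl, rfl⟩, rfl⟩,
              by omega⟩
        · have : ([halve r g].filter fun h => !h.isEmpty) = [halve r g] := by
            rw [List.filter_cons, if_pos (by simpa using he), List.filter_nil]
          rw [this, List.flatMap_singleton, h3, List.map_map]
          exact List.map_congr_left fun k _ => withKey_halve hr k g
    obtain ⟨k0, a1, a2, a3⟩ := hpart 0 (by omega)
    obtain ⟨k1, b1, b2, b3⟩ := hpart 1 (by omega)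
    refine ⟨k0 ++ k1, ?_, fun k => ?_, ?_⟩
    · rw [List.nodup_append]
      refine ⟨a1, b1, ?_⟩
      rintro a ha b hb rfl
      have h1 := ((a2 a).1 ha).1
      have h2 := ((b2 a).1 hb).1
      omega
    · rw [List.mem_append, a2, b2]
      have : k % 2 = 0 ∨ k % 2 = 1 := by omega
      exact ⟨by rintro (⟨_, h⟩ | ⟨_, h⟩) <;> exact h,
        fun h => this.imp (fun a => ⟨a, h⟩) fun a => ⟨a, h⟩⟩
    · rw [List.map_append, ← a3, ← b3, ← List.map_append, ← List.flatMap_append,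
        ← List.filter_append]
      rfl

/-- The groups of a list, without its keys. -/
def grouped (B : ℕ) (g : List (ℕ × κ)) : List (List κ) :=
  (if g.isEmpty then [] else groups B g).map (List.map Prod.snd)

/-- The empty list is a separate case, because `groups 0 []` consists of one empty group instead of
no group. -/
theorem grouped_spec {B : ℕ} {g : List (ℕ × κ)} (h : ∀ p ∈ g, p.1 < 2 ^ B) :
    ∃ ks : List ℕ, ks.Nodup ∧ (∀ k, k ∈ ks ↔ ∃ p ∈ g, p.1 = k) ∧
      grouped B g = ks.map fun k => withKey k g := by
  unfold grouped
  by_cases hg : g = []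
  · exact ⟨[], by simp, by simp [hg], by simp [hg]⟩
  · rw [if_neg (by simpa using hg)]
    exact groups_spec B g hg h

end Grouping

/-! ## Keys of edges; removing loops and parallel edges -/

variable {n : ℕ}

/-- A number that identifies the pair of endpoints. -/
def pairKey (u v : Fin n) : ℕ := (if (u : ℕ) ≤ v then (u : ℕ) else v) * n + if (u : ℕ) ≤ v then (v : ℕ) else u

/-- The key has the smaller and the larger endpoint as its two digits in base `n`. -/
theorem pairKey_eq {u v u' v' : Fin n} : pairKey u v = pairKey u' v' ↔ s(u, v) = s(u', v') := by
  unfold pairKey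
  rw [Sym2.eq_iff]
  constructor
  · intro h
    have hdiv : ∀ a b : ℕ, b < n → (a * n + b) / n = a ∧ (a * n + b) % n = b := by
      intro a b hb
      rw [mul_comm, Nat.mul_add_div (by omega), Nat.mul_add_mod, Nat.div_eq_of_lt hb,
        Nat.mod_eq_of_lt hb]
      simp
    have hu := u.2
    have hv := v.2
    have hu' := u'.2
    have hv' := v'.2
    simp only [Fin.ext_iff]
    split_ifs at h <;>
    · have h1 := congrArg (· / n) h
      have h2 := congrArg (· % n) h
      simp only [(hdiv _ _ hu).1, (hdiv _ _ hv).1, (hdiv _ _ hu').1, (hdiv _ _ hv').1,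
        (hdiv _ _ hu).2, (hdiv _ _ hv).2, (hdiv _ _ hu').2, (hdiv _ _ hv').2] at h1 h2
      omega
  · rintro (⟨rfl, rfl⟩ | ⟨rfl, rfl⟩)
    · rfl
    · split_ifs with h1 h2 h2
      · have : (u : ℕ) = v := le_antisymm h1 h2
        rw [this]
      · rfl
      · rfl
      · omega

theorem pairKey_lt (u v : Fin n) : pairKey u v < n * n := by
  unfold pairKey
  have hu := u.2
  have hv := v.2
  have : ∀ a b : ℕ, a < n → b < n → a * n + b < n * n := by
    intro a b ha hb
    calc a * n + b < a * n + n := by omega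
      _ = (a + 1) * n := by ring
      _ ≤ n * n := Nat.mul_le_mul ha le_rfl
  split_ifs <;> exact this _ _ (by omega) (by omega)

theorem lt_two_pow_lg (n : ℕ) : n < 2 ^ lg n := Nat.lt_pow_succ_log_self (by omega) n

theorem pairKey_lt_pow (u v : Fin n) : pairKey u v < 2 ^ (lg n + lg n) := by
  rw [pow_add]
  exact (pairKey_lt u v).trans_le (Nat.mul_le_mul (lt_two_pow_lg n).le (lt_two_pow_lg n).le)

/-- The number of bits of the keys. -/
def keyBits (n : ℕ) : ℕ := lg n + lg n

abbrev Edge (n : ℕ) := Fin n × Fin n × ℝ≥0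

open Classical in
/-- A lightest edge of a list, as a list with at most one element. -/
noncomputable def lightest (g : List (Edge n)) : List (Edge n) :=
  g.foldl (fun a e => a.head?.elim [e] fun b => if b.2.2 ≤ e.2.2 then a else [e]) []

theorem lightest_spec (g : List (Edge n)) (hg : g ≠ []) :
    ∃ e ∈ g, lightest g = [e] ∧ ∀ e' ∈ g, e.2.2 ≤ e'.2.2 := by
  induction g using List.reverseRecOn with
  | nil => exact absurd rfl hg
  | append_singleton g c ih =>
    unfold lightest at *
    rw [List.foldl_append]
    by_cases h : g = []
    · subst h
      exact ⟨c, by simp, by simp, by simp⟩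
    · obtain ⟨e, h1, h2, h3⟩ := ih h
      rw [h2]
      simp only [List.foldl_cons, List.foldl_nil, List.head?_cons, Option.elim_some]
      split_ifs with hle
      · refine ⟨e, by simp [h1], rfl, fun e' he' => ?_⟩
        rcases List.mem_append.1 he' with he' | he'
        · exact h3 e' he'
        · rw [List.mem_singleton.1 he']; exact hle
      · refine ⟨c, by simp, rfl, fun e' he' => ?_⟩
        rcases List.mem_append.1 he' with he' | he'
        · exact (not_le.1 hle).le.trans (h3 e' he')
        · rw [List.mem_singleton.1 he']

/-- The edges that are not loops, with their keys. -/
def keyed (X : List (Edge n)) : List (ℕ × Edge n) :=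
  (X.filter fun e => e.1 ≠ e.2.1).map fun e => (pairKey e.1 e.2.1, e)

/-- The graph without loops and parallel edges. -/
noncomputable def simplify (X : WGraph n) : WGraph n :=
  (grouped (keyBits n) (keyed X)).flatMap lightest

theorem mem_keyed {X : List (Edge n)} {p : ℕ × Edge n} :
    p ∈ keyed X ↔ p.2 ∈ X ∧ p.2.1 ≠ p.2.2.1 ∧ p.1 = pairKey p.2.1 p.2.2.1 := by
  unfold keyed
  simp only [List.mem_map, List.mem_filter, decide_eq_true_eq]
  constructor
  · rintro ⟨e, ⟨h1, h2⟩, rfl⟩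
    exact ⟨h1, h2, rfl⟩
  · rintro ⟨h1, h2, h3⟩
    exact ⟨p.2, ⟨h1, h2⟩, Prod.ext h3.symm rfl⟩

theorem mem_withKey {κ : Type*} {k : ℕ} {g : List (ℕ × κ)} {x : κ} :
    x ∈ withKey k g ↔ (k, x) ∈ g := by
  unfold withKey
  simp only [List.mem_map, List.mem_filter, decide_eq_true_eq]
  constructor
  · rintro ⟨p, ⟨h1, rfl⟩, rfl⟩
    exact h1
  · intro h
    exact ⟨_, ⟨h, rfl⟩, rfl⟩

/-- The minor algorithm accepts simple graphs only, whereas the union of a sparsifier with new edges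
may have loops and parallel edges. Each group of equal keys contributes one lightest edge. -/
theorem simplify_spec (X : WGraph n) : (simplify X).Simple ∧ Reduces X (simplify X) := by
  obtain ⟨ks, h1, h2, h3⟩ := grouped_spec (B := keyBits n) (g := keyed X) (by
    intro p hp
    rw [(mem_keyed.1 hp).2.2]
    exact pairKey_lt_pow _ _)
  have hch : ∀ k ∈ ks, ∃ e ∈ withKey k (keyed X), lightest (withKey k (keyed X)) = [e] ∧
      ∀ e' ∈ withKey k (keyed X), e.2.2 ≤ e'.2.2 := by
    intro k hk
    refine lightest_spec _ ?_
    obtain ⟨p, hp, rfl⟩ := (h2 k).1 hk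
    exact List.ne_nil_of_mem (mem_withKey.2 hp)
  have hmem : ∀ e, e ∈ simplify X ↔ ∃ k ∈ ks, e ∈ lightest (withKey k (keyed X)) := by
    intro e
    unfold simplify
    rw [h3, List.flatMap_map, List.mem_flatMap]
  have hmem2 : ∀ e k, k ∈ ks → e ∈ lightest (withKey k (keyed X)) →
      (k, e) ∈ keyed X := by
    intro e k hk he
    obtain ⟨e', h4, h5, _⟩ := hch k hk
    rw [h5, List.mem_singleton] at he
    rw [he]
    exact mem_withKey.1 h4
  refine ⟨⟨fun e he => ?_, ?_⟩, fun e he => ?_, fun e he hl => ?_⟩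
  · obtain ⟨k, hk, h⟩ := (hmem e).1 he
    exact (mem_keyed.1 (hmem2 e k hk h)).2.1
  · unfold simplify
    rw [h3, List.flatMap_map, List.map_flatMap, List.nodup_flatMap]
    refine ⟨fun k hk => ?_, h1.imp_of_mem fun {k k'} hk hk' hne => ?_⟩
    · obtain ⟨e, _, h5, _⟩ := hch k hk
      rw [h5]; simp
    · intro p hp hp'
      obtain ⟨e, he, rfl⟩ := List.mem_map.1 hp
      obtain ⟨e', he', h6⟩ := List.mem_map.1 hp'
      have h7 := (mem_keyed.1 (hmem2 e k hk he)).2.2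
      have h8 := (mem_keyed.1 (hmem2 e' k' hk' he')).2.2
      exact hne (h7.trans ((pairKey_eq.2 h6.symm).trans h8.symm))
  · obtain ⟨k, hk, h⟩ := (hmem e).1 he
    exact (mem_keyed.1 (hmem2 e k hk h)).1
  · have hk : (pairKey e.1 e.2.1, e) ∈ keyed X := mem_keyed.2 ⟨he, hl, rfl⟩
    have hk' : pairKey e.1 e.2.1 ∈ ks := (h2 _).2 ⟨_, hk, rfl⟩
    obtain ⟨e', h4, h5, h6⟩ := hch _ hk'
    refine ⟨e', (hmem e').2 ⟨_, hk', by rw [h5]; simp⟩, ?_, h6 e (mem_withKey.2 hk)⟩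
    have := (mem_keyed.1 (mem_withKey.1 h4)).2.2
    exact (pairKey_eq.1 this).symm

/-! ## Removing repetitions from a list of vertices -/

/-- The vertices of a list, without repetitions. -/
def distinct (l : List (Fin n)) : List (Fin n) :=
  (grouped (lg n) (l.map fun v : Fin n => ((v : ℕ), v))).flatMap (List.take 1)

theorem distinct_spec (l : List (Fin n)) :
    (distinct l).Nodup ∧ ∀ v, v ∈ distinct l ↔ v ∈ l := by
  set g : List (ℕ × Fin n) := l.map fun v : Fin n => ((v : ℕ), v) with hg
  have hmemg : ∀ p, p ∈ g ↔ p.2 ∈ l ∧ p.1 = p.2 := by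
    intro p
    rw [hg, List.mem_map]
    constructor
    · rintro ⟨v, hv, rfl⟩
      exact ⟨hv, rfl⟩
    · rintro ⟨h1, h2⟩
      exact ⟨p.2, h1, Prod.ext h2.symm rfl⟩
  obtain ⟨ks, h1, h2, h3⟩ := grouped_spec (B := lg n) (g := g) (by
    intro p hp
    rw [((hmemg p).1 hp).2]
    exact p.2.2.trans (lt_two_pow_lg n))
  have hmem2 : ∀ v k, v ∈ (withKey k g).take 1 → v ∈ l ∧ k = v := by
    intro v k hv
    exact (hmemg _).1 (mem_withKey.1 (List.mem_of_mem_take hv))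
  unfold distinct
  rw [h3, List.flatMap_map]
  refine ⟨?_, fun v => ?_⟩
  · rw [List.nodup_flatMap]
    refine ⟨fun k _ => ?_, h1.imp_of_mem fun {k k'} _ _ hne => ?_⟩
    · rcases withKey k g with _ | ⟨a, t⟩ <;> simp
    · intro v hv hv'
      exact hne ((hmem2 v k hv).2.trans (hmem2 v k' hv').2.symm)
  · rw [List.mem_flatMap]
    constructor
    · rintro ⟨k, _, hv⟩
      exact (hmem2 v k hv).1
    · intro hv
      have hvg : ((v : ℕ), v) ∈ g := (hmemg _).2 ⟨hv, rfl⟩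
      refine ⟨v, (h2 _).2 ⟨_, hvg, rfl⟩, ?_⟩
      have hv' := mem_withKey.2 hvg
      cases hw : withKey (v : ℕ) g with
      | nil => rw [hw] at hv'; exact absurd hv' List.not_mem_nil
      | cons a t =>
        have : (v : ℕ) = a := (hmem2 a v (by rw [hw]; simp)).2
        rw [List.take_succ_cons, List.take_zero, List.mem_singleton]
        exact Fin.ext this

end DynDist

namespace DynDist

variable {n : ℕ}

/-! ## Running a sequence of operations -/

/-- The graph after a sequence of operations. -/
def run (G : WGraph n) (ops : List (Op n)) : WGraph n := ops.foldl WGraph.step G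

theorem run_append (G : WGraph n) (X Y : List (Op n)) : run G (X ++ Y) = run (run G X) Y :=
  List.foldl_append

/-- Insertions insert only absent edges. -/
def Fresh : WGraph n → List (Op n) → Prop
  | _, [] => True
  | G, x :: ops => (∀ u v w, x = .insert u v w → s(u, v) ∉ G.map ends) ∧ Fresh (G.step x) ops

theorem fresh_append {G : WGraph n} {X Y : List (Op n)} :
    Fresh G (X ++ Y) ↔ Fresh G X ∧ Fresh (run G X) Y := by
  induction X generalizing G with
  | nil => simp [Fresh, run]
  | cons x X ih => rw [List.cons_append, Fresh, Fresh, ih, and_assoc]; rfl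

theorem mem_step {G : WGraph n} {x : Op n} {e : Edge n} :
    e ∈ G.step x ↔ x = .insert e.1 e.2.1 e.2.2 ∨ (e ∈ G ∧ ∀ u v, x = .delete u v → ends e ≠ s(u, v)) := by
  cases x with
  | insert u v w =>
    simp only [WGraph.step, List.mem_cons, Op.insert.injEq, reduceCtorEq, false_imp_iff,
      implies_true, and_true]
    refine or_congr_left ⟨fun h => ?_, fun h => ?_⟩
    · rw [h]; exact ⟨rfl, rfl, rfl⟩
    · exact Prod.ext h.1.symm (Prod.ext h.2.1.symm h.2.2.symm)
  | delete u v =>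
    simp only [WGraph.step, List.mem_filter, Op.delete.injEq, reduceCtorEq, false_or,
      decide_eq_true_eq]
    refine and_congr_right fun _ => ⟨?_, fun h => h u v ⟨rfl, rfl⟩⟩
    rintro h _ _ ⟨rfl, rfl⟩
    exact h
  | query u v => simp [WGraph.step]

theorem mem_run_congr {G H : WGraph n} (h : ∀ e, e ∈ G ↔ e ∈ H) (ops : List (Op n)) :
    ∀ e, e ∈ run G ops ↔ e ∈ run H ops := by
  induction ops generalizing G H with
  | nil => exact h
  | cons x ops ih => exact ih fun e => by rw [mem_step, mem_step, h]

theorem fresh_mono {G H : WGraph n} (h : ∀ e ∈ H, e ∈ G) {ops : List (Op n)} (hf : Fresh G ops) :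
    Fresh H ops := by
  induction ops generalizing G H with
  | nil => trivial
  | cons x ops ih =>
    refine ⟨fun u v w hx hm => hf.1 u v w hx ?_, ih (fun e he => ?_) hf.2⟩
    · obtain ⟨e, he, h1⟩ := List.mem_map.1 hm
      exact List.mem_map.2 ⟨e, h e he, h1⟩
    · rw [mem_step] at he ⊢
      exact he.imp_right fun h1 => ⟨h e h1.1, h1.2⟩

/-- An edge survives if it is not deleted. -/
theorem mem_run_append {A B C : WGraph n} {ops : List (Op n)}
    (hA : ∀ e, e ∈ A ↔ e ∈ B ∨ e ∈ C) (hC : ∀ e ∈ C, ∀ u v, .delete u v ∈ ops → ends e ≠ s(u, v)) :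
    ∀ e, e ∈ run A ops ↔ e ∈ run B ops ∨ e ∈ C := by
  induction ops generalizing A B with
  | nil => exact hA
  | cons x ops ih =>
    refine ih (A := A.step x) (B := B.step x) (fun e => ?_) fun e he u v h =>
      hC e he u v (List.mem_cons_of_mem _ h)
    rw [mem_step, mem_step, hA]
    have : e ∈ C → ∀ u v, x = .delete u v → ends e ≠ s(u, v) := fun he u v hx =>
      hC e he u v (by simp [hx])
    tauto

theorem nodup_step {G : WGraph n} {x : Op n} (h : (G.map ends).Nodup)
    (hx : ∀ u v w, x = .insert u v w → s(u, v) ∉ G.map ends) : ((G.step x).map ends).Nodup := by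
  cases x with
  | insert u v w => exact List.nodup_cons.2 ⟨hx u v w rfl, h⟩
  | delete u v => exact h.sublist (List.filter_sublist.map _)
  | query u v => exact h

theorem nodup_run {G : WGraph n} {ops : List (Op n)} (h : (G.map ends).Nodup)
    (hf : Fresh G ops) : ((run G ops).map ends).Nodup := by
  induction ops generalizing G with
  | nil => exact h
  | cons x ops ih => exact ih (nodup_step h hf.1) hf.2

theorem length_step (G : WGraph n) (x : Op n) : (G.step x).length ≤ G.length + 1 := by
  cases x with
  | insert u v w => exact le_rfl
  | delete u v => exact (List.length_filter_le _ _).trans (Nat.le_succ _)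
  | query u v => exact Nat.le_succ _

theorem length_run (G : WGraph n) (ops : List (Op n)) :
    (run G ops).length ≤ G.length + ops.length := by
  induction ops generalizing G with
  | nil => exact le_rfl
  | cons x ops ih =>
    refine (ih (G.step x)).trans ?_
    have := length_step G x
    rw [List.length_cons]
    omega

theorem length_eq_of_mem_iff {G H : WGraph n} (hG : (G.map ends).Nodup) (hH : (H.map ends).Nodup)
    (h : ∀ e, e ∈ G ↔ e ∈ H) : G.length = H.length :=
  ((List.perm_ext_iff_of_nodup (List.Nodup.of_map _ hG) (List.Nodup.of_map _ hH)).2 h).length_eq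

/-! ## Evaluating a sequence of operations edge by edge -/

/-- An edge, with `0` for an insertion, `1` for a deletion, and `2` for a mark. -/
abbrev Item (n : ℕ) := ℕ × Edge n

/-- The weight of a deletion is a dummy; only the kind and the key of the item are used. -/
def opItem : Op n → List (ℕ × Item n)
  | .insert u v w => [(pairKey u v, 0, u, v, w)]
  | .delete u v => [(pairKey u v, 1, u, v, 0)]
  | .query _ _ => []

def opMark : Op n → List (ℕ × Item n)
  | .insert _ _ _ => []
  | .delete u v => [(pairKey u v, 2, u, v, 0)]
  | .query _ _ => []

def edgeItem (e : Edge n) : ℕ × Item n := (pairKey e.1 e.2.1, 0, e)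

/-- The edges that are present after the items. -/
def lastEdge (g : List (Item n)) : List (Edge n) :=
  g.foldl (fun st it => if it.1 = 0 then [it.2] else if it.1 = 1 then [] else st) []

def marks (g : List (Item n)) : List (Item n) := g.filter fun it => it.1 = 2

/-- The items for the edges of `A`, the operations `X`, and the deletions in `Y`. -/
def items (A : WGraph n) (X Y : List (Op n)) : List (ℕ × Item n) :=
  A.map edgeItem ++ (X.flatMap opItem ++ Y.flatMap opMark)

def itemGroups (A : WGraph n) (X Y : List (Op n)) : List (List (Item n)) :=
  grouped (keyBits n) (items A X Y)

/-- The edges of `run A X` that are deleted in `Y`. -/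
def active (A : WGraph n) (X Y : List (Op n)) : WGraph n :=
  (itemGroups A X Y).flatMap fun g => if marks g ≠ [] then lastEdge g else []

/-- The edges of `run A X` that are not deleted in `Y`. -/
def passive (A : WGraph n) (X Y : List (Op n)) : WGraph n :=
  (itemGroups A X Y).flatMap fun g => if marks g ≠ [] then [] else lastEdge g

theorem withKey_append {κ : Type*} (k : ℕ) (g h : List (ℕ × κ)) :
    withKey k (g ++ h) = withKey k g ++ withKey k h := by
  simp [withKey]

/-- The presence of an edge depends only on the operations with its key, and the last of them
decides. Freshness excludes a second, parallel entry, so an insertion leaves exactly the inserted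
edge. -/
theorem mem_lastEdge_run (ops : List (Op n)) (hf : Fresh [] ops) (e : Edge n) :
    e ∈ run [] ops ↔ e ∈ lastEdge (withKey (pairKey e.1 e.2.1) (ops.flatMap opItem)) := by
  induction ops using List.reverseRecOn with
  | nil => simp [run, lastEdge, withKey]
  | append_singleton ops x ih =>
    obtain ⟨h1, h2, -⟩ := fresh_append.1 hf
    have ih := ih h1
    rw [run_append, List.flatMap_append, withKey_append, List.flatMap_singleton]
    unfold lastEdge at ih ⊢
    rw [List.foldl_append]
    have hs : run (run [] ops) [x] = (run [] ops).step x := rfl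
    rw [hs, mem_step, ih]
    cases x with
    | query u v => simp [opItem, withKey]
    | insert u v w =>
      have h3 := h2 u v w rfl
      simp only [Op.insert.injEq, reduceCtorEq, false_imp_iff, implies_true, and_true, opItem]
      by_cases hk : pairKey u v = pairKey e.1 e.2.1
      · simp only [withKey, hk, decide_true, List.filter_cons, if_true, List.filter_nil,
          List.map_cons, List.map_nil, List.foldl_cons, List.foldl_nil, List.mem_singleton]
        constructor
        · rintro (⟨rfl, rfl, rfl⟩ | h)
          · rfl
          · exact absurd (List.mem_map.2 ⟨e, ih.2 h, (pairKey_eq.1 hk).symm⟩) h3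
        · intro h
          rw [h]
          exact Or.inl ⟨rfl, rfl, rfl⟩
      · have : ¬ (u = e.1 ∧ v = e.2.1 ∧ w = e.2.2) := by
          rintro ⟨rfl, rfl, _⟩
          exact hk rfl
        simp [withKey, hk, this]
    | delete u v =>
      simp only [Op.delete.injEq, reduceCtorEq, false_or, opItem]
      by_cases hk : pairKey u v = pairKey e.1 e.2.1
      · have : ends e = s(u, v) := (pairKey_eq.1 hk).symm
        simp only [withKey, hk, decide_true, List.filter_cons, if_true, List.filter_nil,
          List.map_cons, List.map_nil, List.foldl_cons, List.foldl_nil, one_ne_zero, if_false,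
          List.not_mem_nil, iff_false, not_and, not_forall]
        exact fun _ => ⟨u, v, ⟨rfl, rfl⟩, not_not.2 this⟩
      · have h4 : ∀ u' v', u = u' ∧ v = v' → ends e ≠ s(u', v') := by
          rintro _ _ ⟨rfl, rfl⟩ h
          exact hk (pairKey_eq.2 h.symm)
        simp only [withKey, hk, decide_false, List.filter_cons, List.filter_nil]
        simp only [Bool.false_eq_true, if_false, List.map_nil, List.foldl_nil, and_iff_left_iff_imp]
        intro _ u' v' h
        exact h4 u' v' h

theorem foldl_marks (g h : List (Item n)) (hg : ∀ it ∈ h, it.1 = 2) :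
    lastEdge (g ++ h) = lastEdge g := by
  induction h using List.reverseRecOn with
  | nil => simp
  | append_singleton h it ih =>
    have h1 := hg it (by simp)
    rw [← List.append_assoc]
    unfold lastEdge at ih ⊢
    rw [List.foldl_append, ih fun it' h' => hg it' (by simp [h'])]
    simp [h1]

theorem length_lastEdge (g : List (Item n)) : (lastEdge g).length ≤ 1 := by
  induction g using List.reverseRecOn with
  | nil => simp [lastEdge]
  | append_singleton g it ih =>
    unfold lastEdge at ih ⊢
    rw [List.foldl_append, List.foldl_cons, List.foldl_nil]
    split_ifs
    · simp
    · simp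
    · exact ih

theorem mem_opItem {x : Op n} {p : ℕ × Item n} (h : p ∈ opItem x) :
    p.1 = pairKey p.2.2.1 p.2.2.2.1 ∧ p.2.1 ≠ 2 := by
  cases x <;> simp only [opItem, List.mem_singleton, List.not_mem_nil] at h <;> subst h <;>
    simp

theorem mem_opMark {x : Op n} {p : ℕ × Item n} :
    p ∈ opMark x ↔ ∃ u v, x = .delete u v ∧ p = (pairKey u v, 2, u, v, 0) := by
  cases x <;> simp [opMark]

theorem mem_items {A : WGraph n} {X Y : List (Op n)} {p : ℕ × Item n} (h : p ∈ items A X Y) :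
    p.1 = pairKey p.2.2.1 p.2.2.2.1 := by
  unfold items at h
  simp only [List.mem_append, List.mem_map, List.mem_flatMap] at h
  rcases h with ⟨e, _, rfl⟩ | ⟨x, _, h⟩ | ⟨x, _, h⟩
  · rfl
  · exact (mem_opItem h).1
  · obtain ⟨u, v, _, rfl⟩ := mem_opMark.1 h
    rfl

/-- The operations that build a graph. -/
def build (A : WGraph n) : List (Op n) := A.map fun e => .insert e.1 e.2.1 e.2.2

theorem run_build (A B : WGraph n) : run B (build A) = A.reverse ++ B := by
  induction A generalizing B with
  | nil => rfl
  | cons e A ih =>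
    have : run B (build (e :: A)) = run (e :: B) (build A) := rfl
    rw [this, ih]
    simp

theorem fresh_build {A : WGraph n} (h : (A.map ends).Nodup) : Fresh [] (build A) := by
  induction A using List.reverseRecOn with
  | nil => trivial
  | append_singleton A e ih =>
    rw [List.map_append, List.nodup_append] at h
    have : build (A ++ [e]) = build A ++ [.insert e.1 e.2.1 e.2.2] := by simp [build]
    rw [this, fresh_append, run_build]
    refine ⟨ih h.1, ?_, trivial⟩
    rintro u v w hx hm
    obtain ⟨rfl, rfl, rfl⟩ := Op.insert.inj hx
    obtain ⟨e', he', h1⟩ := List.mem_map.1 hm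
    exact h.2.2 (ends e') (List.mem_map.2 ⟨e', by simpa using he', rfl⟩) (ends e) (by simp) h1

/-- The graph `A` is treated as built by insertions before `X`, which reduces the claim to runs that
start with the empty graph. The marks for `Y` come last and do not affect `lastEdge`. Grouping by
keys avoids a scan of the whole graph for every operation. -/
theorem itemGroups_spec (A : WGraph n) (X Y : List (Op n)) (hA : (A.map ends).Nodup)
    (hX : Fresh A X) :
    ∃ ks : List ℕ, ks.Nodup ∧ itemGroups A X Y = ks.map (fun k => withKey k (items A X Y)) ∧
      (∀ e : Edge n, e ∈ run A X → pairKey e.1 e.2.1 ∈ ks) ∧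
      (∀ (e : Edge n) (k : ℕ), e ∈ lastEdge (withKey k (items A X Y)) ↔
        k = pairKey e.1 e.2.1 ∧ e ∈ run A X) ∧
      ∀ e : Edge n, marks (withKey (pairKey e.1 e.2.1) (items A X Y)) ≠ [] ↔
        ∃ u v, .delete u v ∈ Y ∧ ends e = s(u, v) := by
  obtain ⟨ks, h1, h2, h3⟩ := grouped_spec (B := keyBits n) (g := items A X Y) (by
    intro p hp
    rw [mem_items hp]
    exact pairKey_lt_pow _ _)
  have hb : A.map edgeItem ++ X.flatMap opItem = (build A ++ X).flatMap opItem := by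
    rw [List.flatMap_append, build, List.flatMap_map]
    congr 1
    exact List.map_eq_flatMap
  have hrev : ∀ e, e ∈ A ↔ e ∈ (A.reverse ++ [] : WGraph n) := fun e => by simp
  have hfr : Fresh [] (build A ++ X) := by
    rw [fresh_append, run_build]
    exact ⟨fresh_build hA, fresh_mono (fun e => (hrev e).2) hX⟩
  have hlast : ∀ k, lastEdge (withKey k (items A X Y)) =
      lastEdge (withKey k ((build A ++ X).flatMap opItem)) := by
    intro k
    rw [items, ← List.append_assoc, hb, withKey_append, foldl_marks]
    intro it hit
    obtain ⟨x, _, hx⟩ := List.mem_flatMap.1 (mem_withKey.1 hit)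
    obtain ⟨u, v, _, h⟩ := mem_opMark.1 hx
    exact congrArg (fun p => p.2.1) h
  have hrun : ∀ e, e ∈ run A X ↔
      e ∈ lastEdge (withKey (pairKey e.1 e.2.1) (items A X Y)) := by
    intro e
    rw [hlast, ← mem_lastEdge_run _ hfr, run_append, run_build]
    exact mem_run_congr hrev X e
  have hsub : ∀ (g : List (Item n)) (e : Edge n), e ∈ lastEdge g → ∃ it ∈ g, it.2 = e := by
    intro g e
    induction g using List.reverseRecOn with
    | nil => simp [lastEdge]
    | append_singleton g it ih =>
      unfold lastEdge at ih ⊢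
      rw [List.foldl_append, List.foldl_cons, List.foldl_nil]
      split_ifs
      · intro h
        exact ⟨it, by simp, (List.mem_singleton.1 h).symm⟩
      · simp
      · intro h
        obtain ⟨it', h1, h2⟩ := ih h
        exact ⟨it', by simp [h1], h2⟩
  have hkey : ∀ (e : Edge n) (k : ℕ), e ∈ lastEdge (withKey k (items A X Y)) →
      (∃ p ∈ items A X Y, p.1 = k) ∧ k = pairKey e.1 e.2.1 := by
    intro e k he
    obtain ⟨it, h4, rfl⟩ := hsub _ _ he
    exact ⟨⟨_, mem_withKey.1 h4, rfl⟩, mem_items (mem_withKey.1 h4)⟩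
  refine ⟨ks, h1, h3, fun e he => (h2 _).2 (hkey e _ ((hrun e).1 he)).1, fun e k => ?_,
    fun e => ?_⟩
  · constructor
    · intro he
      obtain ⟨_, rfl⟩ := hkey e k he
      exact ⟨rfl, (hrun e).2 he⟩
    · rintro ⟨rfl, he⟩
      exact (hrun e).1 he
  · rw [ne_eq, marks, List.filter_eq_nil_iff]
    simp only [decide_eq_true_eq, not_forall, not_not, mem_withKey, exists_prop]
    constructor
    · rintro ⟨it, h4, h5⟩
      unfold items at h4
      simp only [List.mem_append, List.mem_map, List.mem_flatMap] at h4
      rcases h4 with ⟨e', _, h⟩ | ⟨x, _, h⟩ | ⟨x, hx, h⟩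
      · exact absurd ((congrArg (fun p => p.2.1) h).trans h5) (show ¬ (0 : ℕ) = 2 by decide)
      · exact absurd h5 (mem_opItem h).2
      · obtain ⟨u, v, rfl, h'⟩ := mem_opMark.1 h
        exact ⟨u, v, hx, pairKey_eq.1 (congrArg (fun p => p.1) h')⟩
    · rintro ⟨u, v, h4, h5⟩
      refine ⟨(2, u, v, 0), ?_, rfl⟩
      unfold items
      simp only [List.mem_append, List.mem_map, List.mem_flatMap]
      exact Or.inr (Or.inr ⟨_, h4, mem_opMark.2 ⟨u, v, rfl, by rw [pairKey_eq.2 h5]⟩⟩)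

theorem mem_active {A : WGraph n} {X Y : List (Op n)} (hA : (A.map ends).Nodup)
    (hX : Fresh A X) (e : Edge n) :
    e ∈ active A X Y ↔ e ∈ run A X ∧ ∃ u v, .delete u v ∈ Y ∧ ends e = s(u, v) := by
  obtain ⟨ks, h1, h2, h3, h4, h5⟩ := itemGroups_spec A X Y hA hX
  unfold active
  rw [h2, List.flatMap_map, List.mem_flatMap]
  constructor
  · rintro ⟨k, hk, he⟩
    split_ifs at he with hm
    · obtain ⟨rfl, h6⟩ := (h4 e k).1 he
      exact ⟨h6, (h5 e).1 hm⟩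
    · exact absurd he List.not_mem_nil
  · rintro ⟨h6, h7⟩
    exact ⟨_, h3 e h6, by rw [if_pos ((h5 e).2 h7)]; exact (h4 e _).2 ⟨rfl, h6⟩⟩

theorem mem_passive {A : WGraph n} {X Y : List (Op n)} (hA : (A.map ends).Nodup)
    (hX : Fresh A X) (e : Edge n) :
    e ∈ passive A X Y ↔ e ∈ run A X ∧ ¬ ∃ u v, .delete u v ∈ Y ∧ ends e = s(u, v) := by
  obtain ⟨ks, h1, h2, h3, h4, h5⟩ := itemGroups_spec A X Y hA hX
  unfold passive
  rw [h2, List.flatMap_map, List.mem_flatMap]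
  constructor
  · rintro ⟨k, hk, he⟩
    split_ifs at he with hm
    · exact absurd he List.not_mem_nil
    · obtain ⟨rfl, h6⟩ := (h4 e k).1 he
      exact ⟨h6, fun h => hm ((h5 e).2 h)⟩
  · rintro ⟨h6, h7⟩
    refine ⟨_, h3 e h6, ?_⟩
    rw [if_neg fun h => h7 ((h5 e).1 h)]
    exact (h4 e _).2 ⟨rfl, h6⟩

/-- Every group yields at most one edge, and different groups have different keys. -/
theorem nodup_select {A : WGraph n} {X Y : List (Op n)} (hA : (A.map ends).Nodup)
    (hX : Fresh A X) (f : List (Item n) → WGraph n) (hf : ∀ g, f g = lastEdge g ∨ f g = []) :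
    (((itemGroups A X Y).flatMap f).map ends).Nodup := by
  obtain ⟨ks, h1, h2, h3, h4, h5⟩ := itemGroups_spec A X Y hA hX
  have hsub : ∀ k, ∀ e ∈ f (withKey k (items A X Y)), k = pairKey e.1 e.2.1 := by
    intro k e he
    rcases hf (withKey k (items A X Y)) with h | h
    · rw [h] at he
      exact ((h4 e k).1 he).1
    · rw [h] at he
      exact absurd he List.not_mem_nil
  rw [h2, List.flatMap_map, List.map_flatMap, List.nodup_flatMap]
  refine ⟨fun k _ => ?_, h1.imp fun {k k'} hne p hp hp' => ?_⟩
  · rcases hf (withKey k (items A X Y)) with h | h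
    · rw [h]
      have := length_lastEdge (withKey k (items A X Y))
      generalize lastEdge (withKey k (items A X Y)) = l at this
      rcases l with _ | ⟨a, _ | ⟨b, t⟩⟩
      · simp
      · simp
      · simp at this
    · rw [h]; simp
  · obtain ⟨e, he, rfl⟩ := List.mem_map.1 hp
    obtain ⟨e', he', h6⟩ := List.mem_map.1 hp'
    exact hne ((hsub k e he).trans ((pairKey_eq.2 h6.symm).trans (hsub k' e' he').symm))

theorem nodup_active {A : WGraph n} {X Y : List (Op n)} (hA : (A.map ends).Nodup)
    (hX : Fresh A X) : ((active A X Y).map ends).Nodup :=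
  nodup_select hA hX _ fun g => by split_ifs <;> simp

theorem nodup_passive {A : WGraph n} {X Y : List (Op n)} (hA : (A.map ends).Nodup)
    (hX : Fresh A X) : ((passive A X Y).map ends).Nodup :=
  nodup_select hA hX _ fun g => by split_ifs <;> simp

/-- Distinct active edges need distinct deletions in `Y`. This keeps the active part of a task no
longer than its block, whatever the size of `A`. -/
theorem length_active {A : WGraph n} {X Y : List (Op n)} (hA : (A.map ends).Nodup)
    (hX : Fresh A X) : (active A X Y).length ≤ Y.length := by
  have h := (nodup_active (Y := Y) hA hX).subperm (l₂ := Y.map Op.ends) fun p hp => by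
    obtain ⟨e, he, rfl⟩ := List.mem_map.1 hp
    obtain ⟨_, u, v, h1, h2⟩ := (mem_active hA hX e).1 he
    exact List.mem_map.2 ⟨_, h1, h2.symm⟩
  simpa using h.length_le

theorem length_passive {A : WGraph n} {X Y : List (Op n)} (hA : (A.map ends).Nodup)
    (hX : Fresh A X) : (passive A X Y).length ≤ A.length + X.length := by
  have h := (nodup_passive (Y := Y) hA hX).subperm (l₂ := (run A X).map ends) fun p hp => by
    obtain ⟨e, he, rfl⟩ := List.mem_map.1 hp
    exact List.mem_map.2 ⟨_, ((mem_passive hA hX e).1 he).1, rfl⟩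
  simpa using h.length_le.trans (by simpa using length_run A X)

theorem mem_passive_nil {A : WGraph n} {X : List (Op n)} (hA : (A.map ends).Nodup)
    (hX : Fresh A X) (e : Edge n) : e ∈ passive A X [] ↔ e ∈ run A X := by
  rw [mem_passive hA hX]; simp

end DynDist

namespace DynDist

/-! ## Cutting a list into blocks -/

section Cut

variable {κ : Type*}

/-- Puts an element in front of the first block, if this has less than `h` elements. -/
def cutStep (h : ℕ) (x : κ) : List (List κ) → List (List κ)
  | [] => [[x]]
  | c :: cs => if c.length < h then (x :: c) :: cs else [x] :: c :: cs

/-- Cuts a list into blocks of length `h`; only the first one may be shorter. -/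
def cut (h : ℕ) (l : List κ) : List (List κ) := l.foldr (cutStep h) []

theorem cut_cons (h : ℕ) (x : κ) (l : List κ) : cut h (x :: l) = cutStep h x (cut h l) := rfl

theorem flatten_cut (h : ℕ) (l : List κ) : (cut h l).flatten = l := by
  induction l with
  | nil => rfl
  | cons x l ih =>
    rw [cut_cons]
    cases hc : cut h l with
    | nil => rw [hc] at ih; simp [cutStep, ← ih]
    | cons c cs => rw [hc] at ih; rw [cutStep]; split_ifs <;> simp [← ih]

/-- The cutting proceeds from the right, and the stronger claim is that all blocks behind the first
have length exactly `h`. Hence there is at most one block beyond `l.length / h`. -/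
theorem cut_spec {h : ℕ} (hh : 0 < h) (l : List κ) :
    (∀ c ∈ cut h l, c ≠ [] ∧ c.length ≤ h) ∧ (cut h l).length * h ≤ l.length + h := by
  suffices (∀ c ∈ cut h l, c ≠ [] ∧ c.length ≤ h) ∧
      (cut h l = [] ∧ l = [] ∨ ∃ c cs, cut h l = c :: cs ∧ cs.length * h + c.length = l.length) by
    refine ⟨this.1, ?_⟩
    rcases this.2 with ⟨h1, _⟩ | ⟨c, cs, h1, h2⟩
    · rw [h1]; simp
    · rw [h1, List.length_cons, add_mul]; omega
  induction l with
  | nil => exact ⟨by simp [cut], Or.inl ⟨rfl, rfl⟩⟩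
  | cons x l ih =>
    rw [cut_cons]
    obtain ⟨h1, ⟨h2, rfl⟩ | ⟨c, cs, h2, h3⟩⟩ := ih
    · rw [h2]
      refine ⟨?_, Or.inr ⟨[x], [], rfl, by simp⟩⟩
      intro c hc
      rw [cutStep, List.mem_singleton] at hc
      subst hc
      exact ⟨by simp, hh⟩
    · rw [h2] at h1 ⊢
      rw [cutStep]
      have h4 := h1 c (by simp)
      split_ifs with hlt
      · refine ⟨?_, Or.inr ⟨_, _, rfl, by simp only [List.length_cons]; omega⟩⟩
        intro c' hc'
        rcases List.mem_cons.1 hc' with rfl | hc'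
        · exact ⟨by simp, hlt⟩
        · exact h1 c' (List.mem_cons_of_mem _ hc')
      · refine ⟨?_, Or.inr ⟨_, _, rfl, ?_⟩⟩
        · intro c' hc'
          rcases List.mem_cons.1 hc' with rfl | hc'
          · exact ⟨by simp, hh⟩
          · exact h1 c' hc'
        · have : c.length = h := by omega
          simp only [List.length_cons, List.length_nil]
          rw [← h3, this]
          ring

end Cut

variable {n : ℕ}

/-! ## Tasks -/

def Op.src : Op n → Fin n
  | .insert u _ _ => u
  | .delete u _ => u
  | .query u _ => u

def Op.tgt : Op n → Fin n
  | .insert _ v _ => v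
  | .delete _ v => v
  | .query _ v => v

theorem Op.ends_eq_mk (x : Op n) : x.ends = s(x.src, x.tgt) := by cases x <;> rfl

/-- The vertices named by the operations. -/
def named (X : List (Op n)) : List (Fin n) := X.flatMap fun x => [x.src, x.tgt]

theorem mem_named {X : List (Op n)} {v : Fin n} : v ∈ named X ↔ ∃ x ∈ X, v ∈ x.ends := by
  simp [named, Op.ends_eq_mk]

theorem named_append (X Y : List (Op n)) : named (X ++ Y) = named X ++ named Y :=
  List.flatMap_append

theorem ends_mem_named {X : List (Op n)} {e : Edge n} {x : Op n} (hx : x ∈ X)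
    (h : ends e = x.ends) : e.1 ∈ named X ∧ e.2.1 ∈ named X :=
  ⟨mem_named.2 ⟨x, hx, by rw [← h]; simp [ends]⟩, mem_named.2 ⟨x, hx, by rw [← h]; simp [ends]⟩⟩

/-- A task `(K, A, X)` is to answer the queries among the operations `X`, in the graphs
`K ++ run A Y` for the prefixes `Y` of `X`. -/
abbrev Task (n : ℕ) := WGraph n × WGraph n × List (Op n)

/-- The graphs of a task are planar and approximate, for the vertices named by its operations,
the graphs of a sequence of operations that starts with `G`. -/
structure Task.Good (c : ℝ≥0∞) (G : WGraph n) (t : Task n) : Prop where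
  nodup : (t.2.1.map ends).Nodup
  fresh : Fresh t.2.1 t.2.2
  planar : ∀ p, p <+: t.2.2 → IsPlanar (WGraph.toGraph (t.1 ++ run t.2.1 p))
  lower : ∀ p, p <+: t.2.2 → ∀ u ∈ named t.2.2, ∀ v ∈ named t.2.2,
    (run G p).dist u v ≤ WGraph.dist (t.1 ++ run t.2.1 p) u v
  upper : ∀ p, p <+: t.2.2 → ∀ u ∈ named t.2.2, ∀ v ∈ named t.2.2,
    WGraph.dist (t.1 ++ run t.2.1 p) u v ≤ c * (run G p).dist u v

/-- Sparsification of planar graphs. -/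
def Sparsifies (ε : ℝ) (M : WGraph n → List (Fin n) → WGraph n) : Prop :=
  ∀ G T, G.Simple → IsPlanar G.toGraph → T.Nodup → IsDistApproxMinor ε G {v | v ∈ T} (M G T)

/-- The task for the first part of the operations of a task. -/
noncomputable def subtask (M : WGraph n → List (Fin n) → WGraph n) (K A : WGraph n)
    (X : List (Op n)) : Task n :=
  (M (simplify (K ++ passive A [] X)) (distinct (named X)), active A [] X, X)

theorem Task.Good.fresh_left {c : ℝ≥0∞} {G K A : WGraph n} {X Y : List (Op n)}
    (h : Task.Good c G (K, A, X ++ Y)) : Fresh A X := (fresh_append.1 h.fresh).1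

/-- This moves on to the later blocks without sparsifying: with no deletions to mark, `passive A X
[]` is the whole graph `run A X`, in a duplicate-free order. -/
theorem Task.Good.rest {c : ℝ≥0∞} {G K A : WGraph n} {X Y : List (Op n)}
    (h : Task.Good c G (K, A, X ++ Y)) : Task.Good c (run G X) (K, passive A X [], Y) := by
  have hm := mem_passive_nil h.nodup h.fresh_left
  have hmem : ∀ p, ∀ e, e ∈ K ++ run (passive A X []) p ↔ e ∈ K ++ run A (X ++ p) := by
    intro p e
    rw [List.mem_append, List.mem_append, run_append, mem_run_congr hm]
  have hp : ∀ p, p <+: Y → X ++ p <+: X ++ Y := fun p hp => (List.prefix_append_right_inj X).2 hp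
  have hn : ∀ v, v ∈ named Y → v ∈ named (X ++ Y) := fun v hv => by
    rw [named_append]; exact List.mem_append_right _ hv
  refine ⟨nodup_passive h.nodup h.fresh_left, fresh_mono (fun e => (hm e).1) (fresh_append.1 h.fresh).2,
    fun p h1 => ?_, fun p h1 u hu v hv => ?_, fun p h1 u hu v hv => ?_⟩
  · rw [toGraph_congr (hmem p)]
    exact h.planar _ (hp p h1)
  · rw [dist_congr (hmem p), ← run_append]
    exact h.lower _ (hp p h1) u (hn u hu) v (hn v hv)
  · rw [dist_congr (hmem p), ← run_append]
    exact h.upper _ (hp p h1) u (hn u hu) v (hn v hv)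

theorem mem_of_mem_run {G : WGraph n} {ops : List (Op n)} {e : Edge n} (h : e ∈ run G ops) :
    e ∈ G ∨ ∃ x ∈ ops, ends e = x.ends := by
  induction ops generalizing G with
  | nil => exact Or.inl h
  | cons x ops ih =>
    rcases ih h with h1 | ⟨y, hy, h1⟩
    · rcases mem_of_mem_step h1 with h2 | h2
      · exact Or.inl h2
      · exact Or.inr ⟨x, by simp, h2.symm⟩
    · exact Or.inr ⟨y, List.mem_cons_of_mem _ hy, h1⟩

/-- The input of the sparsification for a subtask is planar. -/
theorem Task.Good.planar_simplify {c : ℝ≥0∞} {G K A : WGraph n} {X Y : List (Op n)}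
    (h : Task.Good c G (K, A, X ++ Y)) :
    IsPlanar (simplify (K ++ passive A [] X)).toGraph := by
  rw [(simplify_spec _).2.toGraph_eq]
  refine (h.planar [] (List.nil_prefix)).mono (toGraph_mono fun e he => ?_)
  rw [List.mem_append] at he ⊢
  exact he.imp_right fun h1 => ((mem_passive (A := A) (X := []) h.nodup trivial e).1 h1).1

/-- All edges at a time of the block split into a part that is constant during the block, namely `K
++ P`, and `run B p`, whose edges have ends named in the block. Only the constant part is
sparsified, and the other one consists of edges between terminals. So `planar_append` and, in both
directions, `dist_append_le` apply. -/
theorem Task.Good.subtask {c : ℝ≥0∞} {ε : ℝ} (hε : 0 ≤ ε)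
    {M : WGraph n → List (Fin n) → WGraph n} (hM : Sparsifies ε M) {G K A : WGraph n}
    {X Y : List (Op n)} (h : Task.Good c G (K, A, X ++ Y)) :
    Task.Good (ENNReal.ofReal (1 + ε) * c) G (subtask M K A X) := by
  set P := passive A [] X with hP
  set B := active A [] X with hB
  obtain ⟨h1, h2⟩ := simplify_spec (K ++ P)
  have hpl : IsPlanar (simplify (K ++ P)).toGraph := h.planar_simplify
  obtain ⟨h3, h4⟩ := hM _ (distinct (named X)) h1 hpl (distinct_spec _).1
  set K' := M (simplify (K ++ P)) (distinct (named X)) with hK'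
  have hT : {v | v ∈ distinct (named X)} = {v | v ∈ named X} :=
    Set.ext fun v => (distinct_spec _).2 v
  rw [hT] at h3 h4
  rw [h2.toGraph_eq] at h3
  simp only [h2.dist_eq] at h4
  have hmP := fun e => mem_passive (A := A) (Y := X) (X := []) h.nodup trivial e
  have hmB := fun e => mem_active (A := A) (Y := X) (X := []) h.nodup trivial e
  have hprefix : ∀ p, p <+: X → p <+: X ++ Y := fun p hp => hp.trans (List.prefix_append X Y)
  have hn : ∀ v, v ∈ named X → v ∈ named (X ++ Y) := fun v hv => by
    rw [named_append]; exact List.mem_append_left _ hv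
  -- Passive edges survive every prefix of the block, so the run affects only the active ones.
  have hrun : ∀ p, p <+: X → ∀ e, e ∈ K ++ run A p ↔ e ∈ (K ++ P) ++ run B p := by
    intro p hp e
    have := mem_run_append (A := A) (B := B) (C := P) (ops := p) (fun e => by
      rw [hmP, hmB]
      exact ⟨fun h => (em _).imp (fun h' => ⟨h, h'⟩) fun h' => ⟨h, h'⟩,
        fun h => h.elim And.left And.left⟩) (fun e he u v hd hne => ((hmP e).1 he).2 ⟨u, v, hp.subset hd, hne⟩) e
    rw [List.mem_append, List.mem_append, List.mem_append, this]
    tauto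
  have hends : ∀ p, p <+: X → ∀ e ∈ run B p, e.1 ∈ named X ∧ e.2.1 ∈ named X := by
    intro p hp e he
    rcases mem_of_mem_run he with he | ⟨x, hx, hex⟩
    · obtain ⟨_, u, v, h5, h6⟩ := (hmB e).1 he
      exact ends_mem_named h5 h6
    · exact ends_mem_named (hp.subset hx) hex
  have hc1 : 1 ≤ ENNReal.ofReal (1 + ε) := by
    rw [ENNReal.one_le_ofReal]; linarith
  refine ⟨nodup_active h.nodup trivial,
    fresh_mono (fun e he => ((hmB e).1 he).1) h.fresh_left, fun p hp => ?_,
    fun p hp u hu v hv => ?_, fun p hp u hu v hv => ?_⟩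
  · refine h3.planar_append (hends p hp) ?_
    have := h.planar p (hprefix p hp)
    rw [toGraph_congr (hrun p hp)] at this
    exact this
  · refine (h.lower p (hprefix p hp) u (hn u hu) v (hn v hv)).trans ?_
    rw [dist_congr (hrun p hp)]
    refine (dist_append_le (A := K') (A' := K ++ P) (X := run B p) (T := {v | v ∈ named X}) (c := 1)
      le_rfl ENNReal.one_ne_top (fun u hu v hv => by simpa using (h4 u hu v hv).1) (hends p hp)
      hu hv).trans ?_
    rw [one_mul]
    exact le_rfl
  · refine (dist_append_le (A := K ++ P) (A' := K') (X := run B p) (T := {v | v ∈ named X}) hc1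
      ENNReal.ofReal_ne_top (fun u hu v hv => (h4 u hu v hv).2) (hends p hp) hu hv).trans ?_
    rw [mul_assoc, ← dist_congr (hrun p hp)]
    gcongr
    exact h.upper p (hprefix p hp) u (hn u hu) v (hn v hv)

/-- The subtasks for consecutive blocks of operations. -/
noncomputable def subtasks (M : WGraph n → List (Fin n) → WGraph n) (K : WGraph n) :
    WGraph n → List (List (Op n)) → List (Task n)
  | _, [] => []
  | A, X :: Xs => subtask M K A X :: subtasks M K (passive A X []) Xs

/-- The subtasks of a task for blocks of length `h`. -/
noncomputable def children (M : WGraph n → List (Fin n) → WGraph n) (h : ℕ) (t : Task n) :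
    List (Task n) :=
  subtasks M t.1 t.2.1 (cut h t.2.2)

/-- The tasks belong to consecutive parts of a sequence of operations that starts with `G`. -/
def Tasks (c : ℝ≥0∞) : WGraph n → List (Task n) → Prop
  | _, [] => True
  | G, t :: ts => t.Good c G ∧ Tasks c (run G t.2.2) ts

/-- All the operations of some tasks. -/
def opsOf (ts : List (Task n)) : List (Op n) := ts.flatMap fun t => t.2.2

theorem tasks_append {c : ℝ≥0∞} {G : WGraph n} {ts ts' : List (Task n)} :
    Tasks c G (ts ++ ts') ↔ Tasks c G ts ∧ Tasks c (run G (opsOf ts)) ts' := by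
  induction ts generalizing G with
  | nil => simp [Tasks, opsOf, run]
  | cons t ts ih =>
    rw [List.cons_append, Tasks, Tasks, ih, and_assoc, ← run_append]
    rfl

theorem opsOf_subtasks (M : WGraph n → List (Fin n) → WGraph n) (K A : WGraph n)
    (Xs : List (List (Op n))) : opsOf (subtasks M K A Xs) = Xs.flatten := by
  induction Xs generalizing A with
  | nil => rfl
  | cons X Xs ih =>
    rw [List.flatten_cons, ← ih (passive A X [])]
    rfl

theorem Task.Good.subtasks {c : ℝ≥0∞} {ε : ℝ} (hε : 0 ≤ ε)
    {M : WGraph n → List (Fin n) → WGraph n} (hM : Sparsifies ε M) {G K A : WGraph n}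
    {Xs : List (List (Op n))} (h : Task.Good c G (K, A, Xs.flatten)) :
    Tasks (ENNReal.ofReal (1 + ε) * c) G (subtasks M K A Xs) := by
  induction Xs generalizing G A with
  | nil => trivial
  | cons X Xs ih => exact ⟨Task.Good.subtask hε hM h, ih h.rest⟩

theorem opsOf_children (M : WGraph n → List (Fin n) → WGraph n) (h : ℕ) (ts : List (Task n)) :
    opsOf (ts.flatMap (children M h)) = opsOf ts := by
  unfold opsOf
  rw [List.flatMap_assoc]
  refine List.flatMap_congr fun t _ => ?_
  have := opsOf_subtasks M t.1 t.2.1 (cut h t.2.2)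
  rw [flatten_cut] at this
  exact this

theorem Tasks.children {c : ℝ≥0∞} {ε : ℝ} (hε : 0 ≤ ε)
    {M : WGraph n → List (Fin n) → WGraph n} (hM : Sparsifies ε M) {G : WGraph n} (h : ℕ)
    {ts : List (Task n)} (ht : Tasks c G ts) :
    Tasks (ENNReal.ofReal (1 + ε) * c) G (ts.flatMap (children M h)) := by
  induction ts generalizing G with
  | nil => trivial
  | cons t ts ih =>
    rw [List.flatMap_cons, tasks_append]
    have h1 : opsOf (DynDist.children M h t) = t.2.2 := by
      simpa [opsOf] using opsOf_children M h [t]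
    refine ⟨Task.Good.subtasks hε hM ?_, ?_⟩
    · rw [flatten_cut]; exact ht.1
    · rw [h1]; exact ih ht.2

/-- A task is good if it belongs to a good list. -/
theorem Tasks.exists_good {c : ℝ≥0∞} {G : WGraph n} {ts : List (Task n)} (ht : Tasks c G ts) :
    ∀ t ∈ ts, ∃ G', t.Good c G' := by
  induction ts generalizing G with
  | nil => simp
  | cons t ts ih =>
    intro t' h'
    rcases List.mem_cons.1 h' with rfl | h'
    · exact ⟨G, ht.1⟩
    · exact ih ht.2 t' h'

/-- The tasks after dividing with all the block lengths. -/
noncomputable def allTasks (M : WGraph n → List (Fin n) → WGraph n) (hs : List ℕ)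
    (ts : List (Task n)) : List (Task n) :=
  hs.foldl (fun ts h => ts.flatMap (children M h)) ts

theorem Tasks.all {c : ℝ≥0∞} {ε : ℝ} (hε : 0 ≤ ε)
    {M : WGraph n → List (Fin n) → WGraph n} (hM : Sparsifies ε M) {G : WGraph n} (hs : List ℕ)
    {ts : List (Task n)} (ht : Tasks c G ts) :
    Tasks (ENNReal.ofReal (1 + ε) ^ hs.length * c) G (allTasks M hs ts) ∧
      opsOf (allTasks M hs ts) = opsOf ts := by
  induction hs using List.reverseRecOn with
  | nil => simpa [allTasks] using ht
  | append_singleton hs h ih =>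
    have : allTasks M (hs ++ [h]) ts = (allTasks M hs ts).flatMap (DynDist.children M h) := by
      simp [allTasks]
    rw [this, opsOf_children]
    refine ⟨?_, ih.2⟩
    have := Tasks.children hε hM h ih.1
    rw [List.length_append, List.length_singleton, pow_succ', mul_assoc]
    exact this

theorem PlanarRun.fresh {G : WGraph n} {ops : List (Op n)} (h : PlanarRun G ops) :
    Fresh G ops := by
  induction ops generalizing G with
  | nil => trivial
  | cons x ops ih =>
    refine ⟨?_, ih h.2.2⟩
    rintro u v w rfl hm
    obtain ⟨e, he, h1⟩ := List.mem_map.1 hm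
    exact h.2.1.2 (toGraph_adj.2 ⟨⟨e, he, h1⟩, h.2.1.1⟩)

theorem PlanarRun.good {G : WGraph n} {ops : List (Op n)} (hG : G.Simple) (h : PlanarRun G ops) :
    Task.Good 1 G ([], G, ops) := by
  refine ⟨hG.2, h.fresh, fun p hp => ?_, fun p _ u _ v _ => le_rfl, fun p _ u _ v _ => ?_⟩
  · have := h.stateAt p.length
    rw [DynDist.stateAt, ← List.prefix_iff_eq_take.1 hp] at this
    exact this
  · rw [one_mul]; exact le_rfl

/-- The answers for a task with few operations. -/
noncomputable def answers (D : WGraph n → Fin n → Fin n → ℝ≥0∞) (t : Task n) : List ℝ≥0∞ :=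
  t.2.2.flatMap fun x => match x with
    | .query u v => [D (t.1 ++ t.2.1) u v]
    | _ => []

/-- When a task has a single operation, a query refers to the graph before that operation, so only
the empty prefix of the invariant is needed. -/
theorem Tasks.approxAnswers {c : ℝ≥0∞} {ε : ℝ} (hc : c ≤ ENNReal.ofReal (1 + ε))
    {D : WGraph n → Fin n → Fin n → ℝ≥0∞} (hD : ∀ K u v, D K u v = K.dist u v) {G : WGraph n}
    {ts : List (Task n)} (ht : Tasks c G ts) (h1 : ∀ t ∈ ts, t.2.2.length = 1) :
    ApproxAnswers ε G (opsOf ts) (ts.flatMap (answers D)) := by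
  induction ts generalizing G with
  | nil => rfl
  | cons t ts ih =>
    obtain ⟨K, A, X⟩ := t
    obtain ⟨x, rfl⟩ := List.length_eq_one_iff.1 (h1 (K, A, X) (by simp))
    have h2 := ih ht.2 fun t h => h1 t (List.mem_cons_of_mem _ h)
    cases x with
    | insert u v w => exact h2
    | delete u v => exact h2
    | query u v =>
      have hu : u ∈ named [(.query u v : Op n)] := by simp [named, Op.src]
      have hv : v ∈ named [(.query u v : Op n)] := by simp [named, Op.tgt]
      refine ⟨?_, h2⟩
      rw [hD]
      exact ⟨ht.1.lower [] List.nil_prefix u hu v hv,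
        (ht.1.upper [] List.nil_prefix u hu v hv).trans (by gcongr; exact le_rfl)⟩

end DynDist

namespace DynDist

variable {n : ℕ}

/-! ## Shortest paths by iterated relaxation -/

open Classical in
/-- A least element of a list, as a list with at most one element. -/
noncomputable def least (l : List ℝ≥0) : List ℝ≥0 :=
  l.foldl (fun a d => a.head?.elim [d] fun b => if b ≤ d then a else [d]) []

theorem least_nil : least [] = [] := rfl

theorem least_spec (l : List ℝ≥0) (hl : l ≠ []) :
    ∃ d ∈ l, least l = [d] ∧ ∀ d' ∈ l, d ≤ d' := by
  induction l using List.reverseRecOn with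
  | nil => exact absurd rfl hl
  | append_singleton l c ih =>
    unfold least at *
    rw [List.foldl_append]
    by_cases h : l = []
    · subst h
      exact ⟨c, by simp, rfl, by simp⟩
    · obtain ⟨e, h1, h2, h3⟩ := ih h
      rw [h2]
      simp only [List.foldl_cons, List.foldl_nil, List.head?_cons, Option.elim_some]
      split_ifs with hle
      · refine ⟨e, by simp [h1], rfl, fun e' he' => ?_⟩
        rcases List.mem_append.1 he' with he' | he'
        · exact h3 e' he'
        · rw [List.mem_singleton.1 he']; exact hle
      · refine ⟨c, by simp, rfl, fun e' he' => ?_⟩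
        rcases List.mem_append.1 he' with he' | he'
        · exact (not_le.1 hle).le.trans (h3 e' he')
        · rw [List.mem_singleton.1 he']

theorem mem_of_mem_least {l : List ℝ≥0} {d : ℝ≥0} (h : d ∈ least l) : d ∈ l := by
  by_cases hl : l = []
  · rw [hl] at h; exact absurd h List.not_mem_nil
  · obtain ⟨e, h1, h2, _⟩ := least_spec l hl
    rw [h2, List.mem_singleton] at h
    rwa [h]

theorem exists_mem_least {l : List ℝ≥0} {d : ℝ≥0} (h : d ∈ l) : ∃ d' ∈ least l, d' ≤ d := by
  obtain ⟨e, _, h2, h3⟩ := least_spec l (List.ne_nil_of_mem h)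
  exact ⟨e, by rw [h2]; simp, h3 d h⟩

theorem length_least (l : List ℝ≥0) : (least l).length ≤ 1 := by
  by_cases hl : l = []
  · rw [hl]; simp [least_nil]
  · obtain ⟨e, _, h2, _⟩ := least_spec l hl
    rw [h2]; simp

/-- A vertex with an upper bound of its distance. -/
abbrev Label (n : ℕ) := Fin n × ℝ≥0

/-- The upper bounds of the distance of `v` that follow from a label. -/
noncomputable def proposals (K : WGraph n) (v : Fin n) (p : Label n) : List ℝ≥0 :=
  (if p.1 = v then [p.2] else []) ++
    K.flatMap fun e => if (e.1 = p.1 ∧ e.2.1 = v) ∨ (e.1 = v ∧ e.2.1 = p.1) then [p.2 + e.2.2] else []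

/-- The new label of a vertex. -/
noncomputable def relabel (K : WGraph n) (D : List (Label n)) (v : Fin n) : List (Label n) :=
  (least (D.flatMap (proposals K v))).map fun d => (v, d)

/-- The endpoints of the edges. -/
def endpoints (K : WGraph n) : List (Fin n) := K.flatMap fun e => [e.1, e.2.1]

/-- One round of relaxation. -/
noncomputable def relax (K : WGraph n) (x : Fin n) (D : List (Label n)) : List (Label n) :=
  (x :: endpoints K).flatMap (relabel K D)

noncomputable def labels (K : WGraph n) (x : Fin n) (r : ℕ) : List (Label n) :=
  (relax K x)^[r] [(x, 0)]

/-- The distance according to the labels. -/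
noncomputable def readLabels (D : List (Label n)) (y : Fin n) : List ℝ≥0 :=
  least (D.flatMap fun p => if p.1 = y then [p.2] else [])

/-- The distance between two vertices, computed by relaxation. -/
noncomputable def shortest (K : WGraph n) (x y : Fin n) : ℝ≥0∞ :=
  (readLabels (labels K x K.length) y).head?.elim ∞ fun d => (d : ℝ≥0∞)

theorem mem_relax {K : WGraph n} {x v : Fin n} {d : ℝ≥0} {D : List (Label n)} :
    (v, d) ∈ relax K x D ↔ v ∈ x :: endpoints K ∧ d ∈ least (D.flatMap (proposals K v)) := by
  unfold relax relabel
  simp only [List.mem_flatMap, List.mem_map, Prod.mk.injEq]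
  constructor
  · rintro ⟨v', h1, d', h2, rfl, rfl⟩
    exact ⟨h1, h2⟩
  · rintro ⟨h1, h2⟩
    exact ⟨v, h1, d, h2, rfl, rfl⟩

theorem mem_proposals {K : WGraph n} {v : Fin n} {p : Label n} {d : ℝ≥0} :
    d ∈ proposals K v p ↔ (p.1 = v ∧ d = p.2) ∨ ∃ e ∈ K, ends e = s(p.1, v) ∧ d = p.2 + e.2.2 := by
  unfold proposals
  rw [List.mem_append, List.mem_flatMap]
  refine or_congr ?_ (exists_congr fun e => and_congr_right fun _ => ?_)
  · split_ifs with h <;> simp [h]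
  · rw [ends_eq]
    split_ifs with h
    · rw [List.mem_singleton]
      exact ⟨fun h' => ⟨h.imp (fun a => a) (fun a => a), h'⟩, fun h' => h'.2⟩
    · simp only [List.not_mem_nil, false_iff, not_and]
      exact fun h' => absurd h' h

theorem labels_succ (K : WGraph n) (x : Fin n) (r : ℕ) :
    labels K x (r + 1) = relax K x (labels K x r) := Function.iterate_succ_apply' _ _ _

theorem dist_le_of_mem_labels {K : WGraph n} {x v : Fin n} {d : ℝ≥0} {r : ℕ}
    (h : (v, d) ∈ labels K x r) : K.dist x v ≤ d := by
  induction r generalizing v d with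
  | zero =>
    rw [labels, Function.iterate_zero, id, List.mem_singleton, Prod.mk.injEq] at h
    rw [h.1, dist_self]; exact zero_le
  | succ r ih =>
    rw [labels_succ, mem_relax] at h
    obtain ⟨⟨u, d'⟩, h1, h2⟩ := List.mem_flatMap.1 (mem_of_mem_least h.2)
    rcases mem_proposals.1 h2 with ⟨rfl, rfl⟩ | ⟨e, he, h3, rfl⟩
    · exact ih h1
    · refine (dist_triangle K x u v).trans ?_
      rw [ENNReal.coe_add]
      refine add_le_add (ih h1) ?_
      rcases ends_eq.1 h3 with ⟨h4, h5⟩ | ⟨h4, h5⟩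
      · simpa only [h4, h5] using (dist_edge he).1
      · simpa only [h4, h5] using (dist_edge he).2

/-- A label proposes its own value to its vertex, so values never increase. Only the source and the
endpoints of edges are relabelled in each round, hence the condition on `v`. -/
theorem labels_mono {K : WGraph n} {x v : Fin n} (hv : v ∈ x :: endpoints K) {d : ℝ≥0} {r s : ℕ}
    (h : (v, d) ∈ labels K x r) (hrs : r ≤ s) : ∃ d' ≤ d, (v, d') ∈ labels K x s := by
  induction s, hrs using Nat.le_induction with
  | base => exact ⟨d, le_rfl, h⟩
  | succ s _ ih =>
    obtain ⟨d', h1, h2⟩ := ih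
    have h3 : d' ∈ (labels K x s).flatMap (proposals K v) :=
      List.mem_flatMap.2 ⟨_, h2, mem_proposals.2 (Or.inl ⟨rfl, rfl⟩)⟩
    obtain ⟨d'', h4, h5⟩ := exists_mem_least h3
    exact ⟨d'', h5.trans h1, by rw [labels_succ]; exact mem_relax.2 ⟨hv, h4⟩⟩

theorem exists_label_of_walk {K : WGraph n} {x u v : Fin n} (p : K.toGraph.Walk u v) :
    ∀ {r : ℕ} {d : ℝ≥0}, (u, d) ∈ labels K x r → ∃ d' : ℝ≥0, (v, d') ∈ labels K x (r + p.length) ∧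
      (d' : ℝ≥0∞) ≤ d + (p.darts.map fun a => K.weight a.fst a.snd).sum := by
  induction p with
  | nil => exact fun h => ⟨_, h, by simp⟩
  | @cons u w v huw p ih =>
    intro r d h
    obtain ⟨e, he, h1, h2⟩ := exists_weight huw
    have h3 : d + e.2.2 ∈ (labels K x r).flatMap (proposals K w) :=
      List.mem_flatMap.2 ⟨_, h, mem_proposals.2 (Or.inr ⟨e, he, h1, rfl⟩)⟩
    obtain ⟨d1, h4, h5⟩ := exists_mem_least h3
    have hw : w ∈ x :: endpoints K := by
      refine List.mem_cons_of_mem _ (List.mem_flatMap.2 ⟨e, he, ?_⟩)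
      rcases ends_eq.1 h1 with ⟨_, h⟩ | ⟨h, _⟩ <;> simp [h]
    have h6 : (w, d1) ∈ labels K x (r + 1) := by
      rw [labels_succ]; exact mem_relax.2 ⟨hw, h4⟩
    obtain ⟨d', h7, h8⟩ := ih h6
    refine ⟨d', ?_, h8.trans ?_⟩
    · rw [SimpleGraph.Walk.length_cons, ← add_assoc, add_right_comm]
      exact h7
    · rw [SimpleGraph.Walk.darts_cons, List.map_cons, List.sum_cons, ← add_assoc]
      refine add_le_add_left ?_ _
      have : (d1 : ℝ≥0∞) ≤ ((d + e.2.2 : ℝ≥0) : ℝ≥0∞) := by exact_mod_cast h5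
      rw [ENNReal.coe_add] at this
      change (d1 : ℝ≥0∞) ≤ d + K.weight u w
      rwa [h2]

/-- The edges of a path are distinct members of the list of edges, so `K.length` rounds of
relaxation reach the end of every path. -/
theorem length_le_of_isPath {K : WGraph n} {u v : Fin n} {p : K.toGraph.Walk u v}
    (hp : p.IsPath) : p.length ≤ K.length := by
  have h := (hp.isTrail.edges_nodup).subperm (l₂ := K.map ends) fun q hq => by
    have := p.edges_subset_edgeSet hq
    rw [WGraph.toGraph, SimpleGraph.edgeSet_fromEdgeSet] at this
    exact this.1
  simpa using h.length_le

/-- Every label is an upper bound of a distance. Conversely, a walk is shortened to a path without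
increasing its length, as weights are nonnegative, and relaxation along the path produces a label at
most as large. No label at all means that there is no walk. -/
theorem shortest_eq (K : WGraph n) (x y : Fin n) : shortest K x y = K.dist x y := by
  unfold shortest readLabels
  set l := (labels K x K.length).flatMap fun p => if p.1 = y then [p.2] else [] with hl
  have hmem : ∀ d, d ∈ l ↔ (y, d) ∈ labels K x K.length := by
    intro d
    rw [hl, List.mem_flatMap]
    constructor
    · rintro ⟨⟨v, d'⟩, h1, h2⟩
      split_ifs at h2 with h
      · rw [List.mem_singleton] at h2
        subst h2
        simp only at h
        rwa [← h]
      · exact absurd h2 List.not_mem_nil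
    · intro h
      exact ⟨_, h, by simp⟩
  have hx : (x, 0) ∈ labels K x 0 := by simp [labels]
  have hwalk : ∀ p : K.toGraph.Walk x y, ∃ d ∈ l,
      (d : ℝ≥0∞) ≤ (p.darts.map fun a => K.weight a.fst a.snd).sum := by
    classical
    intro p
    obtain ⟨d, h1, h2⟩ := exists_label_of_walk p.bypass hx
    have hy : y ∈ x :: endpoints K := by
      cases p using SimpleGraph.Walk.concatRec with
      | Hnil => simp
      | Hconcat q h =>
        obtain ⟨e, he, h1, _⟩ := exists_weight h
        refine List.mem_cons_of_mem _ (List.mem_flatMap.2 ⟨e, he, ?_⟩)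
        rcases ends_eq.1 h1 with ⟨_, h⟩ | ⟨h, _⟩ <;> simp [h]
    obtain ⟨d', h3, h4⟩ := labels_mono hy h1 (s := K.length)
      (by rw [zero_add]; exact length_le_of_isPath p.bypass_isPath)
    refine ⟨d', (hmem d').2 h4, ?_⟩
    have h5 : (d' : ℝ≥0∞) ≤ d := by exact_mod_cast h3
    refine h5.trans (h2.trans ?_)
    rw [ENNReal.coe_zero, zero_add]
    exact (p.darts_bypass_sublist_darts.map _).sum_le_sum fun _ _ => zero_le
  by_cases hnil : l = []
  · rw [hnil, least_nil]
    refine Eq.symm (iInf_eq_top.2 fun p => ?_)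
    obtain ⟨d, h1, _⟩ := hwalk p
    rw [hnil] at h1
    exact absurd h1 List.not_mem_nil
  · obtain ⟨d, h1, h2, h3⟩ := least_spec l hnil
    rw [h2]
    simp only [List.head?_cons, Option.elim_some]
    refine le_antisymm (le_iInf fun p => ?_) (dist_le_of_mem_labels ((hmem d).1 h1))
    obtain ⟨d', h4, h5⟩ := hwalk p
    exact le_trans (by exact_mod_cast h3 d' h4) h5

/-- A vertex is relabelled once for each occurrence among the endpoints. Labels may thus be
repeated, but they do not multiply from round to round. -/
theorem length_labels (K : WGraph n) (x : Fin n) (r : ℕ) :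
    (labels K x r).length ≤ 2 * K.length + 1 := by
  cases r with
  | zero => simp [labels]
  | succ r =>
    rw [labels_succ, relax, List.length_flatMap]
    refine (List.sum_le_card_nsmul _ 1 ?_).trans (le_of_eq ?_)
    · intro m hm
      obtain ⟨v, _, rfl⟩ := List.mem_map.1 hm
      rw [relabel, List.length_map]
      exact length_least _
    · simp [endpoints, List.length_flatMap, mul_comm]

end DynDist

namespace DynDist

universe u

variable {ι : Type u} {w N : ι → ℕ} {x : ι → Val}

/-! ## Programs for grouping -/

/-- The recursion becomes an iteration in which each round splits all the current groups, so that it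
can be programmed as a loop. -/
theorem groups_eq_iterate {κ : Type*} (B : ℕ) (gs : List (List (ℕ × κ))) :
    gs.flatMap (groups B) = (fun gs => gs.flatMap splitGroup)^[B] gs := by
  induction B generalizing gs with
  | zero => simp [groups]
  | succ B ih => rw [Function.iterate_succ_apply, ← ih, List.flatMap_assoc]; rfl

/-- The groups after `j` rounds of splitting. -/
def rounds {κ : Type*} (g : List (ℕ × κ)) (j : ℕ) : List (List (ℕ × κ)) :=
  (fun gs => gs.flatMap splitGroup)^[j] [g]

theorem rounds_succ {κ : Type*} (g : List (ℕ × κ)) (j : ℕ) :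
    rounds g (j + 1) = (rounds g j).flatMap splitGroup := Function.iterate_succ_apply' _ _ _

theorem mem_splitGroup {κ : Type*} {g h : List (ℕ × κ)} :
    h ∈ splitGroup g ↔ (h = halve 0 g ∨ h = halve 1 g) ∧ h ≠ [] := by
  simp [splitGroup, List.mem_filter]

theorem length_halve {κ : Type*} (g : List (ℕ × κ)) :
    (halve 0 g).length + (halve 1 g).length = g.length := by
  induction g with
  | nil => rfl
  | cons p g ih =>
    unfold halve at *
    simp only [List.length_map, List.filter_cons, decide_eq_true_eq] at *
    rcases Nat.mod_two_eq_zero_or_one p.1 with h | h <;> simp [h] <;> omega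

/-- Nonempty groups and a constant total length make every round linear in the number of elements.
The keys never grow, so their bit lengths remain bounded. -/
theorem rounds_spec {κ : Type*} (g : List (ℕ × κ)) (hg : g ≠ []) (j : ℕ) :
    (∀ h ∈ rounds g j, h ≠ [] ∧ ∀ p ∈ h, ∃ p' ∈ g, p.1 ≤ p'.1) ∧
      ((rounds g j).map List.length).sum = g.length := by
  induction j with
  | zero => simp only [rounds, Function.iterate_zero, id, List.mem_singleton, forall_eq]; exact
      ⟨⟨hg, fun p hp => ⟨p, hp, le_rfl⟩⟩, by simp⟩
  | succ j ih =>
    rw [rounds_succ]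
    refine ⟨fun h hh => ?_, ?_⟩
    · obtain ⟨g', h1, h2⟩ := List.mem_flatMap.1 hh
      obtain ⟨h3, h4⟩ := mem_splitGroup.1 h2
      refine ⟨h4, fun p hp => ?_⟩
      obtain ⟨p', h5, h6⟩ : ∃ p' ∈ g', p.1 ≤ p'.1 := by
        rcases h3 with rfl | rfl
        · obtain ⟨p', a, _, b, _⟩ := mem_halve.1 hp
          exact ⟨p', a, by omega⟩
        · obtain ⟨p', a, _, b, _⟩ := mem_halve.1 hp
          exact ⟨p', a, by omega⟩
      obtain ⟨p'', h7, h8⟩ := (ih.1 g' h1).2 p' h5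
      exact ⟨p'', h7, h6.trans h8⟩
    · rw [← ih.2]
      generalize rounds g j = gs
      induction gs with
      | nil => rfl
      | cons a gs ih =>
        rw [List.flatMap_cons, List.map_append, List.sum_append, ih, List.map_cons, List.sum_cons,
          ← length_halve a]
        congr 1
        unfold splitGroup
        by_cases h0 : halve 0 a = [] <;> by_cases h1 : halve 1 a = [] <;> simp [h0, h1]

/-- Without empty groups the constant overhead per group at most doubles the total. -/
theorem sum_length_add_one {κ : Type*} (gs : List (List κ)) (h : ∀ g ∈ gs, g ≠ []) :
    (gs.map fun g => g.length + 1).sum ≤ 2 * (gs.map List.length).sum := by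
  induction gs with
  | nil => simp
  | cons g gs ih =>
    have h1 := ih fun g hg => h g (List.mem_cons_of_mem _ hg)
    have h2 := List.length_pos_iff.2 (h g (by simp))
    rw [List.map_cons, List.map_cons, List.sum_cons, List.sum_cons]
    omega

def encKeyed {κ : Type*} (e : κ → Val) (p : ℕ × κ) : Val := .pair (.nat p.1) (e p.2)

namespace Comp

section Groups

variable {κ : ι → Type} {e : ∀ i, κ i → Val} {g : ∀ i, List (ℕ × κ i)} {b : ι → ℕ}

theorem halve (r : ℕ) (hb : Bdd w (fun _ => 0) b) (hk : ∀ i, ∀ p ∈ g i, p.1.size ≤ b i)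
    (hg : Comp w N x fun i => encList (encKeyed (e i)) (g i)) (hN : Bdd w N fun i => (g i).length) :
    Comp w N x fun i => encList (encKeyed (e i)) (halve r (g i)) := by
  refine map (fun i p => (p.1 / 2, p.2)) (filter (fun i p => p.1 % 2 = r) hg hN ?_)
    (hN.of_le fun i => List.length_filter_le _ _) ?_
  · have hb' : Bdd (ι := Σ i, {c // c ∈ g i}) (fun p => w p.1) (fun _ => 0) fun p => p.2.1.1.size :=
      (hb.comap Sigma.fst).of_le fun p => hk p.1 p.2.1 p.2.2
    have h1 : Comp (ι := Σ i, {c // c ∈ g i}) (fun p => w p.1) (fun _ => 0)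
        (fun p => .pair (x p.1) (encKeyed (e p.1) p.2.1)) fun p => .nat p.2.1.1 := fst (snd id)
    -- The parity is computed as `k - 2 * (k / 2)`.
    have hdiv := natOp .div h1 (const 2) hb' (Bdd.size_const 2)
    have hb2 : Bdd (ι := Σ i, {c // c ∈ g i}) (fun p => w p.1) (fun _ => 0)
        fun p => (NatOp.div.eval p.2.1.1 2).size :=
      hb'.size_le fun p => Nat.div_le_self _ _
    have hmul := natOp .mul (const 2) hdiv (Bdd.size_const 2) hb2
    have hb3 : Bdd (ι := Σ i, {c // c ∈ g i}) (fun p => w p.1) (fun _ => 0)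
        fun p => (NatOp.mul.eval 2 (NatOp.div.eval p.2.1.1 2)).size :=
      hb'.size_le fun p => Nat.mul_div_le _ _
    have hsub := natOp .sub h1 hmul hb' hb3
    have hb4 : Bdd (ι := Σ i, {c // c ∈ g i}) (fun p => w p.1) (fun _ => 0)
        fun p => (NatOp.sub.eval p.2.1.1 (NatOp.mul.eval 2 (NatOp.div.eval p.2.1.1 2))).size :=
      hb'.size_le fun p => Nat.sub_le _ _
    refine (Test.eq hsub (const r) hb4 (Bdd.size_const r)).congr fun p => ?_
    simp only [NatOp.eval, decide_eq_true_eq]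
    omega
  · have hb' : Bdd (ι := Σ i, {c // c ∈ (g i).filter fun p => p.1 % 2 = r}) (fun p => w p.1)
        (fun _ => 0) fun p => p.2.1.1.size :=
      (hb.comap Sigma.fst).of_le fun p => hk p.1 p.2.1 (List.mem_of_mem_filter p.2.2)
    exact (natOp .div (fst (snd id)) (const 2) hb' (Bdd.size_const 2)).pair (snd (snd id))

theorem splitGroup (hb : Bdd w (fun _ => 0) b) (hk : ∀ i, ∀ p ∈ g i, p.1.size ≤ b i)
    (hg : Comp w N x fun i => encList (encKeyed (e i)) (g i)) (hN : Bdd w N fun i => (g i).length) :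
    Comp w N x fun i => encList (encList (encKeyed (e i))) (splitGroup (g i)) := by
  refine filter (κ := fun i => List (ℕ × κ i)) (L := fun i => [DynDist.halve 0 (g i), DynDist.halve 1 (g i)])
    (fun i h => !h.isEmpty)
    (cons (halve 0 hb hk hg hN) (cons (halve 1 hb hk hg hN) nil)) (Bdd.const 2) ?_
  refine (Test.ne_nil (snd id)).congr fun p => ?_
  simp

/-- The number of rounds is given in unary by the list `U`, since loops are folds over lists. -/
theorem rounds (hb : Bdd w (fun _ => 0) b) (hk : ∀ i, ∀ p ∈ g i, p.1.size ≤ b i)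
    (hne : ∀ i, g i ≠ [])
    (hg : Comp w N x fun i => encList (encKeyed (e i)) (g i)) (hN : Bdd w N fun i => (g i).length)
    {U : ι → List ℕ} (hU : Comp w N x fun i => encList Val.nat (U i))
    (hUb : Bdd w (fun _ => 0) fun i => (U i).length) :
    Comp w N x fun i => encList (encList (encKeyed (e i))) (rounds (g i) (U i).length) := by
  refine fold (S := fun i j => encList (encList (encKeyed (e i))) (DynDist.rounds (g i) j))
    (M := fun i _ => (g i).length) (hg.pair (const 0)) hU ?_ ?_
  · refine (hUb.mul (hN.add (Bdd.const 1))).of_le fun i => ?_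
    rw [Finset.sum_const, Finset.card_range, smul_eq_mul]
  · let I := Σ i, {j // j < (U i).length}
    have hs := fun p : I => rounds_spec (g p.1) (hne p.1) p.2.1
    refine of_eq (flatMap (ι := I) (κ := fun p => List (ℕ × κ p.1)) (κ' := fun p => List (ℕ × κ p.1))
      (L := fun p : I => DynDist.rounds (g p.1) p.2.1)
      (e := fun p => encList (encKeyed (e p.1))) (e' := fun p => encList (encKeyed (e p.1)))
      (fun _ => DynDist.splitGroup) (fun _ h => h.length) (fst (snd id)) ?_ ?_ ?_) fun p => by
        rw [rounds_succ]
    · refine ((Bdd.const 2).mul Bdd.self).of_le fun p => ?_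
      rw [← (hs p).2]
      exact sum_length_add_one _ fun h hh => ((hs p).1 h hh).1
    · exact (Bdd.const 2).of_le fun p => List.length_filter_le _ _
    · let J := Σ p : I, {c // c ∈ DynDist.rounds (g p.1) p.2.1}
      refine splitGroup (κ := fun p : J => κ p.1.1)
        (b := fun p => b p.1.1) (hb.comap fun p : J => p.1.1) (fun p q hq => ?_) (snd id) Bdd.self
      obtain ⟨p', h1, h2⟩ := ((hs p.1).1 _ p.2.2).2 q hq
      exact (Nat.size_le_size h2).trans (hk p.1.1 p' h1)

theorem grouped (hb : Bdd w (fun _ => 0) b) (hk : ∀ i, ∀ p ∈ g i, p.1.size ≤ b i)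
    (hg : Comp w N x fun i => encList (encKeyed (e i)) (g i)) (hN : Bdd w N fun i => (g i).length)
    {U : ι → List ℕ} (hU : Comp w N x fun i => encList Val.nat (U i))
    (hUb : Bdd w (fun _ => 0) fun i => (U i).length) :
    Comp w N x fun i => encList (encList (e i)) (grouped (U i).length (g i)) := by
  refine (Test.ne_nil hg).cond ?_ ?_
  · let I := {i // g i ≠ []}
    have hs := fun p : I => rounds_spec (g p.1) p.2 (U p.1).length
    have h1 := rounds (ι := I) (κ := fun i => κ i) (g := fun i => g i) (hb.comap Subtype.val)
      (fun i => hk i) (fun i => i.2) (hg.comap Subtype.val) (hN.comap Subtype.val)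
      (U := fun i => U i) (hU.comap Subtype.val) (hUb.comap Subtype.val)
    have h2 := flatMap (ι := I) (κ := fun p => List (ℕ × κ p.1)) (κ' := fun p => List (κ p.1))
      (e' := fun p => encList (e p.1))
      (fun _ h => [h.map Prod.snd]) (fun _ h => h.length) h1 ?_ (Bdd.const 1) ?_
    · refine h2.of_eq fun i => ?_
      rw [DynDist.grouped, if_neg (by simpa using i.2), ← List.map_eq_flatMap, DynDist.rounds,
        ← groups_eq_iterate, List.flatMap_singleton]
    · refine ((Bdd.const 2).mul (hN.comap Subtype.val)).of_le fun p => ?_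
      rw [← (hs p).2]
      exact sum_length_add_one _ fun h hh => ((hs p).1 h hh).1
    · refine pair ?_ (const 0)
      exact map (ι := Σ p : I, {c // c ∈ DynDist.rounds (g p.1) (U p.1).length})
        (κ := fun p => ℕ × κ p.1.1) (κ' := fun p => κ p.1.1) (fun _ => Prod.snd)
        (e := fun p => encKeyed (e p.1.1)) (snd id) Bdd.self (snd (snd id))
  · refine (const 0).of_eq fun i => ?_
    rw [DynDist.grouped, if_pos (by simpa using i.2)]
    rfl

end Groups

end Comp

end DynDist

namespace DynDist

universe u

variable {ι : Type u} {w N : ι → ℕ} {x : ι → Val}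

/-! ## Programs for lists, vertices and keys -/

theorem sum_length_grouped {κ : Type*} (B : ℕ) (g : List (ℕ × κ)) :
    ((grouped B g).map fun h => h.length + 1).sum ≤ 2 * g.length := by
  unfold grouped
  split_ifs with h
  · simp
  · have h1 := rounds_spec g (by simpa using h) B
    rw [rounds, ← groups_eq_iterate, List.flatMap_singleton] at h1
    rw [List.map_map, ← h1.2]
    refine le_trans (le_of_eq ?_) (sum_length_add_one _ fun h hh => (h1.1 h hh).1)
    congr 1
    exact List.map_congr_left fun h _ => by simp

theorem mem_groups {κ : Type*} (B : ℕ) : ∀ (g : List (ℕ × κ)), ∀ h ∈ groups B g, ∀ p ∈ h,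
    ∃ p' ∈ g, p'.2 = p.2 := by
  induction B with
  | zero =>
    intro g h hh p hp
    rw [groups, List.mem_singleton] at hh
    exact ⟨p, hh ▸ hp, rfl⟩
  | succ B ih =>
    intro g h hh p hp
    obtain ⟨g', h1, h2⟩ := List.mem_flatMap.1 hh
    obtain ⟨p', h3, h4⟩ := ih g' h h2 p hp
    rcases (mem_splitGroup.1 h1).1 with rfl | rfl
    · obtain ⟨p'', h5, _, _, h6⟩ := mem_halve.1 h3
      exact ⟨p'', h5, h6.trans h4⟩
    · obtain ⟨p'', h5, _, _, h6⟩ := mem_halve.1 h3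
      exact ⟨p'', h5, h6.trans h4⟩

theorem mem_of_mem_grouped {κ : Type*} {B : ℕ} {g : List (ℕ × κ)} {h : List κ}
    (hh : h ∈ grouped B g) {c : κ} (hc : c ∈ h) : ∃ p ∈ g, p.2 = c := by
  unfold grouped at hh
  obtain ⟨h', h1, rfl⟩ := List.mem_map.1 hh
  obtain ⟨p, hp, rfl⟩ := List.mem_map.1 hc
  split_ifs at h1
  · exact absurd h1 List.not_mem_nil
  · exact mem_groups B g h' h1 p hp

theorem size_le_lg (n : ℕ) : n.size ≤ lg n := Nat.size_le.2 (lt_two_pow_lg n)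

theorem Bdd.size_fin {n : ι → ℕ} (hn : Bdd w (fun _ => 0) fun i => lg (n i))
    (v : ∀ i, Fin (n i)) : Bdd w N fun i => (v i : ℕ).size :=
  (Bdd.of_zero hn).of_le fun i => (Nat.size_le_size (v i).2.le).trans (size_le_lg _)

theorem size_pairKey {n : ℕ} (u v : Fin n) : (pairKey u v).size ≤ keyBits n :=
  Nat.size_le.2 (pairKey_lt_pow u v)

theorem Bdd.keyBits {n : ι → ℕ} (hn : Bdd w (fun _ => 0) fun i => lg (n i)) :
    Bdd w (fun _ => 0) fun i => keyBits (n i) := hn.add hn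

theorem cutStep_of_lt {κ : Type*} {h : ℕ} {c : κ} {cs : List (List κ)} (hne : cs ≠ [])
    (hlt : (cs.headD []).length < h) : cutStep h c cs = (c :: cs.head hne) :: cs.tail := by
  cases cs with
  | nil => exact absurd rfl hne
  | cons d cs => exact if_pos hlt

theorem cutStep_of_not_lt {κ : Type*} {h : ℕ} {c : κ} {cs : List (List κ)} (hne : cs ≠ [])
    (hlt : ¬ (cs.headD []).length < h) : cutStep h c cs = [c] :: cs := by
  cases cs with
  | nil => exact absurd rfl hne
  | cons d cs => exact if_neg hlt

namespace Comp

section Lists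

variable {κ : ι → Type} {e : ∀ i, κ i → Val} {L : ∀ i, List (κ i)}

theorem foldl {σ : ι → Type} {es : ∀ i, σ i → Val} (P : ∀ i, σ i → Prop)
    (f : ∀ i, σ i → κ i → σ i) (s : ∀ i, σ i) (hP : ∀ i, P i (s i))
    (hf : ∀ i a c, P i a → P i (f i a c)) (hs : Comp w N x fun i => es i (s i))
    (hl : Comp w N x fun i => encList (e i) (L i)) (hb : Bdd w N fun i => (L i).length)
    (h : Comp (ι := Σ i, {a : σ i // P i a} × {c // c ∈ L i}) (fun p => w p.1) (fun _ => 0)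
      (fun p => .pair (x p.1) (.pair (es p.1 p.2.1) (e p.1 p.2.2)))
      fun p => es p.1 (f p.1 p.2.1 p.2.2)) :
    Comp w N x fun i => es i ((L i).foldl (f i) (s i)) := by
  have hPj : ∀ i j, P i (((L i).take j).foldl (f i) (s i)) := by
    intro i j
    generalize (L i).take j = l
    induction l using List.reverseRecOn with
    | nil => exact hP i
    | append_singleton l c ih => rw [List.foldl_append]; exact hf _ _ _ ih
  have := fold (S := fun i j => es i (((L i).take j).foldl (f i) (s i))) (M := fun _ _ => 0)
    (by simpa using hs) hl (by simpa using hb)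
    ((h.comap fun p : (Σ i, {j // j < (L i).length}) =>
      (⟨p.1, ⟨_, hPj p.1 p.2.1⟩, ⟨(L p.1)[p.2.1]'p.2.2, List.getElem_mem _⟩⟩ :
        Σ i, {a : σ i // P i a} × {c // c ∈ L i})).of_eq fun p => by
      rw [← List.take_append_getElem p.2.2, List.foldl_append]; rfl)
  simpa using this

theorem take_one (hl : Comp w N x fun i => encList (e i) (L i)) :
    Comp w N x fun i => encList (e i) ((L i).take 1) := by
  refine (Test.ne_nil hl).cond ?_ ?_
  · have h : ∀ i : {i // L i ≠ []}, L i = (L i).head i.2 :: (L i).tail := fun i =>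
      (List.cons_head_tail i.2).symm
    have h1 := (head h (hl.comap Subtype.val)).pair (const 0)
    refine h1.of_eq fun i => ?_
    conv_rhs => rw [h i, List.take_succ_cons, List.take_zero]
    rfl
  · refine (const 0).of_eq fun i => ?_
    rw [not_not.1 i.2]
    rfl

/-- The empty list, or the list of one element. -/
theorem optional {p : ι → Prop} [∀ i, Decidable (p i)] {c : ∀ i, κ i} (hp : Test w N x p)
    (hc : Comp w N x fun i => e i (c i)) :
    Comp w N x fun i => encList (e i) (if p i then [c i] else []) :=
  (hp.ite (hc.pair (const 0)) (const 0)).of_eq fun i => by split_ifs <;> rfl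

theorem cut {h : ι → ℕ} (hh : ∀ i, 0 < h i) (hhb : Bdd w (fun _ => 0) fun i => (h i).size)
    (hx : Comp w N x fun i => .pair (.nat (h i)) (encList (e i) (L i)))
    (hb : Bdd w N fun i => (L i).length) :
    Comp w N x fun i => encList (encList (e i)) (cut (h i) (L i)) := by
  refine hx.trans ?_
  have h1 := foldl (w := w) (N := N) (x := fun i => .pair (.nat (h i)) (encList (e i) (L i)))
    (L := fun i => (L i).reverse) (σ := fun i => List (List (κ i))) (e := e)
    -- The length of the first block is carried along, since recounting it for each element would
    -- cost a factor `h`. The bound by `h` on all blocks limits the size of this number.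
    (es := fun i cs => .pair (.nat (cs.headD []).length) (encList (encList (e i)) cs))
    (fun i cs => ∀ c ∈ cs, c.length ≤ h i) (fun i cs c => cutStep (h i) c cs) (fun _ => [])
    (by simp) (fun i cs c hcs => ?_) (pair (const 0) (const 0)) (reverse (snd id) hb)
    (by simpa using hb) ?_
  · refine (snd h1).of_eq fun i => ?_
    rw [List.foldl_reverse]
    rfl
  · cases cs with
    | nil => simpa [cutStep] using Nat.succ_le_of_lt (hh i)
    | cons d cs =>
      rw [cutStep]
      have h2 := fun c hc => hcs c (List.mem_cons_of_mem d hc)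
      split_ifs with hlt
      · intro c' hc'
        rcases List.mem_cons.1 hc' with rfl | hc'
        · exact hlt
        · exact h2 c' hc'
      · intro c' hc'
        rcases List.mem_cons.1 hc' with rfl | hc'
        · exact hh i
        · exact hcs c' hc'
  · let I := Σ i, {cs : List (List (κ i)) // ∀ c ∈ cs, c.length ≤ h i} × {c // c ∈ (L i).reverse}
    let X : I → Val := fun p => .pair (.pair (.nat (h p.1)) (encList (e p.1) (L p.1)))
      (.pair (.pair (.nat (p.2.1.1.headD []).length) (encList (encList (e p.1)) p.2.1.1))
        (e p.1 p.2.2.1))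
    have hcs : Comp (ι := I) (fun p => w p.1) (fun _ => 0) X
        fun p => encList (encList (e p.1)) p.2.1.1 := snd (fst (snd id))
    have hc : Comp (ι := I) (fun p => w p.1) (fun _ => 0) X fun p => e p.1 p.2.2.1 := snd (snd id)
    have hlen : Comp (ι := I) (fun p => w p.1) (fun _ => 0) X
        fun p => .nat (p.2.1.1.headD []).length := fst (fst (snd id))
    have hhc : Comp (ι := I) (fun p => w p.1) (fun _ => 0) X fun p => .nat (h p.1) := fst (fst id)
    have hhb' : Bdd (ι := I) (fun p => w p.1) (fun _ => 0) fun p => (h p.1).size :=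
      hhb.comap Sigma.fst
    have hlb : Bdd (ι := I) (fun p => w p.1) (fun _ => 0)
        fun p => ((p.2.1.1.headD []).length).size := hhb'.size_le fun p => by
      rcases hp : p.2.1.1 with _ | ⟨c, cs⟩
      · simp
      · exact p.2.1.2 c (by simp [hp])
    have hsingle : Comp (ι := I) (fun p => w p.1) (fun _ => 0) X
        fun p => encList (e p.1) [p.2.2.1] := pair hc (const 0)
    refine (Test.ne_nil hcs).cond ?_ ?_
    · let I' := {p : I // p.2.1.1 ≠ []}
      have hcons : ∀ p : I', p.1.2.1.1 = p.1.2.1.1.head p.2 :: p.1.2.1.1.tail := fun p =>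
        (List.cons_head_tail p.2).symm
      have hlen2 : ∀ p : I', p.1.2.1.1.headD [] = p.1.2.1.1.head p.2 := fun p => by
        rw [List.headD_eq_head?_getD, List.head?_eq_some_head p.2]; rfl
      have hcs' := hcs.comap (Subtype.val : I' → I)
      have hnew := (hc.comap (Subtype.val : I' → I)).pair (head hcons hcs')
      have hadd := natOp .add (hlen.comap (Subtype.val : I' → I)) (const 1)
        (hlb.comap Subtype.val) (Bdd.size_const 1)
      refine Test.cond ((Test.lt hlen hhc hlb hhb').comap (Subtype.val : I' → I)) ?_ ?_
      · refine ((hadd.pair (hnew.pair (tail hcons hcs'))).comap Subtype.val).of_eq fun p => ?_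
        rw [cutStep_of_lt p.1.2 p.2, hlen2 p.1]
        rfl
      · refine (((const 1).pair ((hsingle.comap Subtype.val).pair hcs')).comap
          Subtype.val).of_eq fun p => ?_
        rw [cutStep_of_not_lt p.1.2 p.2]
        rfl
    · refine (((const 1).pair (hsingle.pair (const 0))).comap Subtype.val).of_eq fun p => ?_
      rw [not_not.1 p.2]
      rfl

end Lists

/-- A list of length `lg n`. -/
theorem unary_lg {n : ι → ℕ} (h0 : ∀ i, 0 < n i) (hn : Bdd w (fun _ => 0) fun i => lg (n i))
    (hx : Comp w N x fun i => .nat (n i)) :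
    Comp w N x fun i => encList Val.nat (List.replicate (lg (n i)) 0) := by
  have h1 := loop (w := w) (N := N) (fun i => lg (n i))
    (y := fun i => encList Val.nat (List.replicate (lg (n i)) 0))
    (fun i j => .pair (.nat (n i / 2 ^ j)) (encList Val.nat (List.replicate j 0)))
    (fun _ _ => 0) ?_ ?_
  · refine ((hx.pair (const 0)).of_eq fun i => ?_).trans h1
    rw [pow_zero, Nat.div_one]
    rfl
  · exact (Bdd.of_zero (hn.add (Bdd.const 1))).of_le fun i => by simp
  · let I := Σ i, {j // j ≤ lg (n i)}
    have hb : Bdd (ι := I) (fun p => w p.1) (fun _ => 0) fun p => (n p.1 / 2 ^ p.2.1).size :=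
      (hn.comap Sigma.fst).of_le fun p =>
        (Nat.size_le_size (Nat.div_le_self _ _)).trans (size_le_lg _)
    let X : I → Val := fun p =>
      .pair (.nat (n p.1 / 2 ^ p.2.1)) (encList Val.nat (List.replicate p.2.1 0))
    have hf : Comp (ι := I) (fun p => w p.1) (fun _ => 0) X fun p => .nat (n p.1 / 2 ^ p.2.1) :=
      fst id
    have hs : Comp (ι := I) (fun p => w p.1) (fun _ => 0) X
      fun p => encList Val.nat (List.replicate p.2.1 0) := snd id
    -- The halving goes on as long as the quotient is positive, that is for `j ≤ Nat.log 2 n`, which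
    -- means `j < lg n`.
    refine ((Test.le (const 1) hf (Bdd.size_const 1) hb).congr (q := fun p : I => p.2.1 < lg (n p.1))
      fun p => ?_).cond ?_ ?_
    · rw [Nat.one_le_div_iff (by positivity)]
      exact (Nat.le_log_iff_pow_le (by omega) (h0 p.1).ne').symm.trans Nat.lt_succ_iff.symm
    · refine ((pair (const 1) (pair (natOp .div hf (const 2) hb (Bdd.size_const 2))
        (pair (const 0) hs))).comap Subtype.val).of_eq fun p => ?_
      rw [if_pos p.2, pow_succ, ← Nat.div_div_eq_div_mul]
      rfl
    · refine ((pair (const 0) hs).comap Subtype.val).of_eq fun p => ?_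
      have : p.1.2.1 = lg (n p.1.1) := le_antisymm p.1.2.2 (not_lt.1 p.2)
      rw [if_neg p.2, this]

section Vertices

variable {n : ι → ℕ}

theorem pairKey (hn : Bdd w (fun _ => 0) fun i => lg (n i)) {a b : ∀ i, Fin (n i)}
    (ha : Comp w N x fun i => encVertex (a i))
    (hb : Comp w N x fun i => encVertex (b i)) (hx : Comp w N x fun i => .nat (n i)) :
    Comp w N x fun i => .nat (pairKey (a i) (b i)) := by
  have sa := Bdd.size_fin (N := fun _ => 0) hn a
  have sb := Bdd.size_fin (N := fun _ => 0) hn b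
  have sn : Bdd w (fun _ => 0) fun i => (n i).size := hn.of_le fun i => size_le_lg _
  have ht := Test.le ha hb sa sb
  have h1 : Comp w N x fun i => .nat (if (a i : ℕ) ≤ b i then (a i : ℕ) else b i) :=
    (ht.ite ha hb).of_eq fun i => by split_ifs <;> rfl
  have h2 : Comp w N x fun i => .nat (if (a i : ℕ) ≤ b i then (b i : ℕ) else a i) :=
    (ht.ite hb ha).of_eq fun i => by split_ifs <;> rfl
  have s1 : Bdd w (fun _ => 0) fun i => (if (a i : ℕ) ≤ b i then (a i : ℕ) else b i).size :=
    (sa.add sb).of_le fun i => by split_ifs <;> omega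
  have s2 : Bdd w (fun _ => 0) fun i => (if (a i : ℕ) ≤ b i then (b i : ℕ) else a i).size :=
    (sa.add sb).of_le fun i => by split_ifs <;> omega
  exact natOp .add (natOp .mul h1 hx s1 sn) h2 (Bdd.size_mul s1 sn) s2

theorem vertex_eq (hn : Bdd w (fun _ => 0) fun i => lg (n i)) {a b : ∀ i, Fin (n i)}
    (ha : Comp w N x fun i => encVertex (a i))
    (hb : Comp w N x fun i => encVertex (b i)) : Test w N x fun i => a i = b i :=
  (Test.eq ha hb (Bdd.size_fin hn a) (Bdd.size_fin hn b)).congr fun _ => Fin.ext_iff.symm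

end Vertices

end Comp

end DynDist

namespace DynDist

universe u

variable {ι : Type u} {w N : ι → ℕ} {x : ι → Val} {n : ι → ℕ}

/-! ## Programs for graphs and operations -/

def Op.kind {n : ℕ} : Op n → ℕ
  | .insert _ _ _ => 0
  | .delete _ _ => 1
  | .query _ _ => 2

/-- The operation as an edge, of length `0` unless it is an insertion. -/
def Op.edge {n : ℕ} : Op n → Edge n
  | .insert u v r => (u, v, r)
  | .delete u v => (u, v, 0)
  | .query u v => (u, v, 0)

theorem encOp_eq {n : ℕ} (o : Op n) : encOp o = .pair (.nat o.kind)
    (if o.kind = 0 then encEdge o.edge else .pair (encVertex o.src) (encVertex o.tgt)) := by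
  cases o <;> rfl

theorem opItem_eq {n : ℕ} (o : Op n) :
    opItem o = if o.kind ≤ 1 then [(pairKey o.src o.tgt, o.kind, o.edge)] else [] := by
  cases o <;> rfl

theorem opMark_eq {n : ℕ} (o : Op n) :
    opMark o = if o.kind = 1 then [(pairKey o.src o.tgt, 2, o.edge)] else [] := by
  cases o <;> rfl

theorem Op.kind_le {n : ℕ} (o : Op n) : o.kind ≤ 2 := by cases o <;> simp [Op.kind]

def encItem {n : ℕ} (it : Item n) : Val := .pair (.nat it.1) (encEdge it.2)

theorem kind_le_of_mem_items {n : ℕ} {A : WGraph n} {X Y : List (Op n)} {p : ℕ × Item n}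
    (h : p ∈ items A X Y) : p.2.1 ≤ 2 := by
  unfold items at h
  simp only [List.mem_append, List.mem_map, List.mem_flatMap] at h
  rcases h with ⟨e, _, rfl⟩ | ⟨o, _, h⟩ | ⟨o, _, h⟩
  · exact Nat.zero_le 2
  · rw [opItem_eq] at h
    split_ifs at h
    · rw [List.mem_singleton.1 h]; exact o.kind_le
    · exact absurd h List.not_mem_nil
  · rw [opMark_eq] at h
    split_ifs at h
    · rw [List.mem_singleton.1 h]
    · exact absurd h List.not_mem_nil

theorem length_items_le {n : ℕ} (A : WGraph n) (X Y : List (Op n)) :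
    (items A X Y).length ≤ A.length + X.length + Y.length := by
  have h1 : (X.flatMap opItem).length ≤ X.length := by
    rw [List.length_flatMap]
    refine (List.sum_le_card_nsmul _ 1 fun m hm => ?_).trans (by simp)
    obtain ⟨o, _, rfl⟩ := List.mem_map.1 hm
    cases o <;> simp [opItem]
  have h2 : (Y.flatMap opMark).length ≤ Y.length := by
    rw [List.length_flatMap]
    refine (List.sum_le_card_nsmul _ 1 fun m hm => ?_).trans (by simp)
    obtain ⟨o, _, rfl⟩ := List.mem_map.1 hm
    cases o <;> simp [opMark]
  unfold items
  rw [List.length_append, List.length_append, List.length_map]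
  omega

theorem Bdd.size_kind (o : ∀ i, Op (n i)) : Bdd w N fun i => (o i).kind.size :=
  (Bdd.size_const 2).of_le fun i => Nat.size_le_size (o i).kind_le

namespace Comp

theorem op_kind {o : ∀ i, Op (n i)} (ho : Comp w N x fun i => encOp (o i)) :
    Comp w N x fun i => .nat (o i).kind :=
  fst (ho.of_eq fun i => encOp_eq (o i))

theorem op_kind_eq {o : ∀ i, Op (n i)} (ho : Comp w N x fun i => encOp (o i)) (k : ℕ) :
    Test w N x fun i => (o i).kind = k :=
  Test.eq (op_kind ho) (const k) (Bdd.size_kind o) (Bdd.size_const k)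

theorem op_insert {o : ∀ i, Op (n i)} (ho : Comp w N x fun i => encOp (o i))
    (h : ∀ i, (o i).kind = 0) : Comp w N x fun i => encEdge (o i).edge :=
  (snd (ho.of_eq fun i => encOp_eq (o i))).of_eq fun i => if_pos (h i)

theorem op_other {o : ∀ i, Op (n i)} (ho : Comp w N x fun i => encOp (o i))
    (h : ∀ i, ¬ (o i).kind = 0) :
    Comp w N x fun i => .pair (encVertex (o i).src) (encVertex (o i).tgt) :=
  (snd (ho.of_eq fun i => encOp_eq (o i))).of_eq fun i => if_neg (h i)

theorem op_src {o : ∀ i, Op (n i)} (ho : Comp w N x fun i => encOp (o i)) :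
    Comp w N x fun i => encVertex (o i).src := by
  refine (op_kind_eq ho 0).cond ?_ ?_
  · refine (fst (op_insert (ho.comap Subtype.val) fun i => i.2)).of_eq fun i => ?_
    cases o i <;> rfl
  · exact fst (op_other (ho.comap Subtype.val) fun i => i.2)

theorem op_tgt {o : ∀ i, Op (n i)} (ho : Comp w N x fun i => encOp (o i)) :
    Comp w N x fun i => encVertex (o i).tgt := by
  refine (op_kind_eq ho 0).cond ?_ ?_
  · refine (fst (snd (op_insert (ho.comap Subtype.val) fun i => i.2))).of_eq fun i => ?_
    cases o i <;> rfl
  · exact snd (op_other (ho.comap Subtype.val) fun i => i.2)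

theorem op_edge {o : ∀ i, Op (n i)} (ho : Comp w N x fun i => encOp (o i)) :
    Comp w N x fun i => encEdge (o i).edge := by
  refine (op_kind_eq ho 0).cond (op_insert (ho.comap Subtype.val) fun i => i.2) ?_
  have h := op_other (ho.comap (Subtype.val : {i // ¬ (o i).kind = 0} → ι)) fun i => i.2
  refine ((fst h).pair ((snd h).pair realZero)).of_eq fun i => ?_
  have := i.2
  revert this
  cases o i <;> intro h
  · exact absurd rfl h
  · rfl
  · rfl

/-! ### Simplification of graphs, distinct vertices -/

theorem unary_keyBits (h0 : ∀ i, 0 < n i) (hn : Bdd w (fun _ => 0) fun i => lg (n i))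
    (hx : Comp w N x fun i => .nat (n i)) :
    Comp w N x fun i => encList Val.nat
      (List.replicate (lg (n i)) 0 ++ List.replicate (lg (n i)) 0) :=
  append (unary_lg h0 hn hx) (unary_lg h0 hn hx) ((Bdd.of_zero hn).of_le fun i => by simp)

theorem groupByEdge {κ : ι → Type} {e : ∀ i, κ i → Val} {g : ∀ i, List (ℕ × κ i)}
    (h0 : ∀ i, 0 < n i) (hn : Bdd w (fun _ => 0) fun i => lg (n i))
    (hk : ∀ i, ∀ p ∈ g i, ∃ u v : Fin (n i), p.1 = DynDist.pairKey u v)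
    (hx : Comp w N x fun i => .nat (n i))
    (hg : Comp w N x fun i => encList (encKeyed (e i)) (g i)) (hN : Bdd w N fun i => (g i).length) :
    Comp w N x fun i => encList (encList (e i)) (DynDist.grouped (keyBits (n i)) (g i)) := by
  refine (grouped (b := fun i => keyBits (n i)) (Bdd.keyBits hn) (fun i p hp => ?_) hg hN
    (unary_keyBits h0 hn hx) ((Bdd.keyBits hn).of_le fun i => ?_)).of_eq fun i => ?_
  · obtain ⟨u, v, h⟩ := hk i p hp
    rw [h]; exact size_pairKey u v
  · simp [keyBits]
  · simp [keyBits]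

theorem lightest {g : ∀ i, List (Edge (n i))} (hg : Comp w N x fun i => encList encEdge (g i))
    (hN : Bdd w N fun i => (g i).length) :
    Comp w N x fun i => encList encEdge (lightest (g i)) := by
  refine foldl (κ := fun i => Edge (n i)) (e := fun _ => encEdge) (σ := fun i => List (Edge (n i)))
    (es := fun _ => encList encEdge) (fun _ _ => True) _ _ (fun _ => trivial)
    (fun _ _ _ _ => trivial) (const 0) hg hN ?_
  let I := Σ i, {a : List (Edge (n i)) // True} × {c // c ∈ g i}
  let X : I → Val := fun p => .pair (x p.1) (.pair (encList encEdge p.2.1.1) (encEdge p.2.2.1))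
  have ha : Comp (ι := I) (fun p => w p.1) (fun _ => 0) X fun p => encList encEdge p.2.1.1 :=
    fst (snd id)
  have he : Comp (ι := I) (fun p => w p.1) (fun _ => 0) X fun p => encEdge p.2.2.1 := snd (snd id)
  have he1 : Comp (ι := I) (fun p => w p.1) (fun _ => 0) X fun p => encList encEdge [p.2.2.1] :=
    he.pair (const 0)
  refine (Test.ne_nil (e := fun _ => encEdge) ha).cond ?_ ?_
  · let I' := {p : I // p.2.1.1 ≠ []}
    have hcons : ∀ p : I', p.1.2.1.1 = p.1.2.1.1.head p.2 :: p.1.2.1.1.tail := fun p =>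
      (List.cons_head_tail p.2).symm
    have hh := head (e := fun _ => encEdge) hcons (ha.comap (Subtype.val : I' → I))
    have ht : Test (ι := I') (fun p => w p.1.1) (fun _ => 0) (fun p => X p.1)
        fun p => (p.1.2.1.1.head p.2).2.2 ≤ p.1.2.2.1.2.2 :=
      (Test.realLe (snd (snd hh)) (snd (snd (he.comap Subtype.val)))).congr fun p => NNReal.coe_le_coe
    classical
    refine (ht.ite (ha.comap Subtype.val) (he1.comap Subtype.val)).of_eq fun p => ?_
    rw [List.head?_eq_some_head p.2, Option.elim_some]
    split_ifs <;> rfl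
  · refine (he1.comap Subtype.val).of_eq fun p => ?_
    rw [not_not.1 p.2]
    rfl

theorem simplify {G : ∀ i, WGraph (n i)}
    (h0 : ∀ i, 0 < n i) (hn : Bdd w (fun _ => 0) fun i => lg (n i))
    (hx : Comp w N x fun i => .pair (.nat (n i)) (encGraph (G i)))
    (hN : Bdd w N fun i => (G i).length) :
    Comp w N x fun i => encGraph (simplify (G i)) := by
  refine hx.trans ?_
  have hf : Comp w N (fun i => .pair (.nat (n i)) (encGraph (G i)))
      fun i => encList encEdge ((G i).filter fun e => e.1 ≠ e.2.1) := by
    refine filter (κ := fun i => Edge (n i)) (fun i e => e.1 ≠ e.2.1) (snd id) hN ?_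
    refine (vertex_eq (n := fun p : (Σ i, {c // c ∈ G i}) => n p.1) (a := fun p => p.2.1.1)
      (b := fun p => p.2.1.2.1) (hn.comap Sigma.fst) (fst (snd id)) (fst (snd (snd id)))).not.congr
      fun p => by simp
  have hk : Comp w N (fun i => .pair (.nat (n i)) (encGraph (G i)))
      fun i => encList (encKeyed encEdge) (keyed (G i)) := by
    refine (fst id).pair hf |>.trans (map (κ := fun i => Edge (n i)) (fun i e => (DynDist.pairKey e.1 e.2.1, e))
      (snd id) (hN.of_le fun i => List.length_filter_le _ _) ?_)
    let I := Σ i, {c // c ∈ (G i).filter fun e => e.1 ≠ e.2.1}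
    exact (pairKey (n := fun p : I => n p.1) (a := fun p => p.2.1.1) (b := fun p => p.2.1.2.1)
      (hn.comap Sigma.fst) (fst (snd id)) (fst (snd (snd id))) (fst (fst id))).pair (snd id)
  have hlen : Bdd w N fun i => (keyed (G i)).length := hN.of_le fun i => by
    rw [keyed, List.length_map]; exact List.length_filter_le _ _
  have hg := groupByEdge (e := fun _ => encEdge) h0 hn
    (fun i p hp => ⟨_, _, (mem_keyed.1 hp).2.2⟩) (fst id) hk hlen
  refine flatMap (κ := fun i => List (Edge (n i))) (κ' := fun i => Edge (n i))
    (e := fun _ => encList encEdge) (e' := fun _ => encEdge) (fun _ => DynDist.lightest)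
    (fun _ h => h.length) hg ?_ ?_ ?_
  · exact ((Bdd.const 2).mul hlen).of_le fun i => sum_length_grouped _ _
  · refine (Bdd.const 1).of_le fun p => ?_
    by_cases h : p.2.1 = []
    · rw [h]; exact Nat.zero_le 1
    · obtain ⟨e, _, h1, _⟩ := lightest_spec _ h
      rw [h1]; exact le_rfl
  · exact lightest (n := fun p : (Σ i, {c // c ∈ DynDist.grouped (keyBits (n i)) (keyed (G i))}) => n p.1)
      (snd id) Bdd.self

theorem distinct {l : ∀ i, List (Fin (n i))}
    (h0 : ∀ i, 0 < n i) (hn : Bdd w (fun _ => 0) fun i => lg (n i))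
    (hx : Comp w N x fun i => .pair (.nat (n i)) (encList encVertex (l i)))
    (hN : Bdd w N fun i => (l i).length) :
    Comp w N x fun i => encList encVertex (distinct (l i)) := by
  refine hx.trans ?_
  have hk : Comp w N (fun i => .pair (.nat (n i)) (encList encVertex (l i)))
      fun i => encList (encKeyed encVertex) ((l i).map fun v : Fin (n i) => ((v : ℕ), v)) :=
    map (κ := fun i => Fin (n i)) (fun i v => ((v : ℕ), v)) (snd id) hN ((snd id).pair (snd id))
  have hg := grouped (e := fun _ => encVertex) (b := fun i => lg (n i)) hn (fun i p hp => by
    obtain ⟨v, _, rfl⟩ := List.mem_map.1 hp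
    exact (Nat.size_le_size v.2.le).trans (size_le_lg _)) hk (hN.of_le fun i => by simp)
    (unary_lg h0 hn (fst id)) (hn.of_le fun i => by simp)
  have hg' := hg.of_eq (z := fun i => encList (encList encVertex)
    (DynDist.grouped (lg (n i)) ((l i).map fun v : Fin (n i) => ((v : ℕ), v)))) fun i => by simp
  refine flatMap (κ := fun i => List (Fin (n i))) (κ' := fun i => Fin (n i))
    (e := fun _ => encList encVertex) (e' := fun _ => encVertex) (fun _ => List.take 1)
    (fun _ _ => 0) hg' ?_ ?_ ?_
  · refine ((Bdd.const 2).mul hN).of_le fun i => ?_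
    refine le_trans (List.sum_le_sum fun h _ => ?_) ((sum_length_grouped (lg (n i))
      ((l i).map fun v : Fin (n i) => ((v : ℕ), v))).trans (by simp))
    omega
  · exact (Bdd.const 1).of_le fun p => by simp
  · exact take_one (κ := fun p : (Σ i, {c // c ∈ DynDist.grouped (lg (n i))
      ((l i).map fun v : Fin (n i) => ((v : ℕ), v))}) => Fin (n p.1)) (snd id)

theorem named {X : ∀ i, List (Op (n i))} (hx : Comp w N x fun i => encList encOp (X i))
    (hN : Bdd w N fun i => (X i).length) :
    Comp w N x fun i => encList encVertex (named (X i)) := by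
  refine flatMap_const (κ := fun i => Op (n i)) (κ' := fun i => Fin (n i)) (e := fun _ => encOp)
    (e' := fun _ => encVertex) (fun _ o => [o.src, o.tgt]) hx hN (m := 2) (by simp) ?_
  let I := Σ i, {c // c ∈ X i}
  exact (op_src (n := fun p : I => n p.1) (o := fun p => p.2.1) (snd id)).pair
    ((op_tgt (n := fun p : I => n p.1) (o := fun p => p.2.1) (snd id)).pair (const 0))

/-! ### Active and passive edges -/

theorem items {A : ∀ i, WGraph (n i)} {X Y : ∀ i, List (Op (n i))}
    (hn : Bdd w (fun _ => 0) fun i => lg (n i))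
    (hx : Comp w N x fun i => .pair (.nat (n i))
      (.pair (encGraph (A i)) (.pair (encList encOp (X i)) (encList encOp (Y i)))))
    (hA : Bdd w N fun i => (A i).length) (hX : Bdd w N fun i => (X i).length)
    (hY : Bdd w N fun i => (Y i).length) :
    Comp w N x fun i => encList (encKeyed encItem) (items (A i) (X i) (Y i)) := by
  refine hx.trans ?_
  have h1 := map (κ := fun i => Edge (n i)) (κ' := fun i => ℕ × Item (n i)) (w := w) (N := N)
    (x := fun i => .pair (.nat (n i))
      (.pair (encGraph (A i)) (.pair (encList encOp (X i)) (encList encOp (Y i)))))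
    (e := fun _ => encEdge) (e' := fun _ => encKeyed encItem) (fun i e => edgeItem e)
    (fst (snd id)) hA (by
      let I := Σ i, {c // c ∈ A i}
      exact (pairKey (n := fun p : I => n p.1) (a := fun p => p.2.1.1) (b := fun p => p.2.1.2.1)
        (hn.comap Sigma.fst) (fst (snd id)) (fst (snd (snd id))) (fst (fst id))).pair
        ((const 0).pair (snd id)))
  have h2 := flatMap_const (κ := fun i => Op (n i)) (κ' := fun i => ℕ × Item (n i)) (w := w) (N := N)
    (x := fun i => .pair (.nat (n i))
      (.pair (encGraph (A i)) (.pair (encList encOp (X i)) (encList encOp (Y i)))))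
    (e := fun _ => encOp) (e' := fun _ => encKeyed encItem) (fun i o => opItem o)
    (fst (snd (snd id))) hX (m := 1) (fun i o => by cases o <;> simp [opItem]) (by
      let I := Σ i, {c // c ∈ X i}
      have ho : Comp (ι := I) (fun p => w p.1) (fun _ => 0) (fun p => .pair (.pair (.nat (n p.1))
        (.pair (encGraph (A p.1)) (.pair (encList encOp (X p.1)) (encList encOp (Y p.1)))))
        (encOp p.2.1)) fun p => encOp p.2.1 := snd id
      refine (optional (κ := fun p : I => ℕ × Item (n p.1)) (e := fun _ => encKeyed encItem)
        (Test.le (op_kind (n := fun p : I => n p.1) ho) (const 1) (Bdd.size_kind _) (Bdd.size_const 1))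
        (c := fun p => (DynDist.pairKey p.2.1.src p.2.1.tgt, p.2.1.kind, p.2.1.edge)) ?_).of_eq
        fun p => by rw [opItem_eq]
      exact (pairKey (n := fun p : I => n p.1) (hn.comap Sigma.fst)
        (op_src (n := fun p : I => n p.1) ho) (op_tgt (n := fun p : I => n p.1) ho)
        (fst (fst id))).pair ((op_kind (n := fun p : I => n p.1) ho).pair
          (op_edge (n := fun p : I => n p.1) ho)))
  have h3 := flatMap_const (κ := fun i => Op (n i)) (κ' := fun i => ℕ × Item (n i)) (w := w) (N := N)
    (x := fun i => .pair (.nat (n i))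
      (.pair (encGraph (A i)) (.pair (encList encOp (X i)) (encList encOp (Y i)))))
    (e := fun _ => encOp) (e' := fun _ => encKeyed encItem) (fun i o => opMark o)
    (snd (snd (snd id))) hY (m := 1) (fun i o => by cases o <;> simp [opMark]) (by
      let I := Σ i, {c // c ∈ Y i}
      have ho : Comp (ι := I) (fun p => w p.1) (fun _ => 0) (fun p => .pair (.pair (.nat (n p.1))
        (.pair (encGraph (A p.1)) (.pair (encList encOp (X p.1)) (encList encOp (Y p.1)))))
        (encOp p.2.1)) fun p => encOp p.2.1 := snd id
      refine (optional (κ := fun p : I => ℕ × Item (n p.1)) (e := fun _ => encKeyed encItem)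
        (op_kind_eq (n := fun p : I => n p.1) ho 1)
        (c := fun p => (DynDist.pairKey p.2.1.src p.2.1.tgt, 2, p.2.1.edge)) ?_).of_eq
        fun p => by rw [opMark_eq]
      exact (pairKey (n := fun p : I => n p.1) (hn.comap Sigma.fst)
        (op_src (n := fun p : I => n p.1) ho) (op_tgt (n := fun p : I => n p.1) ho)
        (fst (fst id))).pair ((const 2).pair (op_edge (n := fun p : I => n p.1) ho)))
  refine append h1 (append h2 h3 ?_) (hA.of_le fun i => by simp)
  exact hX.of_le fun i => by simpa [DynDist.items] using length_items_le ([] : WGraph (n i)) (X i) []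

theorem itemGroups {A : ∀ i, WGraph (n i)} {X Y : ∀ i, List (Op (n i))}
    (h0 : ∀ i, 0 < n i) (hn : Bdd w (fun _ => 0) fun i => lg (n i))
    (hx : Comp w N x fun i => .pair (.nat (n i))
      (.pair (encGraph (A i)) (.pair (encList encOp (X i)) (encList encOp (Y i)))))
    (hA : Bdd w N fun i => (A i).length) (hX : Bdd w N fun i => (X i).length)
    (hY : Bdd w N fun i => (Y i).length) :
    Comp w N x fun i => encList (encList encItem) (itemGroups (A i) (X i) (Y i)) :=
  groupByEdge (e := fun _ => encItem) h0 hn (fun i p hp => ⟨_, _, mem_items hp⟩) (fst hx)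
    (items hn hx hA hX hY) (((hA.add hX).add hY).of_le fun i => length_items_le _ _ _)

theorem item_kind_eq {it : ∀ i, Item (n i)} (hx : Comp w N x fun i => encItem (it i))
    (h2 : ∀ i, (it i).1 ≤ 2) (k : ℕ) : Test w N x fun i => (it i).1 = k :=
  Test.eq (fst hx) (const k) ((Bdd.size_const 2).size_le h2) (Bdd.size_const k)

theorem lastEdge {g : ∀ i, List (Item (n i))} (h2 : ∀ i, ∀ it ∈ g i, it.1 ≤ 2)
    (hx : Comp w N x fun i => encList encItem (g i)) (hN : Bdd w N fun i => (g i).length) :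
    Comp w N x fun i => encGraph (lastEdge (g i)) := by
  refine foldl (κ := fun i => Item (n i)) (e := fun _ => encItem) (σ := fun i => List (Edge (n i)))
    (es := fun _ => encList encEdge) (fun _ _ => True) _ _ (fun _ => trivial)
    (fun _ _ _ _ => trivial) (const 0) hx hN ?_
  let I := Σ i, {a : List (Edge (n i)) // True} × {c // c ∈ g i}
  let X : I → Val := fun p => .pair (x p.1) (.pair (encList encEdge p.2.1.1) (encItem p.2.2.1))
  have hit : Comp (ι := I) (fun p => w p.1) (fun _ => 0) X fun p => encItem p.2.2.1 := snd (snd id)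
  have hk := item_kind_eq (n := fun p : I => n p.1) hit (fun p => h2 p.1 _ p.2.2.2)
  have h1 : Comp (ι := I) (fun p => w p.1) (fun _ => 0) X fun p => encList encEdge [p.2.2.1.2] :=
    (snd hit).pair (const 0)
  refine ((hk 0).ite h1 ((hk 1).ite (const 0) (fst (snd id)))).of_eq fun p => ?_
  split_ifs <;> rfl

theorem has_mark {g : ∀ i, List (Item (n i))} (h2 : ∀ i, ∀ it ∈ g i, it.1 ≤ 2)
    (hx : Comp w N x fun i => encList encItem (g i)) (hN : Bdd w N fun i => (g i).length) :
    Test w N x fun i => marks (g i) ≠ [] := by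
  refine Test.ne_nil (κ := fun i => Item (n i)) (e := fun _ => encItem)
    (filter (κ := fun i => Item (n i)) (fun _ it => it.1 = 2) hx hN ?_)
  exact (item_kind_eq (n := fun p : (Σ i, {c // c ∈ g i}) => n p.1) (snd id)
    (fun p => h2 p.1 _ p.2.2) 2).congr fun p => by simp

theorem select {A : ∀ i, WGraph (n i)} {X Y : ∀ i, List (Op (n i))}
    (h0 : ∀ i, 0 < n i) (hn : Bdd w (fun _ => 0) fun i => lg (n i))
    (hx : Comp w N x fun i => .pair (.nat (n i))
      (.pair (encGraph (A i)) (.pair (encList encOp (X i)) (encList encOp (Y i)))))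
    (hA : Bdd w N fun i => (A i).length) (hX : Bdd w N fun i => (X i).length)
    (hY : Bdd w N fun i => (Y i).length) :
    (Comp w N x fun i => encGraph (active (A i) (X i) (Y i))) ∧
      Comp w N x fun i => encGraph (passive (A i) (X i) (Y i)) := by
  let I := Σ i, {c // c ∈ DynDist.itemGroups (A i) (X i) (Y i)}
  have h2 : ∀ p : I, ∀ it ∈ p.2.1, it.1 ≤ 2 := by
    intro p it hit
    obtain ⟨q, hq, rfl⟩ := mem_of_mem_grouped p.2.2 hit
    exact kind_le_of_mem_items hq
  have hl : Comp (ι := I) (fun p => w p.1) (fun p => p.2.1.length)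
      (fun p => .pair (x p.1) (encList encItem p.2.1)) fun p => encGraph (DynDist.lastEdge p.2.1) :=
    lastEdge (n := fun p : I => n p.1) h2 (snd id) Bdd.self
  have hm : Test (ι := I) (fun p => w p.1) (fun p => p.2.1.length)
      (fun p => .pair (x p.1) (encList encItem p.2.1)) fun p => marks p.2.1 ≠ [] :=
    has_mark (n := fun p : I => n p.1) h2 (snd id) Bdd.self
  have hsum : Bdd w N fun i =>
      ((DynDist.itemGroups (A i) (X i) (Y i)).map fun c => c.length + 1).sum :=
    ((Bdd.const 2).mul ((hA.add hX).add hY)).of_le fun i =>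
      (sum_length_grouped _ _).trans (Nat.mul_le_mul le_rfl (length_items_le _ _ _))
  constructor
  · refine flatMap (κ := fun i => List (Item (n i))) (κ' := fun i => Edge (n i))
      (e := fun _ => encList encItem) (e' := fun _ => encEdge) _ (fun _ h => h.length)
      (itemGroups h0 hn hx hA hX hY) hsum ((Bdd.const 1).of_le fun p => ?_) ?_
    · split_ifs
      · exact length_lastEdge _
      · exact Nat.zero_le 1
    · refine (hm.ite hl (const 0)).of_eq fun p => ?_
      split_ifs <;> rfl
  · refine flatMap (κ := fun i => List (Item (n i))) (κ' := fun i => Edge (n i))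
      (e := fun _ => encList encItem) (e' := fun _ => encEdge) _ (fun _ h => h.length)
      (itemGroups h0 hn hx hA hX hY) hsum ((Bdd.const 1).of_le fun p => ?_) ?_
    · split_ifs
      · exact Nat.zero_le 1
      · exact length_lastEdge _
    · refine (hm.ite (const 0) hl).of_eq fun p => ?_
      split_ifs <;> rfl

end Comp

end DynDist

namespace DynDist

universe u

/-! ## Sparsification programs -/

/-- A sparsification program, with the function that it computes and its time and size bounds. -/
structure MinorProgram (c : ℝ) where
  code : Code
  C : ℕ
  d : ℕ
  M : ∀ n : ℕ, ℕ → WGraph n → List (Fin n) → WGraph n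
  runs : ∀ n q : ℕ, 0 < n → 0 < q → ∀ (G : WGraph n) (T : List (Fin n)), G.Simple →
    IsPlanar G.toGraph → T.Nodup → ∃ t,
      code.Runs (.pair (.nat n) (.pair (.nat q) (.pair (encGraph G) (encList encVertex T))))
        (encGraph (M n q G T)) t ∧ t ≤ C * (G.length + T.length + 1) * (q * lg n) ^ d
  sparsifies : ∀ n q : ℕ, 0 < n → 0 < q → Sparsifies (1 / (q : ℝ)) (M n q)
  size : ∀ n q : ℕ, 0 < n → 0 < q → ∀ (G : WGraph n) (T : List (Fin n)), G.Simple →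
    IsPlanar G.toGraph → T.Nodup →
      ((M n q G T).length : ℝ) ≤ C * (T.length : ℝ) ^ c * ((q : ℝ) * lg n) ^ d

theorem HasMinorAlgorithm.nonempty {c : ℝ} (h : HasMinorAlgorithm c) :
    Nonempty (MinorProgram c) := by
  classical
  obtain ⟨P, C, d, h⟩ := h
  have h' : ∀ (n q : ℕ) (G : WGraph n) (T : List (Fin n)), ∃ H : WGraph n,
      0 < n → 0 < q → G.Simple → IsPlanar G.toGraph → T.Nodup → ∃ t,
        P.Runs (.pair (.nat n) (.pair (.nat q) (.pair (encGraph G) (encList encVertex T))))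
          (encGraph H) t ∧
        t ≤ C * (G.length + T.length + 1) * (q * lg n) ^ d ∧
        IsDistApproxMinor (1 / (q : ℝ)) G {v | v ∈ T} H ∧
        (H.size {v | v ∈ T} : ℝ) ≤ C * (T.length : ℝ) ^ c * ((q : ℝ) * lg n) ^ d := by
    intro n q G T
    by_cases hv : 0 < n ∧ 0 < q ∧ G.Simple ∧ IsPlanar G.toGraph ∧ T.Nodup
    · obtain ⟨H, t, h1⟩ := h n q hv.1 hv.2.1 G T hv.2.2.1 hv.2.2.2.1 hv.2.2.2.2
      exact ⟨H, fun _ _ _ _ _ => ⟨t, h1⟩⟩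
    -- An arbitrary value for invalid inputs, which makes the output a total function of the input.
    · exact ⟨[], fun h1 h2 h3 h4 h5 => absurd ⟨h1, h2, h3, h4, h5⟩ hv⟩
  choose M hM using h'
  refine ⟨⟨P, C, d, M, fun n q hn hq G T h1 h2 h3 => ?_, fun n q hn hq G T h1 h2 h3 => ?_,
    fun n q hn hq G T h1 h2 h3 => ?_⟩⟩
  · obtain ⟨t, a, b, _⟩ := hM n q G T hn hq h1 h2 h3
    exact ⟨t, a, b⟩
  · obtain ⟨t, _, _, a, _⟩ := hM n q G T hn hq h1 h2 h3
    exact a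
  · obtain ⟨t, _, _, _, a⟩ := hM n q G T hn hq h1 h2 h3
    refine le_trans ?_ a
    -- The size also counts vertices; only the number of edges is kept.
    exact_mod_cast Nat.le_add_left _ _

variable {ι : Type u} {w N : ι → ℕ} {x : ι → Val} {n q : ι → ℕ} {c : ℝ}

/-! ## Programs for tasks -/

def encTask {n : ℕ} (t : Task n) : Val :=
  .pair (encGraph t.1) (.pair (encGraph t.2.1) (encList encOp t.2.2))

/-- The state of the active edges after `j` blocks of operations. -/
def passiveAt {n : ℕ} (A : WGraph n) (Xs : List (List (Op n))) (j : ℕ) : WGraph n :=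
  (Xs.take j).foldl (fun A X => passive A X []) A

theorem passiveAt_succ {n : ℕ} (A : WGraph n) (Xs : List (List (Op n))) {j : ℕ}
    (h : j < Xs.length) : passiveAt A Xs (j + 1) = passive (passiveAt A Xs j) Xs[j] [] := by
  rw [passiveAt, ← List.take_append_getElem h, List.foldl_append]; rfl

theorem subtasks_append {n : ℕ} (M : WGraph n → List (Fin n) → WGraph n) (K A : WGraph n)
    (Xs : List (List (Op n))) (X : List (Op n)) :
    subtasks M K A (Xs ++ [X]) =
      subtasks M K A Xs ++ [subtask M K (Xs.foldl (fun A X => passive A X []) A) X] := by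
  induction Xs generalizing A with
  | nil => rfl
  | cons Y Xs ih => rw [List.cons_append, subtasks, ih]; rfl

theorem length_subtasks {n : ℕ} (M : WGraph n → List (Fin n) → WGraph n) (K A : WGraph n)
    (Xs : List (List (Op n))) : (subtasks M K A Xs).length = Xs.length := by
  induction Xs generalizing A with
  | nil => rfl
  | cons Y Xs ih => rw [subtasks, List.length_cons, ih, List.length_cons]

theorem mem_subtasks {n : ℕ} {M : WGraph n → List (Fin n) → WGraph n} {K A : WGraph n}
    {Xs : List (List (Op n))} {t : Task n} (h : t ∈ subtasks M K A Xs) :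
    ∃ (j : ℕ) (hj : j < Xs.length), t = subtask M K (passiveAt A Xs j) Xs[j] := by
  induction Xs generalizing A with
  | nil => exact absurd h List.not_mem_nil
  | cons Y Xs ih =>
    rcases List.mem_cons.1 h with rfl | h
    · exact ⟨0, by simp, rfl⟩
    · obtain ⟨j, hj, rfl⟩ := ih h
      exact ⟨j + 1, by simpa using hj, rfl⟩

theorem Task.Good.at {n : ℕ} {c : ℝ≥0∞} {G K A : WGraph n} {Xs : List (List (Op n))}
    (h : Task.Good c G (K, A, Xs.flatten)) {j : ℕ} (hj : j < Xs.length) :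
    ∃ G', Task.Good c G' (K, passiveAt A Xs j, Xs[j] ++ (Xs.drop (j + 1)).flatten) := by
  suffices ∀ j, j ≤ Xs.length → ∃ G', Task.Good c G' (K, passiveAt A Xs j, (Xs.drop j).flatten) by
    obtain ⟨G', h1⟩ := this j hj.le
    rw [List.drop_eq_getElem_cons hj, List.flatten_cons] at h1
    exact ⟨G', h1⟩
  intro j
  induction j with
  | zero => exact fun _ => ⟨G, h⟩
  | succ j ih =>
    intro hj
    obtain ⟨G', h1⟩ := ih (Nat.le_of_succ_le hj)
    rw [List.drop_eq_getElem_cons hj, List.flatten_cons] at h1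
    rw [passiveAt_succ A Xs hj]
    exact ⟨_, h1.rest⟩

/-- Both lists contain the same edges, each of them once. A bound on the size of the actual graph at
that time, such as the one from planarity, therefore bounds the list that the program maintains. -/
theorem length_passiveAt {n : ℕ} {A : WGraph n} {Xs : List (List (Op n))}
    (hA : (A.map ends).Nodup) (hX : Fresh A Xs.flatten) {j : ℕ} (hj : j ≤ Xs.length) :
    (passiveAt A Xs j).length = (run A (Xs.take j).flatten).length := by
  suffices ∀ j, j ≤ Xs.length → ((passiveAt A Xs j).map ends).Nodup ∧
      ∀ e, e ∈ passiveAt A Xs j ↔ e ∈ run A (Xs.take j).flatten by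
    obtain ⟨h1, h2⟩ := this j hj
    refine length_eq_of_mem_iff h1 (nodup_run hA ?_) h2
    rw [← List.take_append_drop j Xs, List.flatten_append, fresh_append] at hX
    exact hX.1
  intro j
  induction j with
  | zero => exact fun _ => ⟨hA, fun e => Iff.rfl⟩
  | succ j ih =>
    intro hj
    obtain ⟨h1, h2⟩ := ih (Nat.le_of_succ_le hj)
    have hf : Fresh (passiveAt A Xs j) Xs[j] := by
      have h3 := hX
      rw [← List.take_append_drop j Xs, List.flatten_append, fresh_append,
        List.drop_eq_getElem_cons hj, List.flatten_cons, fresh_append] at h3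
      exact fresh_mono (fun e => (h2 e).1) h3.2.1
    rw [passiveAt_succ A Xs hj]
    refine ⟨nodup_passive h1 hf, fun e => ?_⟩
    rw [mem_passive_nil h1 hf, ← List.take_append_getElem hj, List.flatten_append, run_append,
      List.flatten_singleton]
    exact mem_run_congr h2 _ e

theorem distinct_length_le {n : ℕ} (X : List (Op n)) :
    (distinct (named X)).length ≤ 2 * X.length := by
  refine ((distinct_spec _).1.subperm fun v => ((distinct_spec (named X)).2 v).1).length_le.trans ?_
  rw [named, List.length_flatMap]
  refine (List.sum_le_card_nsmul _ 2 fun m hm => ?_).trans (by simp [mul_comm])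
  obtain ⟨o, _, rfl⟩ := List.mem_map.1 hm
  exact le_rfl

theorem length_simplify_le {n : ℕ} (X : WGraph n) : (simplify X).length ≤ X.length := by
  obtain ⟨h1, h2⟩ := simplify_spec X
  have h3 := (List.Nodup.of_map _ h1.2).subperm fun e he => h2.1 e he
  exact h3.length_le

namespace Comp

theorem minor (P : MinorProgram c) {G : ∀ i, WGraph (n i)} {T : ∀ i, List (Fin (n i))}
    (h0 : ∀ i, 0 < n i) (hq0 : ∀ i, 0 < q i) (hn : Bdd w (fun _ => 0) fun i => lg (n i))
    (hq : Bdd w (fun _ => 0) q) (h1 : ∀ i, (G i).Simple) (h2 : ∀ i, IsPlanar (G i).toGraph)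
    (h3 : ∀ i, (T i).Nodup) (hG : Bdd w N fun i => (G i).length)
    (hT : Bdd w N fun i => (T i).length)
    (hx : Comp w N x fun i => .pair (.nat (n i)) (.pair (.nat (q i))
      (.pair (encGraph (G i)) (encList encVertex (T i))))) :
    Comp w N x fun i => encGraph (P.M (n i) (q i) (G i) (T i)) := by
  refine hx.trans ?_
  have hb : Bdd w N fun i =>
      (P.C * (q i * lg (n i)) ^ P.d) * ((G i).length + (T i).length + 1) :=
    ((Bdd.const P.C).mul ((hq.mul hn).pow P.d)).mul ((hG.add hT).add (Bdd.const 1))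
  obtain ⟨k, hk⟩ := hb
  refine ⟨P.code, k, fun i => ?_⟩
  obtain ⟨t, a, b⟩ := P.runs (n i) (q i) (h0 i) (hq0 i) (G i) (T i) (h1 i) (h2 i) (h3 i)
  exact ⟨t, a, b.trans ((le_of_eq (by ring)).trans (hk i))⟩

theorem subtask (P : MinorProgram c) {K A : ∀ i, WGraph (n i)} {X : ∀ i, List (Op (n i))}
    (h0 : ∀ i, 0 < n i) (hq0 : ∀ i, 0 < q i) (hn : Bdd w (fun _ => 0) fun i => lg (n i))
    (hq : Bdd w (fun _ => 0) q)
    (hgood : ∀ i, ∃ c' G Y, Task.Good c' G (K i, A i, X i ++ Y))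
    (hx : Comp w N x fun i => .pair (.pair (.nat (n i)) (.nat (q i))) (encTask (K i, A i, X i)))
    (hK : Bdd w N fun i => (K i).length) (hA : Bdd w N fun i => (A i).length)
    (hX : Bdd w N fun i => (X i).length) :
    Comp w N x fun i => encTask (subtask (P.M (n i) (q i)) (K i) (A i) (X i)) := by
  refine hx.trans ?_
  have hsel := select (w := w) (N := N) (x := fun i => .pair (.pair (.nat (n i)) (.nat (q i)))
    (encTask (K i, A i, X i))) (X := fun _ => []) (Y := X) h0 hn ((fst (fst id)).pair ((fst (snd (snd id))).pair
    ((const 0).pair (snd (snd (snd id)))))) hA (Bdd.const 0) hX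
  have hpl : Bdd w N fun i => (passive (A i) [] (X i)).length := hA.of_le fun i => by
    obtain ⟨c', G, Y, h⟩ := hgood i
    exact length_passive (A := A i) (X := []) h.nodup trivial
  have happ : Comp w N (fun i => .pair (.pair (.nat (n i)) (.nat (q i)))
      (encTask (K i, A i, X i))) fun i => encGraph (K i ++ passive (A i) [] (X i)) :=
    append (κ := fun i => Edge (n i)) (e := fun _ => encEdge) (fst (snd id)) hsel.2 hK
  have hlen : Bdd w N fun i => (K i ++ passive (A i) [] (X i)).length :=
    (hK.add hpl).of_le fun i => by simp
  have hs := simplify h0 hn ((fst (fst id)).pair happ) hlen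
  have hnam := named (w := w) (N := N) (x := fun i => .pair (.pair (.nat (n i)) (.nat (q i)))
    (encTask (K i, A i, X i))) (X := X) (snd (snd (snd id))) hX
  have hd := distinct h0 hn ((fst (fst id)).pair hnam)
    (((Bdd.const 2).mul hX).of_le fun i => by simp [DynDist.named, List.length_flatMap, mul_comm])
  refine pair (minor P h0 hq0 hn hq (fun i => (simplify_spec _).1) (fun i => ?_)
    (fun i => (distinct_spec _).1) (hlen.of_le fun i => length_simplify_le _)
    (((Bdd.const 2).mul hX).of_le fun i => distinct_length_le _)
    ((fst (fst id)).pair ((snd (fst id)).pair (hs.pair hd)))) (pair hsel.1 (snd (snd (snd id))))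
  obtain ⟨c', G, Y, h⟩ := hgood i
  exact h.planar_simplify

/-- A block costs about `|K|`, plus the current active list, plus the block itself. The list `A` is
charged only once, for the first block, and each other block is charged `a`. At the root this makes
the initial edges count once, even when there are few operations. -/
theorem subtasks (P : MinorProgram c) {K A : ∀ i, WGraph (n i)} {Xs : ∀ i, List (List (Op (n i)))}
    (h0 : ∀ i, 0 < n i) (hq0 : ∀ i, 0 < q i) (hn : Bdd w (fun _ => 0) fun i => lg (n i))
    (hq : Bdd w (fun _ => 0) q)
    (hgood : ∀ i, ∃ c' G, Task.Good c' G (K i, A i, (Xs i).flatten)) {a : ι → ℕ}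
    (ha : ∀ i j, 1 ≤ j → j < (Xs i).length → (passiveAt (A i) (Xs i) j).length ≤ a i)
    (hx : Comp w N x fun i => .pair (.pair (.nat (n i)) (.nat (q i)))
      (.pair (encGraph (K i)) (.pair (encGraph (A i)) (encList (encList encOp) (Xs i)))))
    (hK : Bdd w N fun i => (Xs i).length * (K i).length) (hA : Bdd w N fun i => (A i).length)
    (haN : Bdd w N fun i => ((Xs i).length - 1) * a i)
    (hX : Bdd w N fun i => ((Xs i).map fun X => X.length + 1).sum) :
    Comp w N x fun i => encList encTask (subtasks (P.M (n i) (q i)) (K i) (A i) (Xs i)) := by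
  refine hx.trans ?_
  have hXl : Bdd w N fun i => (Xs i).length := hX.of_le fun i => by
    rw [List.sum_map_add]; simp
  have h1 := fold (w := w) (N := N) (L := Xs) (e := fun _ => encList encOp)
    (x := fun i => .pair (.pair (.nat (n i)) (.nat (q i)))
      (.pair (encGraph (K i)) (.pair (encGraph (A i)) (encList (encList encOp) (Xs i)))))
    (S := fun i j => .pair (encGraph (passiveAt (A i) (Xs i) j)) (encList encTask
      (DynDist.subtasks (P.M (n i) (q i)) (K i) (A i) ((Xs i).take j)).reverse))
    (M := fun i j => (K i).length + (passiveAt (A i) (Xs i) j).length + ((Xs i)[j]?.getD []).length)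
    ((fst (snd (snd id))).pair (const 0)) (snd (snd (snd id))) ?_ ?_
  · have h2 := reverse (κ := fun i => Task (n i)) (e := fun _ => encTask) (snd h1)
      (hXl.of_le fun i => by simp [length_subtasks])
    refine h2.of_eq fun i => ?_
    rw [List.reverse_reverse, List.take_length]
  · refine (((hK.add hA).add haN).add hX).of_le fun i => ?_
    have e1 : ∀ j ∈ Finset.range (Xs i).length,
        (K i).length + (passiveAt (A i) (Xs i) j).length + ((Xs i)[j]?.getD []).length + 1 ≤
        (K i).length + (if j = 0 then (A i).length else a i) + (((Xs i)[j]?.getD []).length + 1) := by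
      intro j hj
      have h3 : (passiveAt (A i) (Xs i) j).length ≤ if j = 0 then (A i).length else a i := by
        split_ifs with hj0
        · subst hj0; exact le_rfl
        · exact ha i j (by omega) (Finset.mem_range.1 hj)
      omega
    refine (Finset.sum_le_sum e1).trans ?_
    rw [Finset.sum_add_distrib, Finset.sum_add_distrib, Finset.sum_const, Finset.card_range,
      smul_eq_mul]
    have e2 : ∑ j ∈ Finset.range (Xs i).length, (if j = 0 then (A i).length else a i) ≤
        (A i).length + ((Xs i).length - 1) * a i := by
      cases (Xs i).length with
      | zero => simp
      | succ m => rw [Finset.sum_range_succ']; simp [add_comm]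
    have e3 : ∑ j ∈ Finset.range (Xs i).length, (((Xs i)[j]?.getD []).length + 1) =
        ((Xs i).map fun X => X.length + 1).sum := by
      rw [Finset.sum_range, ← Fin.sum_univ_fun_getElem]
      exact Finset.sum_congr rfl fun j _ => by simp
    omega
  · let I := Σ i, {j // j < (Xs i).length}
    let S : I → Val := fun p => .pair (.pair (.pair (.nat (n p.1)) (.nat (q p.1)))
      (.pair (encGraph (K p.1)) (.pair (encGraph (A p.1)) (encList (encList encOp) (Xs p.1)))))
      (.pair (.pair (encGraph (passiveAt (A p.1) (Xs p.1) p.2.1)) (encList encTask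
      (DynDist.subtasks (P.M (n p.1) (q p.1)) (K p.1) (A p.1) ((Xs p.1).take p.2.1)).reverse))
        (encList encOp ((Xs p.1)[p.2.1]'p.2.2)))
    let B : I → ℕ := fun p => (K p.1).length + (passiveAt (A p.1) (Xs p.1) p.2.1).length +
      ((Xs p.1)[p.2.1]?.getD []).length
    have hgj : ∀ p : I, ∃ c' G Y, Task.Good c' G
        (K p.1, passiveAt (A p.1) (Xs p.1) p.2.1, (Xs p.1)[p.2.1]'p.2.2 ++ Y) := fun p => by
      obtain ⟨c', G, h⟩ := hgood p.1
      obtain ⟨G', h'⟩ := h.at p.2.2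
      exact ⟨c', G', _, h'⟩
    have hget : ∀ p : I, ((Xs p.1)[p.2.1]'p.2.2).length ≤ B p := fun p => by
      simp only [B]
      rw [List.getElem?_eq_getElem p.2.2, Option.getD_some]
      exact Nat.le_add_left _ _
    have bK : Bdd (ι := I) (fun p => w p.1) B fun p => (K p.1).length :=
      Bdd.self.of_le fun p => by simp only [B]; omega
    have bA : Bdd (ι := I) (fun p => w p.1) B
        fun p => (passiveAt (A p.1) (Xs p.1) p.2.1).length :=
      Bdd.self.of_le fun p => by simp only [B]; omega
    have bX : Bdd (ι := I) (fun p => w p.1) B fun p => ((Xs p.1)[p.2.1]'p.2.2).length :=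
      Bdd.self.of_le hget
    have hsub : Comp (ι := I) (fun p => w p.1) B S fun p => encTask
        (DynDist.subtask (P.M (n p.1) (q p.1)) (K p.1) (passiveAt (A p.1) (Xs p.1) p.2.1)
          ((Xs p.1)[p.2.1]'p.2.2)) :=
      subtask (n := fun p : I => n p.1) (q := fun p => q p.1) P (fun p => h0 p.1) (fun p => hq0 p.1)
        (hn.comap Sigma.fst) (hq.comap Sigma.fst) hgj
        ((fst (fst id)).pair ((fst (snd (fst id))).pair ((fst (fst (snd id))).pair (snd (snd id)))))
        bK bA bX
    have hpas : Comp (ι := I) (fun p => w p.1) B S fun p => encGraph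
        (passive (passiveAt (A p.1) (Xs p.1) p.2.1) ((Xs p.1)[p.2.1]'p.2.2) []) :=
      (select (n := fun p : I => n p.1) (Y := fun _ => []) (fun p => h0 p.1) (hn.comap Sigma.fst)
        ((fst (fst (fst id))).pair ((fst (fst (snd id))).pair ((snd (snd id)).pair (const 0))))
        bA bX (Bdd.const 0)).2
    refine (hpas.pair (hsub.pair (snd (fst (snd id))))).of_eq fun p => ?_
    rw [passiveAt_succ _ _ p.2.2, ← List.take_append_getElem p.2.2, subtasks_append,
      List.reverse_append]
    rfl

theorem children (P : MinorProgram c) {t : ∀ i, Task (n i)} {h : ι → ℕ}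
    (h0 : ∀ i, 0 < n i) (hq0 : ∀ i, 0 < q i) (hn : Bdd w (fun _ => 0) fun i => lg (n i))
    (hq : Bdd w (fun _ => 0) q) (hh : ∀ i, 0 < h i) (hhb : Bdd w (fun _ => 0) fun i => (h i).size)
    (hgood : ∀ i, ∃ c' G, Task.Good c' G (t i)) {a : ι → ℕ}
    (ha : ∀ i j, 1 ≤ j → j < (DynDist.cut (h i) (t i).2.2).length →
      (passiveAt (t i).2.1 (DynDist.cut (h i) (t i).2.2) j).length ≤ a i)
    (hx : Comp w N x fun i => .pair (.pair (.nat (n i)) (.nat (q i)))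
      (.pair (.nat (h i)) (encTask (t i))))
    (hK : Bdd w N fun i => (DynDist.cut (h i) (t i).2.2).length * (t i).1.length)
    (hA : Bdd w N fun i => (t i).2.1.length)
    (haN : Bdd w N fun i => ((DynDist.cut (h i) (t i).2.2).length - 1) * a i)
    (hX : Bdd w N fun i => (t i).2.2.length) :
    Comp w N x fun i => encList encTask (children (P.M (n i) (q i)) (h i) (t i)) := by
  refine hx.trans ?_
  have hc : Comp w N (fun i => .pair (.pair (.nat (n i)) (.nat (q i)))
      (.pair (.nat (h i)) (encTask (t i)))) fun i =>
      encList (encList encOp) (DynDist.cut (h i) (t i).2.2) :=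
    cut (κ := fun i => Op (n i)) (e := fun _ => encOp) (L := fun i => (t i).2.2) hh hhb
      ((fst (snd id)).pair (snd (snd (snd (snd id))))) hX
  refine subtasks P h0 hq0 hn hq (fun i => ?_) ha
    ((fst id).pair ((fst (snd (snd id))).pair ((fst (snd (snd (snd id)))).pair hc))) hK hA haN
    (((Bdd.const 2).mul hX).of_le fun i => ?_)
  · obtain ⟨c', G, hg⟩ := hgood i
    refine ⟨c', G, ?_⟩
    rw [flatten_cut]
    exact hg
  · refine (sum_length_add_one _ fun g hg => ((cut_spec (hh i) _).1 g hg).1).trans ?_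
    rw [← List.length_flatten, flatten_cut]

end Comp

end DynDist

namespace DynDist

universe u

variable {ι : Type u} {w N : ι → ℕ} {x : ι → Val} {n : ι → ℕ}

/-! ## Programs for shortest paths -/

def encReal (d : ℝ≥0) : Val := .real d

def encLabel {n : ℕ} (p : Label n) : Val := .pair (encVertex p.1) (encReal p.2)

theorem length_proposals {n : ℕ} (K : WGraph n) (v : Fin n) (p : Label n) :
    (proposals K v p).length ≤ K.length + 1 := by
  unfold proposals
  rw [List.length_append, List.length_flatMap]
  have h1 : (if p.1 = v then [p.2] else []).length ≤ 1 := by split_ifs <;> simp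
  have h2 : (K.map fun e => (if (e.1 = p.1 ∧ e.2.1 = v) ∨ (e.1 = v ∧ e.2.1 = p.1) then [p.2 + e.2.2]
      else []).length).sum ≤ K.length := by
    refine (List.sum_le_card_nsmul _ 1 fun m hm => ?_).trans (by simp)
    obtain ⟨e, _, rfl⟩ := List.mem_map.1 hm
    split_ifs <;> simp
  omega

theorem length_flatMap_le {α β : Type*} {f : α → List β} {l : List α} {m : ℕ}
    (h : ∀ a ∈ l, (f a).length ≤ m) : (l.flatMap f).length ≤ l.length * m := by
  rw [List.length_flatMap]
  refine (List.sum_le_card_nsmul _ m fun k hk => ?_).trans (by simp)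
  obtain ⟨a, ha, rfl⟩ := List.mem_map.1 hk
  exact h a ha

namespace Comp

theorem least {l : ∀ i, List ℝ≥0} (hl : Comp w N x fun i => encList encReal (l i))
    (hN : Bdd w N fun i => (l i).length) : Comp w N x fun i => encList encReal (least (l i)) := by
  refine foldl (κ := fun _ : ι => ℝ≥0) (e := fun _ => encReal) (σ := fun _ => List ℝ≥0)
    (es := fun _ => encList encReal) (fun _ _ => True) _ _ (fun _ => trivial)
    (fun _ _ _ _ => trivial) (const 0) hl hN ?_
  let I := Σ i, {_a : List ℝ≥0 // True} × {c // c ∈ l i}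
  let X : I → Val := fun p => .pair (x p.1) (.pair (encList encReal p.2.1.1) (encReal p.2.2.1))
  have ha : Comp (ι := I) (fun p => w p.1) (fun _ => 0) X fun p => encList encReal p.2.1.1 :=
    fst (snd id)
  have he : Comp (ι := I) (fun p => w p.1) (fun _ => 0) X fun p => encReal p.2.2.1 := snd (snd id)
  have he1 : Comp (ι := I) (fun p => w p.1) (fun _ => 0) X fun p => encList encReal [p.2.2.1] :=
    he.pair (const 0)
  refine (Test.ne_nil (e := fun _ => encReal) ha).cond ?_ ?_
  · let I' := {p : I // p.2.1.1 ≠ []}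
    have hcons : ∀ p : I', p.1.2.1.1 = p.1.2.1.1.head p.2 :: p.1.2.1.1.tail := fun p =>
      (List.cons_head_tail p.2).symm
    have hh := head (e := fun _ => encReal) hcons (ha.comap (Subtype.val : I' → I))
    have ht : Test (ι := I') (fun p => w p.1.1) (fun _ => 0) (fun p => X p.1)
        fun p => p.1.2.1.1.head p.2 ≤ p.1.2.2.1 :=
      (Test.realLe hh (he.comap Subtype.val)).congr fun p => NNReal.coe_le_coe
    classical
    refine (ht.ite (ha.comap Subtype.val) (he1.comap Subtype.val)).of_eq fun p => ?_
    rw [List.head?_eq_some_head p.2, Option.elim_some]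
    split_ifs <;> rfl
  · refine (he1.comap Subtype.val).of_eq fun p => ?_
    rw [not_not.1 p.2]
    rfl

theorem vertex_test (hn : Bdd w (fun _ => 0) fun i => lg (n i)) {a b a' b' : ∀ i, Fin (n i)}
    (ha : Comp w N x fun i => encVertex (a i)) (hb : Comp w N x fun i => encVertex (b i))
    (ha' : Comp w N x fun i => encVertex (a' i)) (hb' : Comp w N x fun i => encVertex (b' i)) :
    Test w N x fun i => (a i = a' i ∧ b i = b' i) ∨ (a i = b' i ∧ b i = a' i) := by
  have h1 := ((vertex_eq hn ha ha').and (vertex_eq hn hb hb')).not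
  have h2 := ((vertex_eq hn ha hb').and (vertex_eq hn hb ha')).not
  exact (h1.and h2).not.congr fun i => by tauto

theorem proposals {K : ∀ i, WGraph (n i)} {v : ∀ i, Fin (n i)} {p : ∀ i, Label (n i)}
    (hn : Bdd w (fun _ => 0) fun i => lg (n i)) (hK : Bdd w N fun i => (K i).length)
    (hx : Comp w N x fun i => .pair (encGraph (K i)) (.pair (encVertex (v i)) (encLabel (p i)))) :
    Comp w N x fun i => encList encReal (proposals (K i) (v i) (p i)) := by
  refine hx.trans ?_
  refine append (κ := fun _ : ι => ℝ≥0) (e := fun _ => encReal)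
    (optional (κ := fun _ : ι => ℝ≥0) (e := fun _ => encReal)
      (vertex_eq hn (fst (snd (snd id))) (fst (snd id))) (snd (snd (snd id)))) ?_
    ((Bdd.const 1).of_le fun i => by split_ifs <;> simp)
  refine flatMap_const (κ := fun i => Edge (n i)) (κ' := fun _ => ℝ≥0) (e := fun _ => encEdge)
    (e' := fun _ => encReal) _ (fst id) hK (m := 1) (fun i e => by split_ifs <;> simp) ?_
  let I := Σ i, {c // c ∈ K i}
  let X : I → Val := fun q => .pair (.pair (encGraph (K q.1)) (.pair (encVertex (v q.1))
    (encLabel (p q.1)))) (encEdge q.2.1)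
  have hv : Comp (ι := I) (fun q => w q.1) (fun _ => 0) X fun q => encVertex (v q.1) :=
    fst (snd (fst id))
  have hp : Comp (ι := I) (fun q => w q.1) (fun _ => 0) X fun q => encLabel (p q.1) :=
    snd (snd (fst id))
  have he : Comp (ι := I) (fun q => w q.1) (fun _ => 0) X fun q => encEdge q.2.1 := snd id
  refine optional (κ := fun _ : I => ℝ≥0) (e := fun _ => encReal)
    (c := fun q => (p q.1).2 + q.2.1.2.2) ?_ ?_
  · exact vertex_test (n := fun q : I => n q.1) (hn.comap Sigma.fst) (fst he) (fst (snd he))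
      (fst hp) hv
  · exact realOp .add (snd hp) (snd (snd he))

theorem relabel {K : ∀ i, WGraph (n i)} {D : ∀ i, List (Label (n i))} {v : ∀ i, Fin (n i)}
    (hn : Bdd w (fun _ => 0) fun i => lg (n i)) (hK : Bdd w (fun _ => 0) fun i => (K i).length)
    (hD : Bdd w (fun _ => 0) fun i => (D i).length)
    (hx : Comp w N x fun i => .pair (encGraph (K i)) (.pair (encList encLabel (D i))
      (encVertex (v i)))) :
    Comp w N x fun i => encList encLabel (relabel (K i) (D i) (v i)) := by
  refine hx.trans ?_
  have h1 := flatMap (w := w) (N := N) (κ := fun i => Label (n i)) (κ' := fun _ => ℝ≥0)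
    (x := fun i => .pair (encGraph (K i)) (.pair (encList encLabel (D i)) (encVertex (v i))))
    (e := fun _ => encLabel) (e' := fun _ => encReal) (fun i => DynDist.proposals (K i) (v i))
    (fun _ _ => 0) (fst (snd id)) ((Bdd.of_zero hD).of_le fun i => by simp)
    (((hK.add (Bdd.const 1)).comap (Sigma.fst : (Σ i, {c // c ∈ D i}) → ι)).of_le
      fun p => length_proposals _ _ _) (by
      let I := Σ i, {c // c ∈ D i}
      exact proposals (n := fun p : I => n p.1) (hn.comap Sigma.fst) (hK.comap Sigma.fst)
        ((fst (fst id)).pair ((snd (snd (fst id))).pair (snd id))))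
  have hlen : Bdd w N fun i => ((D i).flatMap (DynDist.proposals (K i) (v i))).length :=
    (Bdd.of_zero (hD.mul (hK.add (Bdd.const 1)))).of_le fun i =>
      length_flatMap_le fun p _ => length_proposals _ _ _
  have h2 := least h1 hlen
  refine ((snd (snd id)).pair h2).trans (map (κ := fun _ : ι => ℝ≥0) (κ' := fun i => Label (n i))
    (e := fun _ => encReal) (e' := fun _ => encLabel) (fun i d => (v i, d)) (snd id)
    ((Bdd.const 1).of_le fun i => length_least _) ?_)
  exact (fst (fst id)).pair (snd id)

theorem relax {K : ∀ i, WGraph (n i)} {D : ∀ i, List (Label (n i))} {v : ∀ i, Fin (n i)}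
    (hn : Bdd w (fun _ => 0) fun i => lg (n i)) (hK : Bdd w (fun _ => 0) fun i => (K i).length)
    (hD : Bdd w (fun _ => 0) fun i => (D i).length)
    (hx : Comp w N x fun i => .pair (encGraph (K i)) (.pair (encList encLabel (D i))
      (encVertex (v i)))) :
    Comp w N x fun i => encList encLabel (relax (K i) (v i) (D i)) := by
  refine hx.trans ?_
  have h1 : Comp w N (fun i => .pair (encGraph (K i)) (.pair (encList encLabel (D i))
      (encVertex (v i)))) fun i => encList encVertex (endpoints (K i)) :=
    flatMap_const (κ := fun i => Edge (n i)) (κ' := fun i => Fin (n i)) (e := fun _ => encEdge)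
      (e' := fun _ => encVertex) (fun _ e => [e.1, e.2.1]) (fst id) (Bdd.of_zero hK) (m := 2)
      (by simp) (by
        let I := Σ i, {c // c ∈ K i}
        have he : Comp (ι := I) (fun q => w q.1) (fun _ => 0)
          (fun p => .pair (.pair (encGraph (K p.1)) (.pair (encList encLabel (D p.1))
            (encVertex (v p.1)))) (encEdge p.2.1)) fun q => encEdge q.2.1 := snd id
        exact (fst he).pair ((fst (snd he)).pair (const 0)))
  refine flatMap (κ := fun i => Fin (n i)) (κ' := fun i => Label (n i)) (e := fun _ => encVertex)
    (e' := fun _ => encLabel) (fun i => DynDist.relabel (K i) (D i)) (fun _ _ => 0)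
    ((snd (snd id)).pair h1) ?_ ?_ ?_
  · refine (Bdd.of_zero ((((Bdd.const 2).mul hK)).add (Bdd.const 1))).of_le fun i => ?_
    simp only [endpoints, List.length_flatMap, List.map_const', List.sum_replicate, List.length_cons,
      List.length_nil, List.map_cons, List.sum_cons, zero_add, smul_eq_mul]
    omega
  · refine (Bdd.const 1).of_le fun p => ?_
    rw [DynDist.relabel, List.length_map]
    exact length_least _
  · let I := Σ i, {c // c ∈ v i :: endpoints (K i)}
    exact relabel (n := fun p : I => n p.1) (hn.comap Sigma.fst) (hK.comap Sigma.fst)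
      (hD.comap Sigma.fst) ((fst (fst id)).pair ((fst (snd (fst id))).pair (snd id)))

/-- The graph has polylogarithmic size here, so all the nested loops of the relaxation disappear in
the polynomial factor. -/
theorem shortest {K : ∀ i, WGraph (n i)} {u v : ∀ i, Fin (n i)}
    (hn : Bdd w (fun _ => 0) fun i => lg (n i)) (hK : Bdd w (fun _ => 0) fun i => (K i).length)
    (hx : Comp w N x fun i => .pair (encGraph (K i)) (.pair (encVertex (u i))
      (encVertex (v i)))) :
    Comp w N x fun i => encAnswer (shortest (K i) (u i) (v i)) := by
  refine hx.trans (of_zero ?_)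
  have h1 := fold (w := w) (N := fun _ => 0) (κ := fun i => Edge (n i)) (e := fun _ => encEdge)
    (x := fun i => .pair (encGraph (K i)) (.pair (encVertex (u i)) (encVertex (v i)))) (L := K)
    (S := fun i j => encList encLabel (labels (K i) (u i) j)) (M := fun _ _ => 0)
    (((fst (snd id)).pair realZero).pair (const 0)) (fst id) (hK.of_le fun i => by simp) (by
      let I := Σ i, {j // j < (K i).length}
      refine (relax (n := fun p : I => n p.1) (K := fun p => K p.1) (v := fun p => u p.1)
        (D := fun p => labels (K p.1) (u p.1) p.2.1) (hn.comap Sigma.fst) (hK.comap Sigma.fst)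
        ((((Bdd.const 2).mul hK).add (Bdd.const 1)).comap Sigma.fst |>.of_le fun p =>
          length_labels _ _ _)
        ((fst (fst id)).pair ((fst (snd id)).pair (fst (snd (fst id)))))).of_eq fun p => ?_
      rw [labels_succ])
  have hlab : Bdd w (fun _ => 0) fun i => (labels (K i) (u i) (K i).length).length :=
    (((Bdd.const 2).mul hK).add (Bdd.const 1)).of_le fun i => length_labels _ _ _
  have h2 : Comp w (fun _ => 0)
      (fun i => .pair (encGraph (K i)) (.pair (encVertex (u i)) (encVertex (v i))))
      fun i => encList encReal (readLabels (labels (K i) (u i) (K i).length) (v i)) := by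
    refine least ?_ ((hlab.mul (Bdd.const 1)).of_le fun i =>
      length_flatMap_le fun p _ => by split_ifs <;> simp)
    refine ((snd (snd id)).pair h1).trans ?_
    refine flatMap_const (κ := fun i => Label (n i)) (κ' := fun _ => ℝ≥0) (e := fun _ => encLabel)
      (e' := fun _ => encReal) _ (snd id) hlab (m := 1) (fun i e => by split_ifs <;> simp) ?_
    let I := Σ i, {c // c ∈ labels (K i) (u i) (K i).length}
    refine optional (κ := fun _ : I => ℝ≥0) (e := fun _ => encReal)
      (vertex_eq (n := fun p : I => n p.1) (hn.comap Sigma.fst) (fst (snd id)) (fst (fst id)))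
      (snd (snd id))
  refine (Test.ne_nil h2).cond ?_ ?_
  · let I := {i // readLabels (labels (K i) (u i) (K i).length) (v i) ≠ []}
    have hcons := fun i : I => (List.cons_head_tail i.2).symm
    refine (head (κ := fun _ : I => ℝ≥0) (e := fun _ => encReal) hcons (h2.comap Subtype.val)).of_eq
      fun i => ?_
    rw [DynDist.shortest, List.head?_eq_some_head i.2, Option.elim_some, encAnswer,
      if_neg ENNReal.coe_ne_top, ENNReal.coe_toReal]
    rfl
  · refine (const 0).of_eq fun i => ?_
    rw [DynDist.shortest, not_not.1 i.2, encAnswer]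
    exact (if_pos rfl).symm

theorem answers {t : ∀ i, Task (n i)} (hn : Bdd w (fun _ => 0) fun i => lg (n i))
    (hK : Bdd w (fun _ => 0) fun i => (t i).1.length)
    (hA : Bdd w (fun _ => 0) fun i => (t i).2.1.length)
    (hX : Bdd w (fun _ => 0) fun i => (t i).2.2.length)
    (hx : Comp w N x fun i => encTask (t i)) :
    Comp w N x fun i => encList encAnswer (answers DynDist.shortest (t i)) := by
  refine hx.trans (of_zero ?_)
  have hKA : Comp w (fun _ => 0) (fun i => encTask (t i))
      fun i => encGraph ((t i).1 ++ (t i).2.1) :=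
    append (κ := fun i => Edge (n i)) (e := fun _ => encEdge) (fst id) (fst (snd id)) hK
  have h1 := (hKA.pair (snd (snd id))).trans (flatMap_const (w := w) (N := fun _ => 0)
    (κ := fun i => Op (n i)) (κ' := fun _ => ℝ≥0∞) (e := fun _ => encOp) (e' := fun _ => encAnswer)
    (x := fun i => .pair (encGraph ((t i).1 ++ (t i).2.1)) (encList encOp (t i).2.2))
    (L := fun i => (t i).2.2)
    (fun i o => if o.kind = 2 then [DynDist.shortest ((t i).1 ++ (t i).2.1) o.src o.tgt] else [])
    (snd id) hX (m := 1) (fun i o => by split_ifs <;> simp) (by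
      let I := Σ i, {c // c ∈ (t i).2.2}
      have ho : Comp (ι := I) (fun p => w p.1) (fun _ => 0)
        (fun p => .pair (.pair (encGraph ((t p.1).1 ++ (t p.1).2.1)) (encList encOp (t p.1).2.2))
          (encOp p.2.1)) fun p => encOp p.2.1 := snd id
      refine optional (κ := fun _ : I => ℝ≥0∞) (e := fun _ => encAnswer)
        (op_kind_eq (n := fun p : I => n p.1) ho 2) ?_
      exact shortest (n := fun p : I => n p.1) (hn.comap Sigma.fst)
        (((hK.add hA).comap Sigma.fst).of_le fun p => by simp)
        ((fst (fst id)).pair ((op_src (n := fun p : I => n p.1) ho).pair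
          (op_tgt (n := fun p : I => n p.1) ho)))))
  refine h1.of_eq fun i => congrArg (encList encAnswer) ?_
  refine List.flatMap_congr fun o _ => ?_
  cases o <;> rfl

end Comp

end DynDist

namespace DynDist

/-! ## The block lengths -/

/-- The powers of two from `2 ^ J` down to `1`. -/
def levels : ℕ → List ℕ
  | 0 => [1]
  | J + 1 => 2 ^ (J + 1) :: levels J

theorem length_levels (J : ℕ) : (levels J).length = J + 1 := by
  induction J with
  | zero => rfl
  | succ J ih => rw [levels, List.length_cons, ih]

theorem getElem_levels {J j : ℕ} (h : j < (levels J).length) : (levels J)[j] = 2 ^ (J - j) := by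
  induction J generalizing j with
  | zero =>
    rw [length_levels] at h
    obtain rfl : j = 0 := by omega
    rfl
  | succ J ih =>
    cases j with
    | zero => rfl
    | succ j => simp only [levels, List.getElem_cons_succ, ih, Nat.add_sub_add_right]

theorem mem_levels {J h : ℕ} : h ∈ levels J ↔ ∃ j ≤ J, h = 2 ^ j := by
  induction J with
  | zero => simp [levels]
  | succ J ih =>
    rw [levels, List.mem_cons, ih]
    constructor
    · rintro (rfl | ⟨j, h1, rfl⟩)
      · exact ⟨J + 1, le_rfl, rfl⟩
      · exact ⟨j, by omega, rfl⟩
    · rintro ⟨j, h1, rfl⟩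
      rcases Nat.le_succ_iff.1 h1 with h1 | rfl
      · exact Or.inr ⟨j, h1, rfl⟩
      · exact Or.inl rfl

theorem filter_levels {p : ℕ → Bool} {J : ℕ} (hp : ∀ j, p (2 ^ j) = true ↔ j ≤ J) {m : ℕ}
    (h : J ≤ m) : (levels m).filter p = levels J := by
  induction m, h using Nat.le_induction with
  | base =>
    rw [List.filter_eq_self]
    intro h hh
    obtain ⟨j, hj, rfl⟩ := mem_levels.1 hh
    exact (hp j).2 hj
  | succ m hm ih =>
    rw [levels, List.filter_cons_of_neg, ih]
    rw [hp]
    omega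

/-- The logarithm of the greatest power of two that is at most `n ^ (a / b)`. -/
def topLevel (a b n : ℕ) : ℕ := Nat.log 2 (n ^ a) / b

/-- A rational exponent lets the program find the block lengths by comparing integers. -/
theorem pow_le_iff_topLevel {a b n : ℕ} (hb : 0 < b) (hn : 0 < n) (j : ℕ) :
    (2 ^ j) ^ b ≤ n ^ a ↔ j ≤ topLevel a b n := by
  rw [topLevel, Nat.le_div_iff_mul_le hb, ← pow_mul,
    ← Nat.le_log_iff_pow_le (by omega) (pow_pos hn a).ne']

theorem topLevel_le {a b n : ℕ} (hb : 0 < b) (hab : a ≤ b) (hn : 0 < n) :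
    topLevel a b n ≤ lg n := by
  have h := (pow_le_iff_topLevel (a := a) hb hn (topLevel a b n)).2 le_rfl
  rw [← Nat.pow_le_pow_iff_right (a := 2) (by omega)]
  refine le_trans ?_ (lt_two_pow_lg n).le
  by_contra hlt
  have h1 : n ^ b < (2 ^ topLevel a b n) ^ b := Nat.pow_lt_pow_left (not_le.1 hlt) hb.ne'
  have h2 : n ^ a ≤ n ^ b := Nat.pow_le_pow_right hn hab
  omega

/-! ## Sizes of the graphs and of the tasks -/

theorem length_le_of_planar {n : ℕ} {G : WGraph n} (hG : G.Simple) (hp : IsPlanar G.toGraph) :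
    G.length ≤ 6 * n := by
  have h1 := hp.card_edgeSet_le
  rw [Nat.card_eq_fintype_card (α := Fin n), Fintype.card_fin] at h1
  refine le_trans ?_ h1
  classical
  have h2 : (((G.map ends).toFinset : Finset (Sym2 (Fin n))) : Set (Sym2 (Fin n))) ⊆
      G.toGraph.edgeSet := by
    intro p hp
    rw [List.coe_toFinset] at hp
    rw [WGraph.toGraph, SimpleGraph.edgeSet_fromEdgeSet]
    refine ⟨hp, fun hd => ?_⟩
    obtain ⟨e, he, rfl⟩ := List.mem_map.1 hp
    exact hG.1 e he hd
  have h3 := Set.ncard_le_ncard h2 (Set.toFinite _)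
  rw [Set.ncard_coe_finset, List.toFinset_card_of_nodup hG.2, List.length_map] at h3
  exact h3

theorem PlanarRun.simple_run {n : ℕ} {G : WGraph n} {ops : List (Op n)} (hG : G.Simple)
    (h : PlanarRun G ops) {p : List (Op n)} (hp : p <+: ops) :
    (run G p).Simple ∧ IsPlanar (run G p).toGraph := by
  induction p generalizing G ops with
  | nil => exact ⟨hG, by cases ops; exacts [h, h.1]⟩
  | cons x p ih =>
    obtain ⟨ops', rfl, h1⟩ := List.cons_prefix_iff.1 hp
    refine ih (G := G.step x) ⟨fun e he => ?_, nodup_step hG.2 h.fresh.1⟩ h.2.2 h1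
    rcases mem_step.1 he with rfl | h2
    · exact h.2.1.1
    · exact hG.1 e h2.1

theorem mem_children {n : ℕ} {M : WGraph n → List (Fin n) → WGraph n} {h : ℕ} (hh : 0 < h)
    {t t' : Task n} {c : ℝ≥0∞} {G : WGraph n} (hg : t.Good c G) (ht : t' ∈ children M h t) :
    t'.2.2 ≠ [] ∧ t'.2.2.length ≤ h ∧ t'.2.1.length ≤ t'.2.2.length ∧
      ∃ S T, S.Simple ∧ IsPlanar S.toGraph ∧ T.Nodup ∧ T.length ≤ 2 * t'.2.2.length ∧
        t'.1 = M S T := by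
  obtain ⟨j, hj, rfl⟩ := mem_subtasks ht
  have hg' : Task.Good c G (t.1, t.2.1, (cut h t.2.2).flatten) := by rw [flatten_cut]; exact hg
  obtain ⟨G', h1⟩ := hg'.at hj
  have h2 := (cut_spec hh t.2.2).1 _ (List.getElem_mem hj)
  exact ⟨h2.1, h2.2, length_active (A := passiveAt t.2.1 (cut h t.2.2) j) (X := []) h1.nodup trivial,
    _, _, (simplify_spec _).1, h1.planar_simplify, (distinct_spec _).1, distinct_length_le _, rfl⟩

theorem allTasks_append {n : ℕ} (M : WGraph n → List (Fin n) → WGraph n) (hs : List ℕ) (h : ℕ)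
    (ts : List (Task n)) :
    allTasks M (hs ++ [h]) ts = (allTasks M hs ts).flatMap (children M h) := by
  simp [allTasks]

end DynDist

namespace DynDist

/-! ## The program for the oracle -/

/-- An input for the oracle, with the reciprocal `Q` of the precision and a number `D` that bounds
the relative sizes of the sparsifiers and the number of the longest blocks. -/
structure Input {c : ℝ} (P : MinorProgram c) (a b : ℕ) where
  n : ℕ
  Q : ℕ
  D : ℕ
  G : WGraph n
  ops : List (Op n)
  hn : 0 < n
  hQ : 0 < Q
  simple : G.Simple
  planar : PlanarRun G ops
  size_le : ∀ k : ℕ, k ≤ 2 * 2 ^ topLevel a b n → (k : ℝ) ^ c ≤ k * D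
  count_le : n ≤ 2 ^ topLevel a b n * D

namespace Input

variable {c : ℝ} {P : MinorProgram c} {a b : ℕ} (i : Input P a b)

def q : ℕ := i.Q * lg i.n

def J : ℕ := topLevel a b i.n

noncomputable def minor : WGraph i.n → List (Fin i.n) → WGraph i.n := P.M i.n i.q

/-- The task to answer all the queries. -/
def root : Task i.n := ([], i.G, i.ops)

/-- The tasks after `j` rounds. -/
noncomputable def tasksAt (j : ℕ) : List (Task i.n) :=
  allTasks i.minor ((levels i.J).take j) [i.root]

noncomputable def ans : List ℝ≥0∞ := (i.tasksAt (i.J + 1)).flatMap (answers shortest)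

theorem lg_pos : 0 < lg i.n := Nat.succ_pos _

theorem q_pos : 0 < i.q := Nat.mul_pos i.hQ i.lg_pos

theorem D_pos : 0 < i.D := by
  by_contra h
  have h1 := i.count_le
  have h2 := i.hn
  rw [Nat.eq_zero_of_not_pos h] at h1
  omega

theorem sparsifies : Sparsifies (1 / (i.q : ℝ)) i.minor := P.sparsifies i.n i.q i.hn i.q_pos

theorem tasks (j : ℕ) (hj : j ≤ i.J + 1) :
    Tasks (ENNReal.ofReal (1 + 1 / (i.q : ℝ)) ^ j) i.G (i.tasksAt j) ∧
      opsOf (i.tasksAt j) = i.ops := by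
  have h1 : Tasks 1 i.G [i.root] := ⟨i.planar.good i.simple, trivial⟩
  have h2 := Tasks.all (by positivity) i.sparsifies ((levels i.J).take j) h1
  rw [List.length_take, length_levels, min_eq_left hj, mul_one] at h2
  exact ⟨h2.1, h2.2.trans (by simp [opsOf, root])⟩

theorem good {j : ℕ} (hj : j ≤ i.J + 1) : ∀ t ∈ i.tasksAt j, ∃ c' G', t.Good c' G' := fun t ht =>
  ⟨_, (i.tasks j hj).1.exists_good t ht⟩

theorem tasksAt_zero : i.tasksAt 0 = [i.root] := rfl

theorem tasksAt_succ {j : ℕ} (hj : j < i.J + 1) :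
    i.tasksAt (j + 1) = (i.tasksAt j).flatMap (children i.minor (2 ^ (i.J - j))) := by
  have hj' : j < (levels i.J).length := by rwa [length_levels]
  rw [tasksAt, ← List.take_append_getElem hj', allTasks_append, getElem_levels]
  rfl

/-- After a round, `K` is an output of the minor algorithm for at most `2 * |X|` terminals. Blocks
are no longer than `2 ^ J`, so the condition `size_le` turns the bound `k ^ c` into the linear one
`k * D`. For a single operation there are at most two terminals, and the bound does not involve `D`;
the polylogarithmic cost of the final queries rests on this. -/
theorem task_spec {j : ℕ} (hj : j < i.J + 1) {t : Task i.n} (ht : t ∈ i.tasksAt (j + 1)) :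
    t.2.2 ≠ [] ∧ t.2.2.length ≤ 2 ^ (i.J - j) ∧ t.2.1.length ≤ t.2.2.length ∧
      t.1.length ≤ 2 * P.C * (i.q * lg i.n) ^ P.d * (t.2.2.length * i.D) ∧
      (0 ≤ c → t.2.2.length ≤ 1 → t.1.length ≤ P.C * ⌈(2 : ℝ) ^ c⌉₊ * (i.q * lg i.n) ^ P.d) := by
  rw [tasksAt_succ i hj] at ht
  obtain ⟨t', ht', ht⟩ := List.mem_flatMap.1 ht
  obtain ⟨c', G', hg⟩ := i.good hj.le t' ht'
  obtain ⟨h1, h2, h3, S, T, h4, h5, h6, h7, h8⟩ := mem_children (by positivity) hg ht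
  have h9 := P.size i.n i.q i.hn i.q_pos S T h4 h5 h6
  have h10 : t.1 = P.M i.n i.q S T := h8
  rw [← h10] at h9
  refine ⟨h1, h2, h3, ?_, fun hc hX => ?_⟩
  · have h11 : t.2.2.length ≤ 2 ^ i.J := h2.trans (Nat.pow_le_pow_right (by omega) (by omega))
    have h12 := i.size_le T.length (h7.trans (Nat.mul_le_mul le_rfl h11))
    have h13 : (T.length : ℝ) ≤ 2 * t.2.2.length := by exact_mod_cast h7
    have h14 : (t.1.length : ℝ) ≤ P.C * (2 * t.2.2.length * i.D) * ((i.q : ℝ) * lg i.n) ^ P.d := by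
      refine h9.trans ?_
      gcongr
      exact h12.trans (by gcongr)
    have h15 : t.1.length ≤ P.C * (2 * t.2.2.length * i.D) * (i.q * lg i.n) ^ P.d := by
      exact_mod_cast h14
    refine h15.trans (le_of_eq (by ring))
  · have h11 : (T.length : ℝ) ≤ 2 := by exact_mod_cast h7.trans (Nat.mul_le_mul le_rfl hX)
    have h14 : (t.1.length : ℝ) ≤ P.C * ⌈(2 : ℝ) ^ c⌉₊ * ((i.q : ℝ) * lg i.n) ^ P.d := by
      refine h9.trans ?_
      gcongr
      exact (Real.rpow_le_rpow (by positivity) h11 hc).trans (Nat.le_ceil _)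
    exact_mod_cast h14

theorem length_tasksAt {j : ℕ} (hj : j < i.J + 1) :
    ((i.tasksAt (j + 1)).map fun t => t.2.2.length).sum = i.ops.length := by
  rw [← (i.tasks (j + 1) hj).2, opsOf, List.length_flatMap]

/-- Between the blocks of the root the list represents the actual graph at that time, which is
planar and simple. -/
theorem passiveAt_le {h j : ℕ} (hj : j ≤ (cut h i.ops).length) :
    (passiveAt i.G (cut h i.ops) j).length ≤ 6 * i.n := by
  have h1 : Fresh i.G (cut h i.ops).flatten := by rw [flatten_cut]; exact i.planar.fresh
  rw [length_passiveAt i.simple.2 h1 hj]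
  have h2 : ((cut h i.ops).take j).flatten <+: i.ops := by
    conv_rhs => rw [← flatten_cut h i.ops, ← List.take_append_drop j (cut h i.ops),
      List.flatten_append]
    exact List.prefix_append _ _
  obtain ⟨h3, h4⟩ := i.planar.simple_run i.simple h2
  exact length_le_of_planar h3 h4

/-- The budget for all the tasks. -/
def budget : ℕ := i.G.length + i.ops.length * i.D

/-- The budget for one task. -/
def taskBudget (j : ℕ) (t : Task i.n) : ℕ := if j = 0 then i.budget else t.2.2.length * i.D

/-- A bound for the number of active edges. -/
def activeBound (j : ℕ) (t : Task i.n) : ℕ := if j = 0 then 6 * i.n else 2 * t.2.2.length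

/-- The blocks of one level partition the operations, so their budgets add up to `ops.length * D`.
The blocks are nonempty, which absorbs the additional `1` for each task. -/
theorem sum_taskBudget {j : ℕ} (hj : j < i.J + 1) :
    ((i.tasksAt j).map fun t => i.taskBudget j t + 1).sum ≤ 2 * (i.budget + 1) := by
  cases j with
  | zero =>
    rw [tasksAt_zero, List.map_singleton, List.sum_singleton, taskBudget, if_pos rfl]
    omega
  | succ j =>
    have hj' : j < i.J + 1 := by omega
    have h1 : ((i.tasksAt (j + 1)).map fun t => i.taskBudget (j + 1) t + 1).sum ≤
        ((i.tasksAt (j + 1)).map fun t => 2 * i.D * t.2.2.length).sum := by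
      refine List.sum_le_sum fun t ht => ?_
      rw [taskBudget, if_neg (Nat.succ_ne_zero j)]
      have h2 := List.length_pos_iff.2 (i.task_spec hj' ht).1
      have h3 := Nat.mul_pos h2 i.D_pos
      nlinarith
    refine h1.trans ?_
    rw [List.sum_map_mul_left, i.length_tasksAt hj', budget]
    nlinarith [Nat.zero_le i.G.length]

theorem task_bounds {j : ℕ} (hj : j < i.J + 1) {t : Task i.n} (ht : t ∈ i.tasksAt j) :
    (cut (2 ^ (i.J - j)) t.2.2).length * t.1.length ≤
        6 * P.C * (i.q * lg i.n) ^ P.d * i.taskBudget j t ∧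
      t.2.1.length ≤ i.taskBudget j t ∧
      ((cut (2 ^ (i.J - j)) t.2.2).length - 1) * i.activeBound j t ≤ 6 * i.taskBudget j t ∧
      t.2.2.length ≤ i.taskBudget j t ∧
      ∀ k, 1 ≤ k → k < (cut (2 ^ (i.J - j)) t.2.2).length →
        (passiveAt t.2.1 (cut (2 ^ (i.J - j)) t.2.2) k).length ≤ i.activeBound j t := by
  have hD := i.D_pos
  have hpow : 0 < 2 ^ (i.J - j) := by positivity
  have hcut := (cut_spec hpow t.2.2).2
  cases j with
  | zero =>
    rw [tasksAt_zero, List.mem_singleton] at ht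
    subst ht
    simp only [taskBudget, activeBound, if_true, budget, Nat.sub_zero] at hcut ⊢
    have h1 : i.ops.length ≤ i.ops.length * i.D := Nat.le_mul_of_pos_right _ hD
    refine ⟨by simp [root], Nat.le_add_right _ _, ?_, h1.trans (Nat.le_add_left _ _),
      fun k _ hk => i.passiveAt_le hk.le⟩
    -- Every block except one is full, so the cost `6 * n` of a block can be distributed over `2 ^
    -- J` operations with a share of at most `6 * D` each. With all the blocks counted this would
    -- fail for short sequences.
    have h2 : ((cut (2 ^ i.J) i.ops).length - 1) * 2 ^ i.J ≤ i.ops.length := by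
      have h3 : (cut (2 ^ i.J) i.ops).length * 2 ^ i.J ≤ i.ops.length + 2 ^ i.J := hcut
      rw [Nat.sub_mul]
      omega
    have h4 : i.n ≤ 2 ^ i.J * i.D := i.count_le
    calc ((cut (2 ^ i.J) i.ops).length - 1) * (6 * i.n)
        ≤ ((cut (2 ^ i.J) i.ops).length - 1) * (6 * (2 ^ i.J * i.D)) := by gcongr
      _ = 6 * (((cut (2 ^ i.J) i.ops).length - 1) * 2 ^ i.J * i.D) := by ring
      _ ≤ 6 * (i.ops.length * i.D) := by gcongr
      _ ≤ _ := by omega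
  | succ j =>
    have hj' : j < i.J + 1 := by omega
    obtain ⟨h1, h2, h3, h4, -⟩ := i.task_spec hj' ht
    simp only [taskBudget, activeBound, if_neg (Nat.succ_ne_zero j)]
    have h5 : t.2.2.length ≤ t.2.2.length * i.D := Nat.le_mul_of_pos_right _ hD
    have h6 : 2 ^ (i.J - j) = 2 * 2 ^ (i.J - (j + 1)) := by
      rw [← pow_succ']
      congr 1
      omega
    -- The parent block has at most twice the new block length `h`, and the number of blocks times
    -- `h` is at most the length plus `h`, hence at most `3 * h`.
    have h7 : (cut (2 ^ (i.J - (j + 1))) t.2.2).length ≤ 3 := by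
      rw [h6] at h2
      by_contra h8
      have h9 : 4 * 2 ^ (i.J - (j + 1)) ≤
          (cut (2 ^ (i.J - (j + 1))) t.2.2).length * 2 ^ (i.J - (j + 1)) := by
        gcongr; omega
      omega
    refine ⟨?_, h3.trans h5, ?_, h5, fun k _ hk => ?_⟩
    · calc _ ≤ 3 * (2 * P.C * (i.q * lg i.n) ^ P.d * (t.2.2.length * i.D)) := Nat.mul_le_mul h7 h4
        _ = _ := by ring
    · calc _ ≤ 2 * (2 * t.2.2.length) := by gcongr; omega
        _ ≤ _ := by omega
    · obtain ⟨c', G', hg⟩ := i.good hj.le t ht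
      have hf : Fresh t.2.1 (cut (2 ^ (i.J - (j + 1))) t.2.2).flatten := by
        rw [flatten_cut]; exact hg.fresh
      rw [length_passiveAt hg.nodup hf hk.le]
      refine (length_run _ _).trans ?_
      have h8 : ((cut (2 ^ (i.J - (j + 1))) t.2.2).take k).flatten.length ≤ t.2.2.length := by
        conv_rhs => rw [← flatten_cut (2 ^ (i.J - (j + 1))) t.2.2]
        exact ((List.take_sublist _ _).flatten).length_le
      omega

theorem approxAnswers {ε' : ℝ} (h : (1 + 1 / (i.q : ℝ)) ^ (i.J + 1) ≤ 1 + ε') :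
    ApproxAnswers ε' i.G i.ops i.ans := by
  obtain ⟨h1, h2⟩ := i.tasks (i.J + 1) le_rfl
  have h3 := h1.approxAnswers (ε := ε') (D := shortest) ?_ (fun K u v => shortest_eq K u v) ?_
  · rw [h2] at h3
    exact h3
  · rw [← ENNReal.ofReal_pow (by positivity)]
    exact ENNReal.ofReal_le_ofReal h
  · intro t ht
    obtain ⟨h4, h5, _⟩ := i.task_spec (Nat.lt_succ_self _) ht
    rw [Nat.sub_self, pow_zero] at h5
    exact le_antisymm h5 (List.length_pos_iff.2 h4)

end Input

namespace Comp

variable {c : ℝ} {P : MinorProgram c} {a b : ℕ}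

/-- The polylogarithmic parameter. -/
def weight (i : Input P a b) : ℕ := i.Q * lg i.n

theorem bdd_q : Bdd (weight (P := P) (a := a) (b := b)) (fun _ => 0) fun i => i.q := Bdd.weight

theorem bdd_lg : Bdd (weight (P := P) (a := a) (b := b)) (fun _ => 0) fun i => lg i.n :=
  Bdd.weight.of_le fun i => Nat.le_mul_of_pos_left _ i.hQ

/-- The loop runs over the list of block lengths and replaces all tasks by their children. Each
round stays within the budget, and the number of rounds is logarithmic. -/
theorem rounds_of_tasks (hb : 0 < b) (hab : a ≤ b) :
    Comp (ι := Input P a b) weight (fun i => i.budget)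
      (fun i => .pair (.pair (.nat i.n) (.nat i.q)) (.pair (encList Val.nat (levels i.J))
        (encTask i.root))) fun i => encList encTask (i.tasksAt (i.J + 1)) := by
  have hJ : Bdd (weight (P := P) (a := a) (b := b)) (fun _ => 0) fun i => i.J :=
    bdd_lg.of_le fun i => topLevel_le hb hab i.hn
  have h1 := fold (ι := Input P a b) (w := weight) (N := fun i => i.budget)
    (x := fun i => .pair (.pair (.nat i.n) (.nat i.q)) (.pair (encList Val.nat (levels i.J))
        (encTask i.root))) (L := fun i => levels i.J) (e := fun _ => Val.nat)
    (S := fun i j => encList encTask (i.tasksAt j)) (M := fun i _ => i.budget)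
    ((snd (snd id)).pair (const 0)) (fst (snd id)) ?_ ?_
  · exact h1.of_eq fun i => by rw [length_levels]
  · refine ((hJ.add (Bdd.const 1)).mul (Bdd.self.add (Bdd.const 1))).of_le fun i => ?_
    rw [Finset.sum_const, Finset.card_range, smul_eq_mul, length_levels]
  · let I := Σ i : Input P a b, {j // j < (levels i.J).length}
    have hj : ∀ p : I, p.2.1 < p.1.J + 1 := fun p => p.2.2.trans_eq (length_levels _)
    refine of_eq (flatMap (ι := I) (κ := fun p => Task p.1.n) (κ' := fun p => Task p.1.n)
      (L := fun p => p.1.tasksAt p.2.1) (e := fun _ => encTask) (e' := fun _ => encTask)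
      (fun p => DynDist.children p.1.minor (2 ^ (p.1.J - p.2.1))) (fun p t => p.1.taskBudget p.2.1 t)
      (fst (snd id)) ?_ ?_ ?_) fun p => by rw [Input.tasksAt_succ _ (hj p)]
    · exact ((Bdd.const 2).mul (Bdd.self.add (Bdd.const 1))).of_le fun p =>
        Input.sum_taskBudget _ (hj p)
    · refine (Bdd.self.add (Bdd.const 1)).of_le fun p => ?_
      have h2 := (cut_spec (by positivity : 0 < 2 ^ (p.1.1.J - p.1.2.1)) p.2.1.2.2).2
      have h3 := (Input.task_bounds _ (hj p.1) p.2.2).2.2.2.1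
      rw [DynDist.children, length_subtasks]
      have h4 : 0 < 2 ^ (p.1.1.J - p.1.2.1) := by positivity
      have h5 : p.2.1.2.2.length ≤ p.2.1.2.2.length * 2 ^ (p.1.1.J - p.1.2.1) :=
        Nat.le_mul_of_pos_right _ h4
      refine le_trans ?_ (Nat.succ_le_succ h3)
      refine Nat.le_of_mul_le_mul_right (h2.trans ?_) h4
      rw [Nat.succ_mul]
      omega
    · let I' := Σ p : I, {t // t ∈ p.1.tasksAt p.2.1}
      have hbd : ∀ p : I', _ := fun p => p.1.1.task_bounds (hj p.1) p.2.2
      have hw : Bdd (ι := I') (fun p => weight p.1.1) (fun _ => 0)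
          fun p => 6 * P.C * (p.1.1.q * lg p.1.1.n) ^ P.d :=
        (Bdd.const (6 * P.C)).mul (((bdd_q.mul bdd_lg).pow P.d).comap fun p : I' => p.1.1)
      refine children (ι := I') (n := fun p => p.1.1.n) (q := fun p => p.1.1.q)
        (t := fun p => p.2.1) (h := fun p => 2 ^ (p.1.1.J - p.1.2.1))
        (a := fun p => p.1.1.activeBound p.1.2.1 p.2.1) P (fun p => p.1.1.hn) (fun p => p.1.1.q_pos)
        (bdd_lg.comap fun p : I' => p.1.1) (bdd_q.comap fun p : I' => p.1.1)
        (fun p => by positivity) ?_ (fun p => p.1.1.good (hj p.1).le _ p.2.2)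
        (fun p => (hbd p).2.2.2.2) ?_
        ((hw.mul Bdd.self).of_le fun p => (hbd p).1) (Bdd.self.of_le fun p => (hbd p).2.1)
        (((Bdd.const 6).mul Bdd.self).of_le fun p => (hbd p).2.2.1)
        (Bdd.self.of_le fun p => (hbd p).2.2.2.1)
      · refine ((hJ.add (Bdd.const 1)).comap fun p : I' => p.1.1).of_le fun p => ?_
        rw [Nat.size_pow]
        omega
      · have he : Comp (ι := I') (fun p => weight p.1.1) (fun p => p.1.1.taskBudget p.1.2.1 p.2.1)
          (fun p => .pair (.pair (.pair (.pair (.nat p.1.1.n) (.nat p.1.1.q))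
            (.pair (encList Val.nat (levels p.1.1.J)) (encTask p.1.1.root)))
            (.pair (encList encTask (p.1.1.tasksAt p.1.2.1)) (.nat ((levels p.1.1.J)[p.1.2.1]'p.1.2.2))))
            (encTask p.2.1)) fun p => .pair (.pair (.nat p.1.1.n) (.nat p.1.1.q))
            (.pair (.nat ((levels p.1.1.J)[p.1.2.1]'p.1.2.2)) (encTask p.2.1)) :=
          (fst (fst (fst id))).pair ((snd (snd (fst id))).pair (snd id))
        refine he.of_eq fun p => ?_
        rw [getElem_levels]

theorem natPow {ι : Type*} {w N : ι → ℕ} {x : ι → Val} {f : ι → ℕ} (m : ℕ)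
    (hf : Comp w N x fun i => .nat (f i)) (bf : Bdd w (fun _ => 0) fun i => (f i).size) :
    (Comp w N x fun i => .nat (f i ^ m)) ∧ Bdd w (fun _ => 0) fun i => (f i ^ m).size := by
  induction m with
  | zero => exact ⟨(const 1).of_eq fun i => by rw [pow_zero], Bdd.size_const 1⟩
  | succ m ih =>
    refine ⟨(natOp .mul ih.1 hf ih.2 bf).of_eq fun i => ?_, ?_⟩
    · rw [pow_succ]; rfl
    · simpa only [pow_succ] using Bdd.size_mul ih.2 bf

/-- The reciprocal precision `Q` is part of the input, so the exponent in the time bound does not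
depend on it. The number `D` occurs only in the budget and is unknown to the program. -/
theorem oracle (hb : 0 < b) (hab : a ≤ b) (hc : 0 ≤ c) :
    Comp (ι := Input P a b) weight (fun i => i.budget)
      (fun i => .pair (.nat i.Q) (.pair (.nat i.n) (.pair (encGraph i.G) (encList encOp i.ops))))
      fun i => encList encAnswer i.ans := by
  let X : Input P a b → Val := fun i =>
    .pair (.nat i.Q) (.pair (.nat i.n) (.pair (encGraph i.G) (encList encOp i.ops)))
  have hnat : Comp weight (fun _ => 0) X fun i => .nat i.n := fst (snd id)
  have hU : Comp weight (fun _ => 0) X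
      fun i => encList Val.nat (List.replicate (lg i.n) 0) := unary_lg (fun i => i.hn) bdd_lg hnat
  have hUl : Bdd (weight (P := P) (a := a) (b := b)) (fun _ => 0)
      fun i => (List.replicate (lg i.n) 0).length := bdd_lg.of_le fun i => by simp
  have hlg : Comp weight (fun _ => 0) X fun i => .nat (lg i.n) := by
    have h1 := fold (w := weight) (N := fun _ => 0) (x := X)
      (L := fun i => List.replicate (lg i.n) 0) (e := fun _ => Val.nat)
      (S := fun _ j => .nat j) (M := fun _ _ => 0) (const 0) hU (hUl.of_le fun i => by simp) (by
        let I := Σ i : Input P a b, {j // j < (List.replicate (lg i.n) 0).length}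
        exact natOp .add (fst (snd id)) (const 1)
          ((hUl.comap (Sigma.fst : I → _)).size_of.of_le fun p => Nat.size_le_size p.2.2.le)
          (Bdd.size_const 1))
    exact h1.of_eq fun i => by rw [List.length_replicate]
  have hq : Comp weight (fun _ => 0) X fun i => .nat i.q :=
    natOp .mul (fst id) hlg ((Bdd.weight (N := fun _ => 0)).size_of.of_le fun i =>
      Nat.size_le_size (Nat.le_mul_of_pos_right _ i.lg_pos)) bdd_lg.size_of
  have hlev : Comp weight (fun _ => 0) X fun i => encList Val.nat (levels (lg i.n)) := by
    have h1 := fold (w := weight) (N := fun _ => 0) (x := X)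
      (L := fun i => List.replicate (lg i.n) 0) (e := fun _ => Val.nat)
      (S := fun _ j => .pair (.nat (2 ^ j)) (encList Val.nat (levels j))) (M := fun _ _ => 0)
      ((const 1).pair ((const 1).pair (const 0))) hU (hUl.of_le fun i => by simp) (by
        let I := Σ i : Input P a b, {j // j < (List.replicate (lg i.n) 0).length}
        let Y : I → Val := fun p => .pair (X p.1) (.pair (.pair (.nat (2 ^ p.2.1))
          (encList Val.nat (levels p.2.1))) (.nat ((List.replicate (lg p.1.n) 0)[p.2.1]'p.2.2)))
        have h2 : Comp (ι := I) (fun p => weight p.1) (fun _ => 0) Y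
            fun p => .nat (2 ^ (p.2.1 + 1)) :=
          (natOp .mul (fst (fst (snd id))) (const 2)
            (((hUl.add (Bdd.const 1)).comap (Sigma.fst : I → _)).of_le fun p => by
              rw [Nat.size_pow]; have := p.2.2; omega) (Bdd.size_const 2)).of_eq
            fun p => by rw [pow_succ]; rfl
        exact h2.pair (h2.pair (snd (fst (snd id)))))
    exact (snd h1).of_eq fun i => by rw [List.length_replicate]
  have hhs : Comp weight (fun _ => 0) X fun i => encList Val.nat (levels i.J) := by
    have h1 := (hnat.pair hlev).trans (filter (w := weight) (N := fun _ => 0) (κ := fun _ => ℕ)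
      (e := fun _ => Val.nat)
      (x := fun i : Input P a b => .pair (.nat i.n) (encList Val.nat (levels (lg i.n))))
      (L := fun i => levels (lg i.n)) (fun i h => decide (h ^ b ≤ i.n ^ a)) (snd id)
      ((bdd_lg.add (Bdd.const 1)).of_le fun i => by rw [length_levels]) (by
        let I := Σ i : Input P a b, {h // h ∈ levels (lg i.n)}
        have h2 := natPow (ι := I) (w := fun p => weight p.1) (N := fun _ => 0)
          (x := fun p => .pair (.pair (.nat p.1.n) (encList Val.nat (levels (lg p.1.n))))
            (.nat p.2.1)) (f := fun p => p.2.1) b (snd id)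
          (((bdd_lg.add (Bdd.const 1)).comap (Sigma.fst : I → _)).of_le fun p => by
            obtain ⟨j, hj, h⟩ := mem_levels.1 p.2.2
            rw [h, Nat.size_pow]; omega)
        have h3 := natPow (ι := I) (w := fun p => weight p.1) (N := fun _ => 0)
          (x := fun p => .pair (.pair (.nat p.1.n) (encList Val.nat (levels (lg p.1.n))))
            (.nat p.2.1)) (f := fun p => p.1.n) a (fst (fst id))
          ((bdd_lg.comap (Sigma.fst : I → _)).of_le fun p => size_le_lg _)
        exact (Test.le h2.1 h3.1 h2.2 h3.2).congr fun p => by simp))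
    refine h1.of_eq fun i => ?_
    -- Among the powers of two up to `2 ^ lg n`, the admissible block lengths are an initial
    -- segment, and `topLevel_le` ensures that none is missed.
    rw [filter_levels (J := i.J) (fun j => ?_) (topLevel_le hb hab i.hn)]
    rw [decide_eq_true_eq]
    exact pow_le_iff_topLevel hb i.hn j
  have hroot : Comp weight (fun _ => 0) X fun i => encTask i.root :=
    (const 0).pair ((fst (snd (snd id))).pair (snd (snd (snd id))))
  have htasks := (of_zero (N := fun i => i.budget) ((hnat.pair hq).pair (hhs.pair hroot))).trans
    (rounds_of_tasks hb hab)
  refine htasks.trans ?_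
  have hspec : ∀ p : (Σ i : Input P a b, {t // t ∈ i.tasksAt (i.J + 1)}),
      p.2.1.2.2.length = 1 ∧ p.2.1.2.1.length ≤ 1 ∧
        p.2.1.1.length ≤ P.C * ⌈(2 : ℝ) ^ c⌉₊ * (p.1.q * lg p.1.n) ^ P.d := fun p => by
    obtain ⟨h1, h2, h3, _, h4⟩ := p.1.task_spec (Nat.lt_succ_self _) p.2.2
    rw [Nat.sub_self, pow_zero] at h2
    exact ⟨le_antisymm h2 (List.length_pos_iff.2 h1), h3.trans h2, h4 hc h2⟩
  refine flatMap (κ := fun i : Input P a b => Task i.n) (κ' := fun _ => ℝ≥0∞)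
    (e := fun _ => encTask) (e' := fun _ => encAnswer) (fun _ => DynDist.answers DynDist.shortest)
    (fun _ _ => 0) id ?_ ?_ ?_
  · refine Bdd.self.of_le fun i => ?_
    rw [Input.budget]
    have h1 := i.length_tasksAt (Nat.lt_succ_self _)
    have h2 : ((i.tasksAt (i.J + 1)).map fun _ => 0 + 1).sum ≤ i.ops.length := by
      rw [← h1]
      refine List.sum_le_sum fun t ht => ?_
      exact ((hspec ⟨i, t, ht⟩).1).ge
    exact h2.trans ((Nat.le_mul_of_pos_right _ i.D_pos).trans (Nat.le_add_left _ _))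
  · refine (Bdd.const 1).of_le fun p => ?_
    rw [DynDist.answers]
    refine (length_flatMap_le (m := 1) fun o _ => ?_).trans (by rw [(hspec p).1])
    cases o <;> simp
  · let I := Σ i : Input P a b, {t // t ∈ i.tasksAt (i.J + 1)}
    refine answers (n := fun p : I => p.1.n) (bdd_lg.comap Sigma.fst) ?_
      ((Bdd.const 1).of_le fun p => (hspec p).2.1) ((Bdd.const 1).of_le fun p => (hspec p).1.le)
      (snd id)
    exact ((Bdd.const (P.C * ⌈(2 : ℝ) ^ c⌉₊)).mul (((bdd_q.mul bdd_lg).pow P.d).comap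
      (Sigma.fst : I → _))).of_le fun p => (hspec p).2.2

end Comp

end DynDist

namespace DynDist

/-! ## Time bounds for the oracle -/

/-- From `1 + x ≤ exp x` the product is at most `exp (m / (Q * L)) ≤ exp (2 / Q)`, and `Q ≥ 2 / log
(1 + ε)` suffices. Here `L` is `lg n` and `m` the number of levels. -/
theorem exists_precision {ε : ℝ} (hε : 0 < ε) :
    ∃ Q : ℕ, 0 < Q ∧ ∀ L m : ℕ, 0 < L → m ≤ 2 * L →
      (1 + 1 / ((Q * L : ℕ) : ℝ)) ^ m ≤ 1 + ε := by
  have hlog : 0 < Real.log (1 + ε) := Real.log_pos (by linarith)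
  refine ⟨⌈2 / Real.log (1 + ε)⌉₊ + 1, Nat.succ_pos _, fun L m hL hm => ?_⟩
  set Q := ⌈2 / Real.log (1 + ε)⌉₊ + 1 with hQ
  have h1 : 2 / Real.log (1 + ε) ≤ Q := (Nat.le_ceil _).trans (by rw [hQ]; push_cast; linarith)
  have hL' : (0 : ℝ) < L := by exact_mod_cast hL
  have hQ' : (0 : ℝ) < Q := by rw [hQ]; positivity
  have h2 : (m : ℝ) * (1 / ((Q * L : ℕ) : ℝ)) ≤ Real.log (1 + ε) := by
    have hm' : (m : ℝ) ≤ 2 * L := by exact_mod_cast hm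
    rw [div_le_iff₀ hlog] at h1
    push_cast
    rw [mul_one_div, div_le_iff₀ (by positivity)]
    nlinarith
  calc (1 + 1 / ((Q * L : ℕ) : ℝ)) ^ m ≤ Real.exp (1 / ((Q * L : ℕ) : ℝ)) ^ m := by
        gcongr
        rw [add_comm]
        exact Real.add_one_le_exp _
    _ = Real.exp (m * (1 / ((Q * L : ℕ) : ℝ))) := (Real.exp_nat_mul _ _).symm
    _ ≤ Real.exp (Real.log (1 + ε)) := Real.exp_le_exp.2 h2
    _ = 1 + ε := Real.exp_log (by linarith)

/-- The oracle, with the relative sizes of the sparsifiers and the number of the longest blocks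
bounded by `D`. -/
theorem MinorProgram.exists_oracle {c : ℝ} (P : MinorProgram c) {a b : ℕ} (hb : 0 < b)
    (hab : a ≤ b) (hc : 0 ≤ c) :
    ∃ k : ℕ, ∀ ε' : ℝ, 0 < ε' → ∃ C : ℕ, ∀ D : ℕ → ℕ, (∀ n, 0 < n →
      (∀ m : ℕ, m ≤ 2 * 2 ^ topLevel a b n → (m : ℝ) ^ c ≤ m * D n) ∧
        n ≤ 2 ^ topLevel a b n * D n) →
      HasOfflineOracle ε' fun n => C * (lg n : ℝ) ^ k * D n := by
  obtain ⟨code, k, hcode⟩ := Comp.oracle (P := P) hb hab hc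
  refine ⟨k, fun ε' hε' => ?_⟩
  obtain ⟨Q, hQ, hQ2⟩ := exists_precision hε'
  -- Only here does `Q` become a constant of the program, after `k` has been fixed. The factor `(Q +
  -- 2) ^ k` comes from `Q * lg n + 2 ≤ (Q + 2) * lg n`, and `5` covers the four steps that supply
  -- `Q`.
  refine ⟨5 * (Q + 2) ^ k, fun D hD => ⟨.comp code (.pair (.const Q) .id),
    fun n hn G ops hG hrun => ?_⟩⟩
  let i : Input P a b := ⟨n, Q, D n, G, ops, hn, hQ, hG, hrun, (hD n hn).1, (hD n hn).2⟩
  obtain ⟨t, h1, h2⟩ := hcode i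
  refine ⟨i.ans, 1 + 1 + 1 + t + 1, .comp (.pair (.const _ _) (.id _)) h1, ?_,
    i.approxAnswers (hQ2 _ _ i.lg_pos ?_)⟩
  · have hD1 : 1 ≤ D n := i.D_pos
    have hlg : 1 ≤ lg n := i.lg_pos
    have h3 : Q * lg n + 2 ≤ (Q + 2) * lg n := by nlinarith
    have h4 : G.length + ops.length * D n + 1 ≤ (G.length + ops.length + 1) * D n := by
      nlinarith [Nat.zero_le G.length]
    have h5 : t ≤ ((Q + 2) * lg n) ^ k * ((G.length + ops.length + 1) * D n) :=
      h2.trans (Nat.mul_le_mul (Nat.pow_le_pow_left h3 k) h4)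
    have h6 : 1 ≤ ((Q + 2) * lg n) ^ k * ((G.length + ops.length + 1) * D n) :=
      Nat.mul_pos (pow_pos (Nat.mul_pos (by omega) hlg) k) (Nat.mul_pos (by omega) hD1)
    have h7 : 1 + 1 + 1 + t + 1 ≤
        5 * (((Q + 2) * lg n) ^ k * ((G.length + ops.length + 1) * D n)) := by omega
    have h8 : ((1 + 1 + 1 + t + 1 : ℕ) : ℝ) ≤
        5 * ((((Q : ℝ) + 2) * lg n) ^ k * ((G.length + ops.length + 1) * D n)) := by
      exact_mod_cast h7
    refine h8.trans (le_of_eq ?_)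
    rw [mul_pow]
    push_cast
    ring
  · have := topLevel_le (a := a) hb hab hn
    have h3 : 1 ≤ lg n := i.lg_pos
    change topLevel a b n + 1 ≤ 2 * lg n
    omega

/-- Apply `log n ≤ n ^ η / η` with `η = δ / (k + 1)`; the denominator `k + 1` also covers `k = 0`.
-/
theorem lg_pow_le (k : ℕ) {δ : ℝ} (hδ : 0 < δ) :
    ∃ K : ℝ, 0 ≤ K ∧ ∀ n : ℕ, 0 < n → (lg n : ℝ) ^ k ≤ K * (n : ℝ) ^ δ := by
  set η := δ / (k + 1) with hη
  have hη0 : 0 < η := by positivity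
  have hlog2 := Real.log_pos (by norm_num : (1 : ℝ) < 2)
  refine ⟨(1 + 1 / (η * Real.log 2)) ^ k, by positivity, fun n hn => ?_⟩
  have hn1 : (1 : ℝ) ≤ n := by exact_mod_cast hn
  have hn0 : (0 : ℝ) ≤ n := by positivity
  have h1 : (lg n : ℝ) ≤ (1 + 1 / (η * Real.log 2)) * (n : ℝ) ^ η := by
    have h2 : ((Nat.log 2 n : ℕ) : ℝ) ≤ Real.log n / Real.log 2 := by
      rw [Real.log_div_log]
      exact_mod_cast Real.natLog_le_logb n 2
    have h3 := Real.log_le_rpow_div hn0 hη0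
    have h4 := Real.one_le_rpow hn1 hη0.le
    have h5 : Real.log n / Real.log 2 ≤ (n : ℝ) ^ η / η / Real.log 2 := by gcongr
    rw [lg]
    push_cast
    rw [add_mul, one_mul]
    have h6 : (n : ℝ) ^ η / η / Real.log 2 = 1 / (η * Real.log 2) * (n : ℝ) ^ η := by
      field_simp
    linarith
  calc (lg n : ℝ) ^ k ≤ ((1 + 1 / (η * Real.log 2)) * (n : ℝ) ^ η) ^ k := by gcongr
    _ = (1 + 1 / (η * Real.log 2)) ^ k * (n : ℝ) ^ (η * k) := by
        rw [mul_pow, Real.rpow_mul hn0, Real.rpow_natCast]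
    _ ≤ _ := by
        gcongr
        rw [hη, div_mul_eq_mul_div, div_le_iff₀ (by positivity)]
        nlinarith

theorem two_pow_topLevel {a b n : ℕ} (hb : 0 < b) (hn : 0 < n) :
    (2 : ℝ) ^ topLevel a b n ≤ (n : ℝ) ^ ((a : ℝ) / b) ∧
      (n : ℝ) ^ ((a : ℝ) / b) ≤ 2 * 2 ^ topLevel a b n := by
  have hn0 : (0 : ℝ) ≤ n := by positivity
  have hb' : b ≠ 0 := hb.ne'
  have hpow : ((n : ℝ) ^ ((a : ℝ) / b)) ^ b = (n : ℝ) ^ a := by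
    rw [← Real.rpow_natCast, ← Real.rpow_mul hn0, div_mul_cancel₀ _ (by exact_mod_cast hb'),
      Real.rpow_natCast]
  constructor
  · have h1 : ((2 : ℝ) ^ topLevel a b n) ^ b ≤ (n : ℝ) ^ a := by
      exact_mod_cast (pow_le_iff_topLevel (a := a) hb hn _).2 le_rfl
    rw [← hpow] at h1
    exact le_of_pow_le_pow_left₀ hb' (by positivity) h1
  · have h1 : (n : ℝ) ^ a ≤ ((2 : ℝ) ^ (topLevel a b n + 1)) ^ b := by
      have h2 := mt (pow_le_iff_topLevel (a := a) hb hn (topLevel a b n + 1)).1 (by omega)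
      exact_mod_cast (not_le.1 h2).le
    rw [← hpow] at h1
    have h3 := le_of_pow_le_pow_left₀ hb' (by positivity) h1
    rwa [pow_succ'] at h3

theorem HasOfflineOracle.mono {ε : ℝ} {u v : ℕ → ℝ} (h : HasOfflineOracle ε u)
    (huv : ∀ n, 0 < n → u n ≤ v n) : HasOfflineOracle ε v := by
  obtain ⟨Q, hQ⟩ := h
  refine ⟨Q, fun n hn G ops hG hrun => ?_⟩
  obtain ⟨ans, t, h1, h2, h3⟩ := hQ n hn G ops hG hrun
  exact ⟨ans, t, h1, h2.trans (mul_le_mul_of_nonneg_left (huv n hn) (by positivity)), h3⟩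

theorem HasMinorAlgorithm.oracle_polylog (h : HasMinorAlgorithm 1) :
    ∃ d : ℕ, ∀ ε' : ℝ, 0 < ε' → ∃ C : ℝ,
      HasOfflineOracle ε' (fun n => C * (lg n : ℝ) ^ d) := by
  obtain ⟨P⟩ := h.nonempty
  obtain ⟨k, hk⟩ := P.exists_oracle (a := 1) (b := 1) one_pos le_rfl zero_le_one
  refine ⟨k, fun ε' hε' => ?_⟩
  obtain ⟨C, hC⟩ := hk ε' hε'
  -- For `c = 1` the sparsifiers are linear, and the longest blocks have length at least `n / 2`, so
  -- `D = 2` serves both purposes.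
  refine ⟨C * 2, (hC (fun _ => 2) fun n hn => ⟨fun m _ => ?_, ?_⟩).mono fun n _ => le_of_eq ?_⟩
  · rw [Real.rpow_one]
    have : (0 : ℝ) ≤ m := by positivity
    push_cast
    linarith
  · have := (two_pow_topLevel (a := 1) one_pos hn).2
    simp only [Nat.cast_one, div_one, Real.rpow_one] at this
    rw [mul_comm]
    exact_mod_cast this
  · push_cast
    ring

theorem HasMinorAlgorithm.oracle_rpow {γ : ℝ} (hγ : 0 < γ) (hγ' : γ ≤ 1 / 3)
    (h : HasMinorAlgorithm (2 / (1 + 3 * γ))) (ε' : ℝ) (hε' : 0 < ε') :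
    ∃ C : ℝ, HasOfflineOracle ε' (fun n => C * (n : ℝ) ^ (1 / 2 - γ / 2)) := by
  obtain ⟨P⟩ := h.nonempty
  set c := 2 / (1 + 3 * γ) with hc
  have hc1 : 1 ≤ c := by rw [hc, le_div_iff₀ (by linarith)]; linarith
  have hc2 : c ≤ 2 := by rw [hc, div_le_iff₀ (by linarith)]; linarith
  -- The lower bound on `r` makes `1 - r < 1/2 - γ/2`, for the cost of the top level; the upper one
  -- gives `r * (c - 1) ≤ 1/2 - 3 * γ / 2`, for the sparsifiers. There is room between them because
  -- `γ > 0`.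
  obtain ⟨r, hr1, hr2⟩ := exists_rat_btwn (show 1 / 2 + γ / 2 < 1 / 2 + 3 * γ / 2 by linarith)
  have hr0 : (0 : ℝ) < r := by linarith
  have hr0' : 0 < r := by exact_mod_cast hr0
  have hθ : ((r.num.toNat : ℕ) : ℝ) / r.den = r := by
    have h1 : ((r.num.toNat : ℕ) : ℤ) = r.num := Int.toNat_of_nonneg (Rat.num_nonneg.2 hr0'.le)
    have h2 : ((r.num.toNat : ℕ) : ℝ) = (r.num : ℝ) := by exact_mod_cast h1
    rw [h2]
    exact_mod_cast Rat.num_div_den r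
  set a := r.num.toNat with ha
  set b := r.den with hb
  have hb0 : 0 < b := r.den_pos
  have hab : a ≤ b := by
    have h1 : (a : ℝ) / b ≤ 1 := by rw [hθ]; linarith
    rw [div_le_one (by exact_mod_cast hb0)] at h1
    exact_mod_cast h1
  obtain ⟨k, hk⟩ := P.exists_oracle hb0 hab (by linarith)
  obtain ⟨C, hC⟩ := hk ε' hε'
  set e := max (1 - (r : ℝ)) (1 / 2 - 3 * γ / 2) with he
  have he0 : 0 ≤ e := (by linarith : (0 : ℝ) ≤ 1 / 2 - 3 * γ / 2).trans (le_max_right _ _)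
  have he1 : e < 1 / 2 - γ / 2 := max_lt (by linarith) (by linarith)
  obtain ⟨K, hK0, hK⟩ := lg_pow_le k (sub_pos.2 he1)
  -- The factor `2` in `D` covers both `2 ^ (c - 1) ≤ 2` and the rounding of `n ^ r` to a power of
  -- two. The ceiling is at most `3 * n ^ e`, since `n ^ e ≥ 1`.
  refine ⟨C * K * 3, (hC (fun n => ⌈2 * (n : ℝ) ^ e⌉₊) fun n hn => ?_).mono fun n hn => ?_⟩
  · have hn1 : (1 : ℝ) ≤ n := by exact_mod_cast hn
    have hn0 : (0 : ℝ) < n := by linarith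
    obtain ⟨h1, h2⟩ := two_pow_topLevel (a := a) hb0 hn
    rw [hθ] at h1 h2
    have hceil := Nat.le_ceil (2 * (n : ℝ) ^ e)
    constructor
    · intro m hm
      rcases Nat.eq_zero_or_pos m with rfl | hm0
      · rw [Nat.cast_zero, Real.zero_rpow (by linarith), zero_mul]
      have hm0' : (0 : ℝ) < m := by exact_mod_cast hm0
      have hm' : (m : ℝ) ≤ 2 * (n : ℝ) ^ (r : ℝ) := by
        have : (m : ℝ) ≤ 2 * 2 ^ topLevel a b n := by exact_mod_cast hm
        linarith
      have h3 : (m : ℝ) ^ c = m * (m : ℝ) ^ (c - 1) := by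
        rw [← Real.rpow_one_add' hm0'.le (by linarith)]
        congr 1
        ring
      rw [h3]
      refine mul_le_mul_of_nonneg_left (le_trans ?_ hceil) hm0'.le
      calc (m : ℝ) ^ (c - 1) ≤ (2 * (n : ℝ) ^ (r : ℝ)) ^ (c - 1) :=
            Real.rpow_le_rpow hm0'.le hm' (by linarith)
        _ = 2 ^ (c - 1) * (n : ℝ) ^ (r * (c - 1)) := by
            rw [Real.mul_rpow (by norm_num) (by positivity), ← Real.rpow_mul hn0.le]
        _ ≤ 2 * (n : ℝ) ^ e := by
            gcongr
            · calc (2 : ℝ) ^ (c - 1) ≤ 2 ^ (1 : ℝ) :=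
                    Real.rpow_le_rpow_of_exponent_le (by norm_num) (by linarith)
                _ = 2 := Real.rpow_one 2
            · refine le_trans ?_ (le_max_right _ _)
              -- With `r ≤ (1 + 3 * γ) / 2` the factor `1 + 3 * γ` cancels, and `(1 - 3 * γ) / 2`
              -- remains.
              have h4 : c - 1 = (1 - 3 * γ) / (1 + 3 * γ) := by rw [hc]; field_simp; ring
              rw [h4, mul_div_assoc', div_le_iff₀ (by linarith)]
              nlinarith
    · have h3 : (n : ℝ) = (n : ℝ) ^ (r : ℝ) * (n : ℝ) ^ (1 - (r : ℝ)) := by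
        rw [← Real.rpow_add hn0]
        simp
      have h4 : (n : ℝ) ^ (1 - (r : ℝ)) ≤ (n : ℝ) ^ e :=
        Real.rpow_le_rpow_of_exponent_le hn1 (le_max_left _ _)
      have h5 : (n : ℝ) ≤ 2 ^ topLevel a b n * (⌈2 * (n : ℝ) ^ e⌉₊ : ℝ) := by
        calc (n : ℝ) = (n : ℝ) ^ (r : ℝ) * (n : ℝ) ^ (1 - (r : ℝ)) := h3
          _ ≤ (2 * 2 ^ topLevel a b n) * (n : ℝ) ^ e := by gcongr
          _ = 2 ^ topLevel a b n * (2 * (n : ℝ) ^ e) := by ring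
          _ ≤ _ := by gcongr
      exact_mod_cast h5
  · have hn1 : (1 : ℝ) ≤ n := by exact_mod_cast hn
    have hn0 : (0 : ℝ) < n := by linarith
    have h1 : (1 : ℝ) ≤ (n : ℝ) ^ e := Real.one_le_rpow hn1 he0
    have h2 : ((⌈2 * (n : ℝ) ^ e⌉₊ : ℕ) : ℝ) ≤ 3 * (n : ℝ) ^ e := by
      have := (Nat.ceil_lt_add_one (by positivity : 0 ≤ 2 * (n : ℝ) ^ e)).le
      linarith
    calc (C : ℝ) * (lg n : ℝ) ^ k * (⌈2 * (n : ℝ) ^ e⌉₊ : ℕ)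
        ≤ C * (K * (n : ℝ) ^ (1 / 2 - γ / 2 - e)) * (3 * (n : ℝ) ^ e) := by
          gcongr
          exact hK n hn
      _ = C * K * 3 * ((n : ℝ) ^ (1 / 2 - γ / 2 - e) * (n : ℝ) ^ e) := by ring
      _ = C * K * 3 * (n : ℝ) ^ (1 / 2 - γ / 2) := by
          rw [← Real.rpow_add hn0]
          congr 2
          ring

end DynDist

theorem mainTheorem12 (γ : ℝ) (hγ : 0 < γ) (hγ' : γ ≤ 1 / 3) :
    -- sparsifiers of size `k ^ (2 / (1 + 3γ)) * poly(1 / ε, log n)`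
    (DynDist.HasMinorAlgorithm (2 / (1 + 3 * γ)) →
      ∀ ε' : ℝ, 0 < ε' → ∃ C : ℝ,
        DynDist.HasOfflineOracle ε' (fun n => C * (n : ℝ) ^ (1 / 2 - γ / 2))) ∧
    -- sparsifiers of size `k * poly(1 / ε, log n)`
    (DynDist.HasMinorAlgorithm 1 →
      ∃ d : ℕ, ∀ ε' : ℝ, 0 < ε' → ∃ C : ℝ,
        DynDist.HasOfflineOracle ε' (fun n => C * (DynDist.lg n : ℝ) ^ d)) ∧
    -- all the graphs of a hierarchy of sparsifiers over a planar dynamic graph are planar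
    (∀ (ε : ℝ) (n : ℕ) (G : DynDist.WGraph n) (ops : List (DynDist.Op n)),
      G.Simple → DynDist.PlanarRun G ops →
      ∀ (r s : ℕ) (G'' G' : DynDist.WGraph n), DynDist.Hierarchy ε G ops r s G'' G' →
        DynDist.IsPlanar G''.toGraph ∧ DynDist.IsPlanar G'.toGraph) := by
  refine ⟨fun h => h.oracle_rpow hγ hγ', fun h => h.oracle_polylog,
    fun ε n G ops _ hrun r s G'' G' h => h.planar hrun⟩
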